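/- All graphs are finite and simple. A graph $H$ is a minor of a graph $G$ if $H$ can be obtained, up to isomorphism, from a subgraph of $G$ by contracting edges (deleting resulting loops and parallel edges). For positive integers $t,s$, let $\mathcal{K}_t^{-s}$ be the family of all graphs obtained from the complete graph $K_t$ by deleting exactly $s$ edges; $G$ has a $\mathcal{K}_t^{-s}$ minor if some $H\in\mathcal{K}_t^{-s}$ is a minor of $G$. Let $K_8^{=}$ be the graph obtained from $K_8$ by deleting two independent (vertex-disjoint) edges. For a graph $H$ and an integer $k\ge 1$, $(H,k)$-cockades are defined recursively: every graph isomorphic to $H$ is an $(H,k)$-cockade; if $G_1$ and $G_2$ are $(H,k)$-cockades and $G$ is obtained from their disjoint union by identifying a clique of size $k$ in $G_1$ with a clique of size $k$ in $G_2$, then $G$ is an $(H,k)$-cockade; and every $(H,k)$-cockade arises in this way. Theorem. (i) Every graph on $n\ge 9$ vertices with at least $5n-14$ edges has a $\mathcal{K}_9^{-6}$ minor. (ii) This is best possible in the sense that every $(K_8^{=},4)$-cockade on $n$ vertices has exactly $5n-14$ edges but has no $\mathcal{K}_9^{-5}$ minor. -/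

import Mathlib

universe u v

/-- `IsContraction G H`: up to isomorphism, `H` is obtained from `G` by contracting edges, loops and
parallel edges being deleted. Contracting a set of edges merges the vertices of each connected
piece into one vertex, so it is given by a map `f` onto the vertices of `H` with connected (in
particular nonempty) fibres; two distinct vertices of `H` are adjacent exactly when some edge
of `G` joins their fibres. -/
def SimpleGraph.IsContraction {V W : Type*} (G : SimpleGraph V) (H : SimpleGraph W) : Prop :=
  ∃ f : V → W,
    (∀ w : W, (G.induce (f ⁻¹' {w})).Connected) ∧
    ∀ a b : W, H.Adj a b ↔ a ≠ b ∧ ∃ x y : V, f x = a ∧ f y = b ∧ G.Adj x y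

/-- `H` is a minor of `G`: it can be obtained from a subgraph of `G` by contracting edges. -/
def SimpleGraph.IsMinorOf {W V : Type*} (H : SimpleGraph W) (G : SimpleGraph V) : Prop :=
  ∃ S : G.Subgraph, S.coe.IsContraction H

/-- The family `𝒦ₜ⁻ˢ` of the graphs obtained from the complete graph `Kₜ` (on the vertex set
`Fin t`) by deleting exactly `s` edges. -/
def completeMinusEdges (t s : ℕ) : Set (SimpleGraph (Fin t)) :=
  {H | ∃ D : Finset (Sym2 (Fin t)),
    (D : Set (Sym2 (Fin t))) ⊆ (⊤ : SimpleGraph (Fin t)).edgeSet ∧ D.card = s ∧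
      H = (⊤ : SimpleGraph (Fin t)).deleteEdges D}

/-- `G` has a `𝒦ₜ⁻ˢ` minor: some member of the family `𝒦ₜ⁻ˢ` is a minor of `G`. -/
def SimpleGraph.HasCompleteMinusMinor {V : Type*} (G : SimpleGraph V) (t s : ℕ) : Prop :=
  ∃ H ∈ completeMinusEdges t s, H.IsMinorOf G

/-- The graph `K₈⁼`: the complete graph on eight vertices with two independent edges deleted. -/
def completeEightMinusTwoIndependent : SimpleGraph (Fin 8) :=
  (⊤ : SimpleGraph (Fin 8)).deleteEdges {s(0, 1), s(2, 3)}

/-- `(H, k)`-cockades. A graph isomorphic to `H` is one. If `G₁` and `G₂` are `(H, k)`-cockades, so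
is every graph `G` obtained from their disjoint union by identifying a `k`-clique `K₁` of `G₁` with
a `k`-clique `K₂` of `G₂`. Here `f₁` and `f₂` are the resulting inclusions of the two vertex sets
into that of `G`: together they are onto, and their images overlap exactly in the identified
clique. -/
inductive SimpleGraph.IsCockade {U : Type v} (H : SimpleGraph U) (k : ℕ) :
    ∀ {V : Type u}, SimpleGraph V → Prop
  | base {V : Type u} (G : SimpleGraph V) (e : Nonempty (G ≃g H)) : IsCockade H k G
  | glue {V₁ V₂ V : Type u} (G₁ : SimpleGraph V₁) (G₂ : SimpleGraph V₂) (G : SimpleGraph V)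
      (h₁ : IsCockade H k G₁) (h₂ : IsCockade H k G₂)
      (K₁ : Finset V₁) (K₂ : Finset V₂) (hK₁ : G₁.IsNClique k K₁) (hK₂ : G₂.IsNClique k K₂)
      (f₁ : V₁ ↪ V) (f₂ : V₂ ↪ V)
      (cover : Set.range f₁ ∪ Set.range f₂ = Set.univ)
      (overlap₁ : Set.range f₁ ∩ Set.range f₂ = f₁ '' K₁)
      (overlap₂ : Set.range f₁ ∩ Set.range f₂ = f₂ '' K₂)
      (hG : G = G₁.map f₁ ⊔ G₂.map f₂) : IsCockade H k G

/-! Part (i). A graph on nine vertices contains a member of the family as soon as it has 30 edges.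
So a smallest counterexample, thinned to exactly 5n - 14 edges, has n ≥ 10, its minors on m vertices
with 9 ≤ m < n have at most 5m - 15 edges, and its minors on nine vertices have at most 29. This is
`IsCritical`; the work is to show that no such graph exists. Edges are counted twice throughout,
whence the constants 28, 30, 58 and 60.

Deleting a vertex gives minimum degree 6, and contracting an edge puts every edge in five triangles;
hence a vertex of N(v) has at most d(v) - 6 non-neighbours in N(v). Adding the edge bounds for the
two sides of a small cut, after contracting either side onto the cut, gives 5-connectedness
(`five_le_card_outer`). So every component outside N[v] is attached to at least five vertices of
N(v), and contracting it onto one of them adds edges to the dense graph N[v]. This excludes degrees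
7 and 8.

If d(v) = 6, then N[v] is a K₇. Menger's theorem links v by five disjoint connected sets to any
non-adjacent w; contracting them and one further set near w gives nine bags with 30 adjacencies when
w has degree 6 or 9 (`false_of_connections`). A vertex of degree 9 cannot be adjacent to v either,
so every vertex outside N[v] has degree at least 10, and the degree sum 10n - 28 then forces N[v] to
be an isolated K₇, which is absurd.

Hence all degrees are at least 9, and the degree sum yields vertices of degree 9
(`false_of_nine_le`). Take a largest connected C missing N[v] for some v of degree 9. By
`false_of_attached`, C is not attached to all the relevant vertices of N(v), so there is another
component outside N[v], and it contains a second vertex w of degree 9. By maximality the boundary S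
of C lies in N(v) ∩ N(w). Contracting v and w into C ∪ S, and C into the complement of C, gives two
minors with too many edges in total.

Part (ii). The induction proves more: no cockade has 8 bags missing at most one adjacency, or 9 bags
missing at most five. In a sum over a 4-clique at most four bags meet the clique, and bags missing
opposite sides are not joined. Few missing adjacencies therefore force nearly all bags to meet one
side, to which the model restricts (`IsSeparation.hasModel_of_sum`). -/

namespace DenseMinor
-- Connected sets of vertices
section
open scoped Classical
open Finset

variable {V : Type*}

/-- A finite set of vertices is connected if every proper nonempty part of it is joined to the
rest by an edge. -/
def Conn (G : SimpleGraph V) (C : Finset V) : Prop :=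
  C.Nonempty ∧ ∀ A ⊆ C, A.Nonempty → A ≠ C → ∃ a ∈ A, ∃ b ∈ C \ A, G.Adj a b

/-- The cut form of connectedness serves the extremal arguments; this is its link to the walks in
the definition of a minor. -/
theorem conn_iff_induce_connected {G : SimpleGraph V} {C : Finset V} :
    Conn G C ↔ (G.induce (C : Set V)).Connected := by
  constructor
  · rintro ⟨⟨x, hx⟩, h⟩
    rw [SimpleGraph.connected_iff_exists_forall_reachable]
    refine ⟨⟨x, hx⟩, ?_⟩
    by_contra hcon
    push Not at hcon
    obtain ⟨⟨w, hw⟩, hnw⟩ := hcon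
    obtain ⟨a, ha, b, hb, hab⟩ := h
      (C.filter fun y => ∃ hy : y ∈ (C : Set V),
        (G.induce (C : Set V)).Reachable ⟨x, hx⟩ ⟨y, hy⟩) (filter_subset _ _)
      ⟨x, by simp only [mem_filter]; exact ⟨hx, hx, SimpleGraph.Reachable.refl _⟩⟩
      (by
        intro heq
        have : w ∈ C := hw
        rw [← heq, mem_filter] at this
        obtain ⟨_, _, h2⟩ := this
        exact hnw h2)
    rw [mem_filter] at ha
    obtain ⟨haC, hy, hr⟩ := ha
    rw [mem_sdiff, mem_filter] at hb
    refine hb.2 ⟨hb.1, hb.1, hr.trans (SimpleGraph.Adj.reachable ?_)⟩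
    simpa using hab
  · intro h
    obtain ⟨⟨x, hx⟩⟩ := h.nonempty
    refine ⟨⟨x, hx⟩, fun A hA hne hAC => ?_⟩
    by_contra hcon
    push Not at hcon
    obtain ⟨a, ha⟩ := hne
    apply hAC
    refine subset_antisymm hA fun y hy => ?_
    obtain ⟨p⟩ := h.preconnected ⟨a, hA ha⟩ ⟨y, hy⟩
    have key : ∀ (u v : (C : Set V)) (p : (G.induce (C : Set V)).Walk u v),
        u.1 ∈ A → v.1 ∈ A := by
      intro u v p
      induction p with
      | nil => exact id
      | @cons u v w hadj p ih =>
        intro hu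
        apply ih
        by_contra hv
        exact hcon u.1 hu v.1 (mem_sdiff.2 ⟨v.2, hv⟩) (by simpa using hadj)
    exact key _ _ p ha

theorem Conn.mono {G G' : SimpleGraph V} (h : G ≤ G') {C : Finset V} (hC : Conn G C) :
    Conn G' C :=
  ⟨hC.1, fun A hA hne hAC => by
    obtain ⟨a, ha, b, hb, hab⟩ := hC.2 A hA hne hAC
    exact ⟨a, ha, b, hb, h hab⟩⟩

theorem conn_singleton (G : SimpleGraph V) (x : V) : Conn G {x} :=
  ⟨singleton_nonempty x, fun A hA hne hAC => by
    rcases subset_singleton_iff.1 hA with rfl | rfl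
    · exact absurd hne (by simp)
    · exact absurd rfl hAC⟩

theorem conn_union {G : SimpleGraph V} {A B : Finset V} (hA : Conn G A) (hB : Conn G B)
    (h : (∃ x, x ∈ A ∧ x ∈ B) ∨ ∃ a ∈ A, ∃ b ∈ B, G.Adj a b) : Conn G (A ∪ B) := by
  rw [conn_iff_induce_connected] at *
  rw [coe_union]
  rcases h with ⟨x, hx⟩ | ⟨a, ha, b, hb, hab⟩
  · exact SimpleGraph.induce_union_connected hA.preconnected hB.preconnected ⟨x, hx⟩
  · exact SimpleGraph.connected_induce_union hA.preconnected hB.preconnected ha hb hab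

theorem conn_insert {G : SimpleGraph V} {A : Finset V} {x a : V} (hA : Conn G A) (ha : a ∈ A)
    (h : G.Adj a x) : Conn G (insert x A) := by
  rw [insert_eq, union_comm]
  exact conn_union hA (conn_singleton G x) (Or.inr ⟨a, ha, x, mem_singleton_self x, h⟩)

theorem conn_pair {G : SimpleGraph V} {a b : V} (h : G.Adj a b) : Conn G {a, b} :=
  conn_insert (conn_singleton G b) (mem_singleton_self b) h.symm

theorem conn_of_dominating {G : SimpleGraph V} {C : Finset V} {x : V} (hx : x ∈ C)
    (h : ∀ y ∈ C, y ≠ x → G.Adj x y) : Conn G C := by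
  refine ⟨⟨x, hx⟩, fun A hA hne hAC => ?_⟩
  by_cases hxA : x ∈ A
  · obtain ⟨y, hy⟩ : ∃ y, y ∈ C \ A := by
      by_contra hcon
      push Not at hcon
      exact hAC (subset_antisymm hA fun y hy => by
        by_contra hyA
        exact hcon y (mem_sdiff.2 ⟨hy, hyA⟩))
    exact ⟨x, hxA, y, hy, h y (mem_sdiff.1 hy).1 fun hyx => (mem_sdiff.1 hy).2 (hyx ▸ hxA)⟩
  · obtain ⟨a, ha⟩ := hne
    exact ⟨a, ha, x, mem_sdiff.2 ⟨hx, hxA⟩, (h a (hA ha) fun hax => hxA (hax ▸ ha)).symm⟩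

/-- A part that splits some bag is left by an edge inside that bag. Otherwise it is a union of bags,
and an edge of the quotient leaves it. -/
theorem conn_biUnion {ι : Type*} {G : SimpleGraph V} {G' : SimpleGraph ι} {Q : Finset ι}
    {φ : ι → Finset V} (hQ : Conn G' Q) (hφ : ∀ q ∈ Q, Conn G (φ q))
    (hadj : ∀ x ∈ Q, ∀ y ∈ Q, G'.Adj x y → ∃ a ∈ φ x, ∃ b ∈ φ y, G.Adj a b) :
    Conn G (Q.biUnion φ) := by
  obtain ⟨q0, hq0⟩ := hQ.1
  obtain ⟨x0, hx0⟩ := (hφ q0 hq0).1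
  refine ⟨⟨x0, mem_biUnion.2 ⟨q0, hq0, hx0⟩⟩, fun A hA hne hAC => ?_⟩
  by_cases hsplit : ∃ q ∈ Q, (A ∩ φ q).Nonempty ∧ A ∩ φ q ≠ φ q
  · obtain ⟨q, hq, h1, h2⟩ := hsplit
    obtain ⟨a, ha, b, hb, hab⟩ := (hφ q hq).2 _ inter_subset_right h1 h2
    rw [mem_inter] at ha
    rw [mem_sdiff, mem_inter] at hb
    exact ⟨a, ha.1, b, mem_sdiff.2 ⟨mem_biUnion.2 ⟨q, hq, hb.1⟩, fun h => hb.2 ⟨h, hb.1⟩⟩, hab⟩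
  · push Not at hsplit
    obtain ⟨a, ha⟩ := hne
    obtain ⟨q1, hq1, ha1⟩ := mem_biUnion.1 (hA ha)
    obtain ⟨p, hp, r, hr, hpr⟩ := hQ.2 (Q.filter fun q => φ q ⊆ A) (filter_subset _ _)
      ⟨q1, mem_filter.2 ⟨hq1, inter_eq_right.1 (hsplit q1 hq1 ⟨a, mem_inter.2 ⟨ha, ha1⟩⟩)⟩⟩
      (by
        intro heq
        apply hAC
        refine subset_antisymm hA fun y hy => ?_
        obtain ⟨q, hq, hyq⟩ := mem_biUnion.1 hy
        rw [← heq, mem_filter] at hq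
        exact hq.2 hyq)
    rw [mem_filter] at hp
    rw [mem_sdiff, mem_filter] at hr
    obtain ⟨u, hu, w, hw, huw⟩ := hadj p hp.1 r hr.1 hpr
    refine ⟨u, hp.2 hu, w, mem_sdiff.2 ⟨mem_biUnion.2 ⟨r, hr.1, hw⟩, fun hwA => ?_⟩, huw⟩
    exact hr.2 ⟨hr.1, inter_eq_right.1 (hsplit r hr.1 ⟨w, mem_inter.2 ⟨hwA, hw⟩⟩)⟩

/-- A largest connected set that avoids `F` and contains `z`. -/
theorem exists_component [Fintype V] (G : SimpleGraph V) {F : Finset V} {z : V} (hz : z ∉ F) :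
    ∃ C, Conn G C ∧ z ∈ C ∧ Disjoint C F ∧ ∀ c ∈ C, ∀ x, x ∉ C → G.Adj c x → x ∈ F := by
  obtain ⟨C, hC, hmax⟩ := exists_max_image
    ((univ : Finset (Finset V)).filter fun C => Conn G C ∧ z ∈ C ∧ Disjoint C F) card
    ⟨{z}, by simp [conn_singleton, hz]⟩
  simp only [mem_filter, mem_univ, true_and] at hC hmax
  refine ⟨C, hC.1, hC.2.1, hC.2.2, fun c hc x hx hcx => ?_⟩
  by_contra hxF
  have := hmax (insert x C) ⟨conn_insert hC.1 hc hcx, mem_insert_of_mem hC.2.1, by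
    rw [disjoint_insert_left]; exact ⟨hxF, hC.2.2⟩⟩
  rw [card_insert_of_notMem hx] at this
  omega

/-- A connected set that contains `b` and meets `A` contains one with just one vertex in `A`. -/
theorem Conn.exists_subset_inter_eq_singleton [Fintype V] {G : SimpleGraph V} {P A : Finset V}
    {a b : V} (hP : Conn G P) (hb : b ∈ P) (haP : a ∈ P) (haA : a ∈ A) :
    ∃ P' ⊆ P, Conn G P' ∧ b ∈ P' ∧ ∃ x, P' ∩ A = {x} := by
  by_cases hbA : b ∈ A
  · exact ⟨{b}, by simpa using hb, conn_singleton G b, mem_singleton_self b, b, by simp [hbA]⟩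
  obtain ⟨C, hC, hbC, hdis, hnb⟩ := exists_component G (F := A ∪ Pᶜ) (z := b) (by simp [hbA, hb])
  have hCP : C ⊆ P := fun x hx => by
    by_contra hxP
    exact disjoint_left.1 hdis hx (mem_union_right _ (mem_compl.2 hxP))
  have hCA : ∀ x ∈ C, x ∉ A := fun x hx hxA => disjoint_left.1 hdis hx (mem_union_left _ hxA)
  obtain ⟨c, hc, x, hx, hcx⟩ := hP.2 C hCP ⟨b, hbC⟩ fun h => hCA a (h ▸ haP) haA
  rw [mem_sdiff] at hx
  have hxA : x ∈ A := by
    have := hnb c hc x hx.2 hcx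
    simpa [hx.1] using this
  refine ⟨insert x C, insert_subset hx.1 hCP, conn_insert hC hc hcx, mem_insert_of_mem hbC, x, ?_⟩
  ext y
  simp only [mem_inter, mem_insert, mem_singleton]
  constructor
  · rintro ⟨rfl | hy, hyA⟩
    · rfl
    · exact absurd hyA (hCA y hy)
  · rintro rfl
    exact ⟨Or.inl rfl, hxA⟩

/-- Shrink twice: first to a set with a single vertex x in A, then, keeping x, to one with a single
vertex in B. The second step cannot add vertices of A. -/
theorem Conn.exists_subset_inter_eq_singletons [Fintype V] {G : SimpleGraph V} {P A B : Finset V}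
    (hP : Conn G P) (hA : (P ∩ A).Nonempty) (hB : (P ∩ B).Nonempty) :
    ∃ P' ⊆ P, Conn G P' ∧ (∃ a, P' ∩ A = {a}) ∧ ∃ b, P' ∩ B = {b} := by
  obtain ⟨a, ha⟩ := hA
  obtain ⟨b, hb⟩ := hB
  rw [mem_inter] at ha hb
  obtain ⟨P1, hP1, hc1, hb1, x, hx⟩ := hP.exists_subset_inter_eq_singleton hb.1 ha.1 ha.2
  have hx1 : x ∈ P1 ∧ x ∈ A := by
    rw [← mem_inter, hx]; exact mem_singleton_self x
  obtain ⟨P2, hP2, hc2, hx2, y, hy⟩ := hc1.exists_subset_inter_eq_singleton hx1.1 hb1 hb.2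
  refine ⟨P2, hP2.trans hP1, hc2, ⟨x, ?_⟩, y, hy⟩
  refine subset_antisymm ?_ ?_
  · rw [← hx]; exact inter_subset_inter_right hP2
  · simpa using ⟨hx2, hx1.2⟩

end
end DenseMinor

/-! ### Counting adjacencies, and contraction -/

namespace DenseMinor
section
open scoped Classical
open Finset

variable {V : Type*}

/-- The number of neighbours of `s` in `S`. -/
noncomputable def deg (G : SimpleGraph V) (S : Finset V) (s : V) : ℕ := #{t ∈ S | G.Adj s t}

/-- The number of non-neighbours of `s` in `S`, other than `s`. -/
noncomputable def codeg (G : SimpleGraph V) (S : Finset V) (s : V) : ℕ :=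
  #{t ∈ S | t ≠ s ∧ ¬ G.Adj s t}

/-- The number of pairs in `A × B` that are adjacent. -/
noncomputable def adjPairs (G : SimpleGraph V) (A B : Finset V) : ℕ := ∑ a ∈ A, deg G B a

theorem adjPairs_eq_card (G : SimpleGraph V) (A B : Finset V) :
    adjPairs G A B = #{p ∈ A ×ˢ B | G.Adj p.1 p.2} := by
  simp only [adjPairs, deg, card_filter, sum_product]

theorem adjPairs_comm (G : SimpleGraph V) (A B : Finset V) :
    adjPairs G A B = adjPairs G B A := by
  simp only [adjPairs, deg, card_filter]
  rw [sum_comm]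
  simp only [G.adj_comm]

theorem adjPairs_union_left (G : SimpleGraph V) {A B : Finset V} (h : Disjoint A B)
    (C : Finset V) : adjPairs G (A ∪ B) C = adjPairs G A C + adjPairs G B C :=
  sum_union h

theorem adjPairs_union_right (G : SimpleGraph V) {A B : Finset V} (h : Disjoint A B)
    (C : Finset V) : adjPairs G C (A ∪ B) = adjPairs G C A + adjPairs G C B := by
  rw [adjPairs_comm, adjPairs_union_left G h, adjPairs_comm G A, adjPairs_comm G B]

theorem adjPairs_union_self (G : SimpleGraph V) {A B : Finset V} (h : Disjoint A B) :
    adjPairs G (A ∪ B) (A ∪ B) = adjPairs G A A + 2 * adjPairs G A B + adjPairs G B B := by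
  rw [adjPairs_union_left G h, adjPairs_union_right G h, adjPairs_union_right G h,
    adjPairs_comm G B A]
  ring

theorem adjPairs_singleton_left (G : SimpleGraph V) (x : V) (B : Finset V) :
    adjPairs G {x} B = deg G B x := by simp [adjPairs]

theorem deg_singleton (G : SimpleGraph V) (x y : V) :
    deg G {y} x = if G.Adj x y then 1 else 0 := by
  simp only [deg, filter_singleton]
  split_ifs <;> simp

theorem adjPairs_insert_self (G : SimpleGraph V) {A : Finset V} {x : V} (h : x ∉ A) :
    adjPairs G (insert x A) (insert x A) = adjPairs G A A + 2 * deg G A x := by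
  rw [insert_eq, adjPairs_union_self G (by simpa using h), adjPairs_singleton_left,
    adjPairs_singleton_left, deg_singleton]
  simp
  ring

theorem codeg_mono {G : SimpleGraph V} {S T : Finset V} (h : S ⊆ T) (x : V) :
    codeg G S x ≤ codeg G T x := card_le_card (filter_subset_filter _ h)

theorem deg_add_codeg (G : SimpleGraph V) {S : Finset V} {s : V} (h : s ∈ S) :
    deg G S s + codeg G S s + 1 = #S := by
  rw [← card_erase_add_one h, ← card_filter_add_card_filter_not (s := S.erase s) (G.Adj s)]
  congr 2
  · unfold deg
    congr 1
    ext t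
    simp only [mem_filter, mem_erase]
    exact ⟨fun h => ⟨⟨h.2.ne', h.1⟩, h.2⟩, fun h => ⟨h.1.2, h.2⟩⟩
  · unfold codeg
    congr 1
    ext t
    simp only [mem_filter, mem_erase]
    tauto

theorem deg_add_codeg_of_notMem (G : SimpleGraph V) {S : Finset V} {s : V} (h : s ∉ S) :
    deg G S s + codeg G S s = #S := by
  rw [← card_filter_add_card_filter_not (s := S) (G.Adj s)]
  congr 1
  unfold codeg
  congr 1
  ext t
  simp only [mem_filter]
  exact ⟨fun h => ⟨h.1, h.2.2⟩, fun ⟨h1, h2⟩ => ⟨h1, fun h3 => h (h3 ▸ h1), h2⟩⟩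

/-- Twice the number of non-adjacent pairs of distinct vertices in `S`. -/
noncomputable def coPairs (G : SimpleGraph V) (S : Finset V) : ℕ := ∑ s ∈ S, codeg G S s

theorem adjPairs_add_coPairs (G : SimpleGraph V) (S : Finset V) :
    adjPairs G S S + coPairs G S + #S = #S * #S := by
  have : ∑ s ∈ S, (deg G S s + codeg G S s + 1) = #S * #S := by
    rw [sum_congr rfl fun s hs => deg_add_codeg G hs]
    simp
  rw [sum_add_distrib, sum_add_distrib] at this
  simpa [adjPairs, coPairs] using this

/-- Edges are counted twice, so this parity sharpens many of the numerical bounds by one. -/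
theorem adjPairs_even (G : SimpleGraph V) (S : Finset V) : Even (adjPairs G S S) := by
  induction S using Finset.induction_on with
  | empty => simp [adjPairs]
  | insert x S hx ih =>
    rw [adjPairs_insert_self G hx]
    exact ih.add (even_two_mul _)

theorem adjPairs_mono {G G' : SimpleGraph V} (h : G ≤ G') (A B : Finset V) :
    adjPairs G A B ≤ adjPairs G' A B := by
  rw [adjPairs_eq_card, adjPairs_eq_card]
  exact card_le_card (monotone_filter_right _ fun p _ hp => h hp)

theorem coPairs_even (G : SimpleGraph V) (S : Finset V) : Even (coPairs G S) := by
  have h1 := adjPairs_add_coPairs G S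
  obtain ⟨r, hr⟩ := adjPairs_even G S
  have h2 : Even (#S * #S + #S) := by
    have := Nat.even_mul_succ_self #S
    rwa [Nat.mul_succ] at this
  obtain ⟨q, hq⟩ := h2
  exact ⟨q - r - #S, by omega⟩

theorem codeg_symm_count (G : SimpleGraph V) (A B : Finset V) :
    ∑ a ∈ A, codeg G B a = ∑ b ∈ B, codeg G A b := by
  simp only [codeg, card_filter]
  rw [sum_comm]
  simp only [G.adj_comm, ne_comm]

theorem codeg_union (G : SimpleGraph V) {S T : Finset V} (h : Disjoint S T) (x : V) :
    codeg G (S ∪ T) x = codeg G S x + codeg G T x := by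
  simp only [codeg, filter_union]
  exact card_union_of_disjoint (disjoint_filter_filter h)

theorem coPairs_union (G : SimpleGraph V) {A B : Finset V} (h : Disjoint A B) :
    coPairs G (A ∪ B) = coPairs G A + 2 * ∑ a ∈ A, codeg G B a + coPairs G B := by
  simp only [coPairs]
  rw [sum_union h, sum_congr rfl fun x _ => codeg_union G h x,
    sum_congr (s₁ := B) rfl fun x _ => codeg_union G h x, sum_add_distrib, sum_add_distrib,
    codeg_symm_count G A B]
  ring

theorem codeg_singleton_self (G : SimpleGraph V) (x : V) : codeg G {x} x = 0 := by
  simp [codeg]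

theorem coPairs_insert (G : SimpleGraph V) {A : Finset V} {x : V} (h : x ∉ A) :
    coPairs G (insert x A) = coPairs G A + 2 * codeg G A x := by
  rw [insert_eq, coPairs_union G (by simpa using h)]
  simp [coPairs, codeg_singleton_self]
  ring

theorem coPairs_erase (G : SimpleGraph V) {A : Finset V} {x : V} (h : x ∈ A) :
    coPairs G A = coPairs G (A.erase x) + 2 * codeg G A x := by
  conv_lhs => rw [← insert_erase h]
  rw [coPairs_insert G (notMem_erase x A)]
  congr 2
  unfold codeg
  congr 1
  ext t
  simp only [mem_filter, mem_erase]
  tauto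

/-- The graph obtained by contracting the set `Q` onto its vertex `s`; the other vertices of `Q`
are meant to be dropped from the vertex set under consideration. -/
def con (G : SimpleGraph V) (Q : Finset V) (s : V) : SimpleGraph V where
  Adj a b := a ≠ b ∧ (G.Adj a b ∨ (a = s ∧ ∃ q ∈ Q, G.Adj q b) ∨ (b = s ∧ ∃ q ∈ Q, G.Adj q a))
  symm := ⟨fun a b h => ⟨h.1.symm, by
    rcases h.2 with h | h | h
    · exact Or.inl h.symm
    · exact Or.inr (Or.inr h)
    · exact Or.inr (Or.inl h)⟩⟩
  loopless := ⟨fun a h => h.1 rfl⟩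

theorem le_con (G : SimpleGraph V) (Q : Finset V) (s : V) : G ≤ con G Q s :=
  fun _ _ h => ⟨h.ne, Or.inl h⟩

theorem con_adj {G : SimpleGraph V} {Q : Finset V} {s q t : V} (hq : q ∈ Q) (h : G.Adj q t)
    (hne : t ≠ s) : (con G Q s).Adj s t :=
  ⟨hne.symm, Or.inr (Or.inl ⟨rfl, q, hq, h⟩)⟩

/-- Adding the edges from `s ∈ X` to a set of non-neighbours. -/
theorem adjPairs_add_le_of_adj {G G' : SimpleGraph V} (h : G ≤ G') {X T : Finset V} {s : V}
    (hs : s ∈ X) (hT : T ⊆ X) (hT1 : ∀ t ∈ T, ¬ G.Adj s t) (hT2 : ∀ t ∈ T, G'.Adj s t) :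
    adjPairs G X X + 2 * #T ≤ adjPairs G' X X := by
  have hsT : s ∉ T := fun hsT => (hT2 s hsT).ne rfl
  have h1 : X = insert s (X.erase s) := (insert_erase hs).symm
  rw [h1, adjPairs_insert_self G (notMem_erase s X), adjPairs_insert_self G' (notMem_erase s X)]
  have h2 := adjPairs_mono h (X.erase s) (X.erase s)
  have h3 : deg G (X.erase s) s + #T ≤ deg G' (X.erase s) s := by
    unfold deg
    rw [← card_union_of_disjoint]
    · apply card_le_card
      intro t ht
      rw [mem_union, mem_filter] at ht
      rw [mem_filter]
      rcases ht with ht | ht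
      · exact ⟨ht.1, h ht.2⟩
      · exact ⟨mem_erase.2 ⟨fun h => hsT (h ▸ ht), hT ht⟩, hT2 t ht⟩
    · rw [disjoint_left]
      intro t ht ht2
      exact hT1 t ht2 (mem_filter.1 ht).2
  omega

/-- The non-neighbours of `s` in `X` that have a neighbour in `Q`. -/
noncomputable def gain (G : SimpleGraph V) (X Q : Finset V) (s : V) : Finset V :=
  {t ∈ X | t ≠ s ∧ ¬ G.Adj s t ∧ ∃ q ∈ Q, G.Adj q t}

theorem adjPairs_con (G : SimpleGraph V) {X Q : Finset V} {s : V} (hs : s ∈ X) :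
    adjPairs G X X + 2 * #(gain G X Q s) ≤ adjPairs (con G Q s) X X := by
  refine adjPairs_add_le_of_adj (le_con G Q s) hs (filter_subset _ _) ?_ ?_
  · intro t ht
    exact (mem_filter.1 ht).2.2.1
  · intro t ht
    obtain ⟨_, h1, _, q, hq, hqt⟩ := mem_filter.1 ht
    exact con_adj hq hqt h1

/-- On the vertex set `X`, the graph `G'` is a minor of `G`. -/
def MinorOn (G : SimpleGraph V) (X : Finset V) (G' : SimpleGraph V) : Prop :=
  ∃ φ : V → Finset V, (∀ x ∈ X, Conn G (φ x)) ∧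
    (∀ x ∈ X, ∀ y ∈ X, x ≠ y → Disjoint (φ x) (φ y)) ∧
    ∀ x ∈ X, ∀ y ∈ X, G'.Adj x y → ∃ a ∈ φ x, ∃ b ∈ φ y, G.Adj a b

theorem minorOn_self (G : SimpleGraph V) (X : Finset V) : MinorOn G X G :=
  ⟨fun x => {x}, fun x _ => conn_singleton G x, fun x _ y _ h => by simpa using h,
    fun x _ y _ h => ⟨x, mem_singleton_self x, y, mem_singleton_self y, h⟩⟩

/-- The new bag of s is the union of the bags over Q. It stays disjoint from the others because s is
the only vertex of Q kept in X'. -/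
theorem MinorOn.con {G : SimpleGraph V} {X X' : Finset V} {G' : SimpleGraph V} {Q : Finset V}
    {s : V} (h : MinorOn G X G') (hQ : Conn G' Q) (hs : s ∈ Q) (hQX : Q ⊆ X) (hX : X' ⊆ X)
    (hQX' : ∀ x ∈ X', x ∈ Q → x = s) : MinorOn G X' (con G' Q s) := by
  obtain ⟨φ, h1, h2, h3⟩ := h
  refine ⟨fun x => if x = s then Q.biUnion φ else φ x, ?_, ?_, ?_⟩
  · intro x hx
    dsimp only
    split_ifs with hxs
    · exact conn_biUnion hQ (fun q hq => h1 q (hQX hq))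
        fun x hx y hy => h3 x (hQX hx) y (hQX hy)
    · exact h1 x (hX hx)
  · intro x hx y hy hxy
    dsimp only
    split_ifs with hxs hys hys
    · exact absurd (hxs.trans hys.symm) hxy
    · rw [disjoint_biUnion_left]
      intro q hq
      exact h2 q (hQX hq) y (hX hy) fun h => hys (hQX' y hy (h ▸ hq))
    · rw [disjoint_biUnion_right]
      intro q hq
      exact h2 x (hX hx) q (hQX hq) fun h => hxs (hQX' x hx (h ▸ hq))
    · exact h2 x (hX hx) y (hX hy) hxy
  · have key : ∀ x ∈ X', ∀ y ∈ X', x = s → y ≠ s → (∃ q ∈ Q, G'.Adj q y) →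
        ∃ a ∈ (if x = s then Q.biUnion φ else φ x), ∃ b ∈ (if y = s then Q.biUnion φ else φ y),
          G.Adj a b := by
      rintro x hx y hy rfl hys ⟨q, hq, hqy⟩
      rw [if_pos rfl, if_neg hys]
      obtain ⟨a, ha, b, hb, hab⟩ := h3 q (hQX hq) y (hX hy) hqy
      exact ⟨a, mem_biUnion.2 ⟨q, hq, ha⟩, b, hb, hab⟩
    intro x hx y hy hxy
    dsimp only
    by_cases hxs : x = s
    · have hys : y ≠ s := fun h => hxy.1 (hxs.trans h.symm)
      refine key x hx y hy hxs hys ?_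
      rcases hxy.2 with h | h | h
      · exact ⟨s, hs, hxs ▸ h⟩
      · exact h.2
      · exact absurd h.1 hys
    · by_cases hys : y = s
      · obtain ⟨a, ha, b, hb, hab⟩ := key y hy x hx hys hxs (by
          rcases hxy.2 with h | h | h
          · exact ⟨s, hs, hys ▸ h.symm⟩
          · exact absurd h.1 hxs
          · exact h.2)
        exact ⟨b, hb, a, ha, hab.symm⟩
      · rw [if_neg hxs, if_neg hys]
        rcases hxy.2 with h | h | h
        · exact h3 x (hX hx) y (hX hy) h
        · exact absurd h.1 hxs
        · exact absurd h.1 hys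

end
end DenseMinor

/-! ### Critical graphs: minimum degree and common neighbours -/

namespace DenseMinor
section
open scoped Classical
open Finset

variable {V : Type*}

theorem codeg_le_card_gain {G : SimpleGraph V} {S X Q : Finset V} {s : V} (hS : S ⊆ X)
    (hQ : ∀ t ∈ S, ∃ q ∈ Q, G.Adj q t) : codeg G S s ≤ #(gain G X Q s) := by
  refine card_le_card fun t ht => ?_
  obtain ⟨h1, h2, h3⟩ := mem_filter.1 ht
  exact mem_filter.2 ⟨hS h1, h2, h3, hQ t h1⟩

theorem codeg_erase_le_card_gain_erase {G : SimpleGraph V} {S X Q : Finset V} {s r : V}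
    (hS : S ⊆ X) (hQ : ∀ t ∈ S, ∃ q ∈ Q, G.Adj q t) :
    codeg G (S.erase r) s ≤ #((gain G X Q s).erase r) := by
  refine card_le_card fun t ht => ?_
  obtain ⟨h1, h2, h3⟩ := mem_filter.1 ht
  rw [mem_erase] at h1
  exact mem_erase.2 ⟨h1.1, mem_filter.2 ⟨hS h1.2, h2, h3, hQ t h1.2⟩⟩

theorem adjPairs_con_insert {G : SimpleGraph V} {Y T Q : Finset V} {s : V} (hs : s ∉ Y)
    (hT : T ⊆ Y) (hTQ : ∀ t ∈ T, ∃ q ∈ Q, G.Adj q t) :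
    adjPairs G Y Y + 2 * #T ≤ adjPairs (con G Q s) (insert s Y) (insert s Y) := by
  rw [adjPairs_insert_self _ hs]
  have h1 := adjPairs_mono (le_con G Q s) Y Y
  have h2 : #T ≤ deg (con G Q s) Y s := card_le_card fun t ht => by
    obtain ⟨q, hq, hqt⟩ := hTQ t ht
    exact mem_filter.2 ⟨hT ht, con_adj hq hqt fun h => hs (h ▸ hT ht)⟩
  omega

variable [Fintype V]

/-- The neighbourhood of `v`. -/
noncomputable def nbr (G : SimpleGraph V) (v : V) : Finset V := {x | G.Adj v x}

theorem mem_nbr {G : SimpleGraph V} {v x : V} : x ∈ nbr G v ↔ G.Adj v x := by simp [nbr]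

theorem notMem_nbr_self (G : SimpleGraph V) (v : V) : v ∉ nbr G v := by simp [nbr]

theorem deg_eq_card_inter (G : SimpleGraph V) (S : Finset V) (v : V) :
    deg G S v = #(nbr G v ∩ S) := by
  unfold deg
  congr 1
  ext t
  simp [mem_nbr, and_comm]

theorem deg_eq_card_nbr {G : SimpleGraph V} {S : Finset V} {v : V} (h : nbr G v ⊆ S) :
    deg G S v = #(nbr G v) := by
  rw [deg_eq_card_inter, inter_eq_left.2 h]

/-- The set of vertices outside `C` with a neighbour in `C`. -/
noncomputable def outer (G : SimpleGraph V) (C : Finset V) : Finset V :=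
  {x | x ∉ C ∧ ∃ c ∈ C, G.Adj c x}

theorem mem_outer {G : SimpleGraph V} {C : Finset V} {x : V} :
    x ∈ outer G C ↔ x ∉ C ∧ ∃ c ∈ C, G.Adj c x := by simp [outer]

theorem disjoint_outer (G : SimpleGraph V) (C : Finset V) : Disjoint C (outer G C) :=
  disjoint_left.2 fun _ hx h => (mem_outer.1 h).1 hx

theorem nbr_subset {G : SimpleGraph V} {C : Finset V} {c : V} (hc : c ∈ C) :
    nbr G c ⊆ C ∪ outer G C := fun x hx => by
  by_cases hxC : x ∈ C
  · exact mem_union_left _ hxC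
  · exact mem_union_right _ (mem_outer.2 ⟨hxC, c, hc, mem_nbr.1 hx⟩)

/-- A graph with `n ≥ 10` vertices and `5 n - 14` edges that satisfies the extremal bound on
all its minors: proper minors with `m ≥ 9` vertices have at most `5 m - 15` edges, and minors with
nine vertices have at most `29`. Edges are counted twice. -/
structure IsCritical (G : SimpleGraph V) : Prop where
  ten_le : 10 ≤ Fintype.card V
  edges : adjPairs G univ univ + 28 = 10 * Fintype.card V
  small : ∀ X G', MinorOn G X G' → 9 ≤ #X → #X < Fintype.card V →
    adjPairs G' X X + 30 ≤ 10 * #X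
  nine : ∀ X G', MinorOn G X G' → #X = 9 → adjPairs G' X X ≤ 58

theorem minorOn_con {G : SimpleGraph V} {X Q : Finset V} {s : V} (hQ : Conn G Q) (hs : s ∈ Q)
    (hX : ∀ x ∈ X, x ∈ Q → x = s) : MinorOn G X (con G Q s) :=
  (minorOn_self G univ).con hQ hs (subset_univ _) (subset_univ _) hX

theorem minorOn_con_insert {G : SimpleGraph V} {Y Q : Finset V} {s : V} (hQ : Conn G Q)
    (hs : s ∈ Q) (hY : Disjoint Q Y) : MinorOn G (insert s Y) (con G Q s) :=
  minorOn_con hQ hs fun x hx hxQ => by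
    rcases mem_insert.1 hx with h | h
    · exact h
    · exact absurd h (disjoint_left.1 hY hxQ)

theorem minorOn_con_con {G : SimpleGraph V} {X Q R : Finset V} {s r : V} (hQ : Conn G Q)
    (hs : s ∈ Q) (hR : Conn G R) (hr : r ∈ R) (hQR : Disjoint Q R)
    (hXQ : ∀ x ∈ X, x ∈ Q → x = s) (hXR : ∀ x ∈ X, x ∈ R → x = r) :
    MinorOn G X (con (con G Q s) R r) := by
  have h1 : MinorOn G (X ∪ R) (con G Q s) := minorOn_con hQ hs fun x hx hxQ => by
    rcases mem_union.1 hx with h | h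
    · exact hXQ x h hxQ
    · exact absurd h (disjoint_left.1 hQR hxQ)
  exact h1.con (hR.mono (le_con G Q s)) hr subset_union_right subset_union_left hXR

omit [Fintype V] in
-- The pair {s, r} might be gained by both contractions, so s is discarded from the second gain.
theorem adjPairs_con_con {G : SimpleGraph V} {X Q R : Finset V} {s r : V} (hs : s ∈ X)
    (hr : r ∈ X) (hsr : s ≠ r) :
    adjPairs G X X + 2 * #(gain G X Q s) + 2 * #((gain G X R r).erase s) ≤
      adjPairs (con (con G Q s) R r) X X := by
  have h1 := adjPairs_con G (Q := Q) hs
  have h2 := adjPairs_con (con G Q s) (Q := R) hr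
  have h3 : #((gain G X R r).erase s) ≤ #(gain (con G Q s) X R r) := by
    refine card_le_card fun t ht => ?_
    obtain ⟨hts, ht⟩ := mem_erase.1 ht
    obtain ⟨h1, h2, h3, q, hq, hqt⟩ := mem_filter.1 ht
    refine mem_filter.2 ⟨h1, h2, ?_, q, hq, le_con G Q s hqt⟩
    rintro ⟨_, h | h | h⟩
    · exact h3 h
    · exact hsr h.1.symm
    · exact hts h.1
  omega

namespace IsCritical

variable {G : SimpleGraph V} (h : IsCritical G)
include h

theorem small_con {X Q : Finset V} {s : V} (hX9 : 9 ≤ #X) (hXn : #X < Fintype.card V)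
    (hQ : Conn G Q) (hs : s ∈ Q) (hsX : s ∈ X) (hX : ∀ x ∈ X, x ∈ Q → x = s) :
    adjPairs G X X + 2 * #(gain G X Q s) + 30 ≤ 10 * #X := by
  have h1 := h.small X _ (minorOn_con hQ hs hX) hX9 hXn
  have h2 := adjPairs_con G (Q := Q) hsX
  omega

theorem adjPairs_univ_le {x : V} : adjPairs G univ univ + 28 = 10 * Fintype.card V ∧
    adjPairs G univ univ =
      adjPairs G (univ.erase x) (univ.erase x) + 2 * #(nbr G x) := by
  refine ⟨h.edges, ?_⟩
  conv_lhs => rw [← insert_erase (mem_univ x)]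
  rw [adjPairs_insert_self _ (notMem_erase x _), deg_eq_card_nbr]
  intro t ht
  exact mem_erase.2 ⟨(mem_nbr.1 ht).ne', mem_univ t⟩

/-- Passing from 5n - 14 edges to at most 5(n - 1) - 15 means losing at least six. -/
theorem six_le_card_nbr (x : V) : 6 ≤ #(nbr G x) := by
  obtain ⟨h1, h2⟩ := h.adjPairs_univ_le (x := x)
  have h3 : #(univ.erase x) = Fintype.card V - 1 := by
    rw [card_erase_of_mem (mem_univ x), card_univ]
  have := h.ten_le
  have h4 := h.small _ _ (minorOn_self G (univ.erase x)) (by omega) (by omega)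
  omega

/-- Contracting xy loses that edge and one edge for each common neighbour, and the loss must be at
least six. -/
theorem five_le_card_common {x y : V} (hxy : G.Adj x y) : 5 ≤ #(nbr G x ∩ nbr G y) := by
  obtain ⟨h1, h2⟩ := h.adjPairs_univ_le (x := y)
  have h3 : #(univ.erase y) = Fintype.card V - 1 := by
    rw [card_erase_of_mem (mem_univ y), card_univ]
  have := h.ten_le
  have h4 := h.small_con (X := univ.erase y) (Q := {x, y}) (s := x) (by omega) (by omega)
    (conn_pair hxy) (by simp) (by simp [hxy.ne]) (by
      intro z hz hz2
      simp only [mem_erase, mem_univ, and_true] at hz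
      simp only [mem_insert, mem_singleton] at hz2
      tauto)
  have h5 : #(nbr G y) ≤ #(gain G (univ.erase y) {x, y} x) + #(nbr G x ∩ nbr G y) + 1 := by
    have : nbr G y ⊆ insert x (gain G (univ.erase y) {x, y} x ∪ (nbr G x ∩ nbr G y)) := by
      intro t ht
      rw [mem_nbr] at ht
      simp only [mem_insert, mem_union, mem_inter, mem_nbr, gain, mem_filter, mem_erase, mem_univ,
        mem_singleton, exists_eq_or_imp, exists_eq_left]
      have := ht.ne'
      tauto
    refine (card_le_card this).trans ((card_insert_le _ _).trans ?_)
    have := card_union_le (gain G (univ.erase y) {x, y} x) (nbr G x ∩ nbr G y)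
    omega
  omega

theorem five_le_deg {x y : V} (hxy : G.Adj x y) {S : Finset V} (hS : nbr G x ∩ nbr G y ⊆ S) :
    5 ≤ deg G S y := by
  refine (h.five_le_card_common hxy).trans ?_
  rw [deg_eq_card_inter]
  exact card_le_card fun t ht => mem_inter.2 ⟨(mem_inter.1 ht).2, hS ht⟩

theorem codeg_nbr {v x : V} (hx : x ∈ nbr G v) : codeg G (nbr G v) x + 6 ≤ #(nbr G v) := by
  have h1 := deg_add_codeg G hx
  have h2 := h.five_le_deg (mem_nbr.1 hx) (S := nbr G v) inter_subset_left
  omega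

end IsCritical

end
end DenseMinor

/-! ### Critical graphs are 5-connected -/

namespace DenseMinor
section
open scoped Classical
open Finset

variable {V : Type*}

theorem coPairs_mono (G : SimpleGraph V) {S T : Finset V} (h : S ⊆ T) :
    coPairs G S ≤ coPairs G T :=
  (sum_le_sum fun s _ => codeg_mono h s).trans (sum_le_sum_of_subset h)

theorem coPairs_le_of_codeg_le {G : SimpleGraph V} {S : Finset V} {d : ℕ}
    (h : ∀ s ∈ S, codeg G S s ≤ d) : coPairs G S ≤ #S * d := by
  simpa [coPairs] using sum_le_card_nsmul S _ d h

theorem exists_coPairs_le (G : SimpleGraph V) {S : Finset V} (hS : S.Nonempty) :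
    ∃ s ∈ S, coPairs G S ≤ #S * codeg G S s ∧ ∀ t ∈ S, codeg G S t ≤ codeg G S s := by
  obtain ⟨s, hs, hmax⟩ := exists_max_image S (codeg G S) hS
  exact ⟨s, hs, coPairs_le_of_codeg_le hmax, hmax⟩

theorem codeg_eq_zero_iff {G : SimpleGraph V} {S : Finset V} {x : V} :
    codeg G S x = 0 ↔ ∀ t ∈ S, t ≠ x → G.Adj x t := by
  simp only [codeg, card_eq_zero, filter_eq_empty_iff, not_and, not_not]

variable [Fintype V]

/-- All edges leaving C end in its boundary, so the sides C ∪ S and Cᶜ cover every edge and share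
only those inside the boundary S. -/
theorem adjPairs_cut (G : SimpleGraph V) (C : Finset V) :
    adjPairs G univ univ + adjPairs G (outer G C) (outer G C) =
      adjPairs G (C ∪ outer G C) (C ∪ outer G C) + adjPairs G Cᶜ Cᶜ := by
  rw [adjPairs_union_self G (disjoint_outer G C), ← union_compl C,
    adjPairs_union_self G disjoint_compl_right]
  have : adjPairs G C Cᶜ = adjPairs G C (outer G C) := by
    refine sum_congr rfl fun c hc => ?_
    unfold deg
    congr 1
    ext x
    simp only [mem_filter, mem_compl, mem_outer]
    exact ⟨fun h => ⟨⟨h.1, c, hc, h.2⟩, h.2⟩, fun h => ⟨h.1.1, h.2⟩⟩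
  rw [this]
  ring

namespace IsCritical

variable {G : SimpleGraph V} (h : IsCritical G)
include h

/-- Contracting D onto s joins s to every vertex of S to which it was not adjacent. -/
theorem small_of_dominated {X S D : Finset V} {s : V} (hX9 : 9 ≤ #X) (hXn : #X < Fintype.card V)
    (hSX : S ⊆ X) (hD : Conn G D) (hDX : Disjoint D X) (hSD : ∀ t ∈ S, ∃ d ∈ D, G.Adj d t)
    (hs : s ∈ S) : adjPairs G X X + 2 * codeg G S s + 30 ≤ 10 * #X := by
  obtain ⟨d, hd, hds⟩ := hSD s hs
  have h1 := h.small_con hX9 hXn (conn_insert hD hd hds) (mem_insert_self s D) (hSX hs)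
    fun x hx hxQ => by
      rcases mem_insert.1 hxQ with h | h
      · exact h
      · exact absurd hx (disjoint_left.1 hDX h)
  have h2 := codeg_le_card_gain (G := G) (s := s) (Q := insert s D) hSX
    fun t ht => by
      obtain ⟨d, hd, hdt⟩ := hSD t ht
      exact ⟨d, mem_insert_of_mem hd, hdt⟩
  omega

/-- Contracted to a single vertex, D becomes the ninth vertex and brings an edge to each vertex of
T. -/
theorem nine_of_dominated {Y T D : Finset V} (hY : #Y = 8) (hD : Conn G D) (hDY : Disjoint D Y)
    (hTY : T ⊆ Y) (hTD : ∀ t ∈ T, ∃ d ∈ D, G.Adj d t) : adjPairs G Y Y + 2 * #T ≤ 58 := by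
  obtain ⟨d, hd⟩ := hD.1
  have hdY : d ∉ Y := disjoint_left.1 hDY hd
  have h1 := h.nine _ _ (minorOn_con_insert hD hd hDY) (by rw [card_insert_of_notMem hdY, hY])
  have h2 := adjPairs_con_insert hdY hTY hTD
  omega

/-- A boundary vertex has a neighbour c in C, and its five common neighbours with c also lie in C or
on the boundary. -/
theorem six_le_deg_union_outer {C : Finset V} {x : V} (hx : x ∈ C ∪ outer G C) :
    6 ≤ deg G (C ∪ outer G C) x := by
  rcases mem_union.1 hx with hx | hx
  · rw [deg_eq_card_nbr (nbr_subset hx)]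
    exact h.six_le_card_nbr x
  · obtain ⟨hxC, c, hc, hcx⟩ := mem_outer.1 hx
    have h1 := h.five_le_card_common hcx
    have h2 : insert c (nbr G c ∩ nbr G x) ⊆ {t ∈ C ∪ outer G C | G.Adj x t} := by
      intro t ht
      rcases mem_insert.1 ht with rfl | ht
      · exact mem_filter.2 ⟨mem_union_left _ hc, hcx.symm⟩
      · rw [mem_inter, mem_nbr, mem_nbr] at ht
        exact mem_filter.2 ⟨nbr_subset hc (mem_nbr.2 ht.1), ht.2⟩
    have h3 := card_le_card h2
    rw [card_insert_of_notMem (by simp [mem_nbr])] at h3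
    exact le_trans (by omega) h3

/-- With n = 10 there are 36 edges, and deleting x would leave nine vertices with 30. -/
theorem ten_lt_card_of_card_nbr_eq_six {x : V} (hx : #(nbr G x) = 6) : 10 < Fintype.card V := by
  by_contra hcon
  have h0 := h.ten_le
  obtain ⟨h1, h2⟩ := h.adjPairs_univ_le (x := x)
  have h3 : #(univ.erase x) = Fintype.card V - 1 := by
    rw [card_erase_of_mem (mem_univ x), card_univ]
  have h4 := h.nine _ _ (minorOn_self G (univ.erase x)) (by omega)
  omega

/-- For a cut S of at most four vertices, the edge bounds on C ∪ S and Cᶜ add up to less than e(G) +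
e(S). When |S| = 4 the bounds must first be improved by contracting the opposite side onto a vertex
of S. Sides with seven or eight vertices, where the general bound is not available, are treated by
their density or by adding the opposite side as a ninth vertex. -/
theorem five_le_card_outer_aux {C D S : Finset V} (hC : Conn G C) (hD : Conn G D)
    (hCS : outer G C = S) (hDS : outer G D = S) (hCD : Disjoint C D) (hle : #C ≤ #D) :
    5 ≤ #S := by
  by_contra hcon
  have hCS' : Disjoint C S := hCS ▸ disjoint_outer G C
  have hDS' : Disjoint D S := hDS ▸ disjoint_outer G D
  have hSC : ∀ t ∈ S, ∃ d ∈ C, G.Adj d t := fun t ht => (mem_outer.1 (hCS ▸ ht)).2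
  have hSD : ∀ t ∈ S, ∃ d ∈ D, G.Adj d t := fun t ht => (mem_outer.1 (hDS ▸ ht)).2
  have hDV1 : Disjoint D (C ∪ S) := disjoint_union_right.2 ⟨hCD.symm, hDS'⟩
  have hCV2 : Disjoint C Cᶜ := disjoint_compl_right
  have hSV2 : S ⊆ Cᶜ := fun x hx => mem_compl.2 (disjoint_right.1 hCS' hx)
  have hDV2 : D ∪ S ⊆ Cᶜ := union_subset
    (fun x hx => mem_compl.2 (disjoint_right.1 hCD hx)) hSV2
  have hn1 : #(C ∪ S) = #C + #S := card_union_of_disjoint hCS'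
  have hn2 : #Cᶜ + #C = Fintype.card V := by rw [add_comm, card_add_card_compl]
  have hDc : #D + #S ≤ #Cᶜ := by
    rw [← card_union_of_disjoint hDS']; exact card_le_card hDV2
  have hcut := adjPairs_cut G C
  rw [hCS] at hcut
  have hE := h.edges
  have hS := adjPairs_add_coPairs G S
  have hV1 := adjPairs_add_coPairs G (C ∪ S)
  have hV2 := adjPairs_add_coPairs G Cᶜ
  have hdeg1 : ∀ x ∈ C ∪ S, codeg G (C ∪ S) x + 7 ≤ #(C ∪ S) := fun x hx => by
    have h1 := h.six_le_deg_union_outer (C := C) (x := x) (by rwa [hCS])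
    rw [hCS] at h1
    have h2 := deg_add_codeg G hx
    omega
  have hdeg2 : ∀ x ∈ D ∪ S, codeg G (D ∪ S) x + 7 ≤ #(D ∪ S) := fun x hx => by
    have h1 := h.six_le_deg_union_outer (C := D) (x := x) (by rwa [hDS])
    rw [hDS] at h1
    have h2 := deg_add_codeg G hx
    omega
  obtain ⟨c, hc⟩ := hC.1
  obtain ⟨d, hd⟩ := hD.1
  have hc7 := hdeg1 c (mem_union_left _ hc)
  have hmono := coPairs_mono G (subset_union_right (s₁ := C) (s₂ := S))
  have hevS := coPairs_even G S
  have hev1 := coPairs_even G (C ∪ S)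
  have hevE2 := adjPairs_even G Cᶜ
  have hCpos : 0 < #C := card_pos.2 hC.1
  have hDpos : 0 < #D := card_pos.2 hD.1
  have hS4 : #S ≤ 4 := by omega
  have hsmall2 : 9 ≤ #Cᶜ → adjPairs G Cᶜ Cᶜ + 30 ≤ 10 * #Cᶜ := fun h9 =>
    h.small _ _ (minorOn_self G _) h9 (by omega)
  have hnew1 : #(C ∪ S) = 8 → adjPairs G (C ∪ S) (C ∪ S) + 2 * #S ≤ 58 := fun h8 =>
    h.nine_of_dominated h8 hD hDV1 subset_union_right hSD
  have hnew2 : #Cᶜ = 8 → adjPairs G Cᶜ Cᶜ + 2 * #S ≤ 58 := fun h8 =>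
    h.nine_of_dominated h8 hC hCV2 hSV2 hSC
  rcases lt_or_ge #(C ∪ S) 9 with hlt | h9
  · have h78 : #(C ∪ S) = 7 ∨ #(C ∪ S) = 8 := by omega
    rcases h78 with h7 | h8
    -- Seven vertices with at least six neighbours each within the set: C ∪ S is a K₇.
    · have hco : coPairs G (C ∪ S) = 0 := by
        have := coPairs_le_of_codeg_le (G := G) (S := C ∪ S) (d := 0)
          fun s hs => by have := hdeg1 s hs; omega
        omega
      rw [h7] at hV1
      rcases lt_or_ge #Cᶜ 9 with hlt2 | h9'
      · have h78' : #Cᶜ = 7 ∨ #Cᶜ = 8 := by omega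
        rcases h78' with h7' | h8'
        -- Both sides have seven vertices, so n = 14 - |S|, which leaves only n = 10.
        · have hnbr : #(nbr G c) = 6 := by
            have h1 : nbr G c ⊆ (C ∪ S).erase c := fun x hx =>
              mem_erase.2 ⟨(mem_nbr.1 hx).ne', hCS ▸ nbr_subset hc hx⟩
            have h2 := card_le_card h1
            rw [card_erase_of_mem (mem_union_left _ hc)] at h2
            have := h.six_le_card_nbr c
            omega
          have := h.ten_lt_card_of_card_nbr_eq_six hnbr
          rw [h7'] at hV2
          generalize #S = k at *
          interval_cases k <;> omega
        · have := hnew2 h8'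
          generalize #S = k at *
          interval_cases k <;> omega
      · have := hsmall2 h9'
        generalize #S = k at *
        interval_cases k <;> omega
    · have hn := hnew1 h8
      have hco : coPairs G (C ∪ S) ≤ 8 := by
        have := coPairs_le_of_codeg_le (G := G) (S := C ∪ S) (d := 1)
          fun s hs => by have := hdeg1 s hs; omega
        omega
      have hcoS1 : ∀ s ∈ S, codeg G S s ≤ 1 := fun s hs => by
        have h1 := hdeg1 s (mem_union_right _ hs)
        have h2 := codeg_mono (G := G) (subset_union_right (s₁ := C) (s₂ := S)) s
        omega
      have hcoS := coPairs_le_of_codeg_le hcoS1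
      obtain ⟨r1, hr1⟩ := hev1
      obtain ⟨rS, hrS⟩ := hevS
      rw [h8] at hV1
      rcases lt_or_ge #Cᶜ 9 with hlt2 | h9'
      · have h8' : #Cᶜ = 8 := by omega
        have hDSeq : D ∪ S = Cᶜ := eq_of_subset_of_card_le hDV2 (by
          rw [card_union_of_disjoint hDS']; omega)
        have hev2 := coPairs_even G Cᶜ
        obtain ⟨r2, hr2⟩ := hev2
        have hn2' := hnew2 h8'
        rw [h8'] at hV2
        -- With eight vertices on each side only this tight case survives the count: S induces a
        -- 4-cycle and C ∪ S has 25 edges.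
        have key : #S = 4 ∧ coPairs G S = 4 ∧ coPairs G (C ∪ S) = 6 := by
          generalize #S = k at *
          interval_cases k <;> omega
        obtain ⟨hk, hS4, h16⟩ := key
        have hall : ∀ s ∈ S, codeg G S s = 1 := by
          intro s hs
          by_contra hne
          have h1 := hcoS1 s hs
          have h2 : coPairs G S < ∑ s ∈ S, 1 := sum_lt_sum hcoS1 ⟨s, hs, by omega⟩
          simp at h2
          omega
        -- The one non-neighbour that s may have in D ∪ S is already used inside S.
        have hDS0 : ∀ r ∈ D, ∀ s ∈ S, G.Adj r s := by
          intro r hr s hs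
          have h1 := hdeg2 s (mem_union_right _ hs)
          rw [codeg_union G hDS', hall s hs, hDSeq, h8'] at h1
          exact (codeg_eq_zero_iff.1 (by omega) r hr
            fun h => disjoint_left.1 hDS' hr (h ▸ hs)).symm
        obtain ⟨r, hr, r', hr', hrr⟩ := one_lt_card.1 (show 1 < #D by omega)
        obtain ⟨s, hs⟩ : S.Nonempty := card_pos.1 (by omega)
        have hr1 : r' ∉ C ∪ S := disjoint_left.1 hDV1 hr'
        have hr0 : r ∉ C ∪ S := disjoint_left.1 hDV1 hr
        have hsX : s ∈ insert r' (C ∪ S) := mem_insert_of_mem (mem_union_right _ hs)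
        -- Two vertices of D suffice: r contracted onto s gains an edge inside S, and r' adds four,
        -- so 25 + 1 + 4 = 30 edges on nine vertices.
        have h1 := h.nine (insert r' (C ∪ S)) (con G {s, r} s)
          (minorOn_con (conn_pair (hDS0 r hr s hs).symm) (by simp) (by
            intro x hx hxQ
            rcases mem_insert.1 hxQ with h | h
            · exact h
            · rw [mem_singleton] at h
              subst h
              rcases mem_insert.1 hx with h | h
              · exact absurd h hrr
              · exact absurd h hr0))
          (by rw [card_insert_of_notMem hr1, h8])
        have h2 := adjPairs_con G (Q := {s, r}) hsX
        have h3 := codeg_le_card_gain (G := G) (S := S) (X := insert r' (C ∪ S)) (Q := {s, r})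
          (s := s) (fun x hx => mem_insert_of_mem (mem_union_right _ hx))
          fun t ht => ⟨r, by simp, hDS0 r hr t ht⟩
        rw [adjPairs_insert_self _ hr1] at h2
        have h4 : deg G (C ∪ S) r' ≥ #S := card_le_card fun t ht =>
          mem_filter.2 ⟨mem_union_right _ ht, hDS0 r' hr' t ht⟩
        rw [hall s hs] at h3
        omega
      · have hs2 := hsmall2 h9'
        have hcase : #S ≤ 3 ∨ #S = 4 := by omega
        rcases hcase with hk | hk
        · generalize #S = k at *
          interval_cases k <;> omega
        · obtain ⟨s, hs, hsum, -⟩ := exists_coPairs_le G (S := S) (card_pos.1 (by omega))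
          have := h.small_of_dominated h9' (by omega) hSV2 hC hCV2 hSC hs
          rw [hk] at hS hsum hcoS hn
          omega
  · have h92 : 9 ≤ #Cᶜ := by omega
    have hs2 := hsmall2 h92
    have hs1 := h.small _ _ (minorOn_self G (C ∪ S)) h9 (by omega)
    have hcase : #S ≤ 3 ∨ #S = 4 := by omega
    rcases hcase with hk | hk
    · generalize #S = k at *
      interval_cases k <;> omega
    -- The same s, with the most non-neighbours in S, is used on both sides: the two gains together
    -- outweigh the edges missing from S.
    · obtain ⟨s, hs, hsum, -⟩ := exists_coPairs_le G (S := S) (card_pos.1 (by omega))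
      have h1 := h.small_of_dominated h92 (by omega) hSV2 hC hCV2 hSC hs
      have h2 := h.small_of_dominated h9 (by omega) subset_union_right hD hDV1 hSD hs
      rw [hk] at hS hsum
      omega

/-- A critical graph is 5-connected. -/
theorem five_le_card_outer {C : Finset V} (hC : Conn G C) (hne : C ∪ outer G C ≠ univ) :
    5 ≤ #(outer G C) := by
  -- The weight orders sets lexicographically, by boundary size and then by size, since a set has
  -- fewer than n + 1 vertices more than any other.
  obtain ⟨A, hA, hmin⟩ := exists_min_image
    ((univ : Finset (Finset V)).filter fun C => Conn G C ∧ C ∪ outer G C ≠ univ)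
    (fun C => #(outer G C) * (Fintype.card V + 1) + #C) ⟨C, by simp [hC, hne]⟩
  simp only [mem_filter, mem_univ, true_and] at hA hmin
  have hlex : ∀ B, Conn G B → B ∪ outer G B ≠ univ → #(outer G A) ≤ #(outer G B) ∧
      (#(outer G B) ≤ #(outer G A) → #A ≤ #B) := by
    intro B hB hBne
    have h1 := hmin B ⟨hB, hBne⟩
    have h2 := card_le_univ B
    constructor
    · by_contra hlt
      have : (#(outer G B) + 1) * (Fintype.card V + 1) ≤ #(outer G A) * (Fintype.card V + 1) :=
        Nat.mul_le_mul_right _ (by omega)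
      rw [Nat.add_mul] at this
      omega
    · intro h3
      have : #(outer G B) * (Fintype.card V + 1) ≤ #(outer G A) * (Fintype.card V + 1) :=
        Nat.mul_le_mul_right _ h3
      omega
  refine le_trans ?_ (hlex C hC hne).1
  obtain ⟨z, hz⟩ : ∃ z, z ∉ A ∪ outer G A := by
    by_contra hcon
    push Not at hcon
    exact hA.2 (eq_univ_of_forall hcon)
  obtain ⟨D, hD, hzD, hdis, hnb⟩ := exists_component G hz
  have hAD : Disjoint A D := disjoint_right.2 fun x hx hxA =>
    disjoint_left.1 hdis hx (mem_union_left _ hxA)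
  have hDA : outer G D ⊆ outer G A := by
    intro x hx
    obtain ⟨hxD, d, hd, hdx⟩ := mem_outer.1 hx
    rcases mem_union.1 (hnb d hd x hxD hdx) with h1 | h1
    · exact absurd (nbr_subset h1 (mem_nbr.2 hdx.symm)) (disjoint_left.1 hdis hd)
    · exact h1
  have hDne : D ∪ outer G D ≠ univ := by
    obtain ⟨a, ha⟩ := hA.1.1
    intro heq
    have := heq ▸ mem_univ a
    rcases mem_union.1 this with h1 | h1
    · exact disjoint_left.1 hAD ha h1
    · exact disjoint_left.1 (disjoint_outer G A) ha (hDA h1)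
  obtain ⟨h1, h2⟩ := hlex D hD hDne
  -- By minimality a component D beyond the boundary of A has that same boundary, and is at least as
  -- large as A.
  have heq : outer G D = outer G A := eq_of_subset_of_card_le hDA h1
  exact h.five_le_card_outer_aux hA.1 hD rfl heq hAD (h2 (by rw [heq]))

end IsCritical

end
end DenseMinor

/-! ### No vertex of degree seven or eight -/

namespace DenseMinor
section
open scoped Classical
open Finset

variable {V : Type*} [Fintype V]

theorem exists_minorOn_of_dominated {G : SimpleGraph V} {X S D : Finset V} {s : V}
    (hSX : S ⊆ X) (hD : Conn G D) (hDX : Disjoint D X) (hSD : ∀ t ∈ S, ∃ d ∈ D, G.Adj d t)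
    (hs : s ∈ S) :
    ∃ G', MinorOn G X G' ∧ adjPairs G X X + 2 * codeg G S s ≤ adjPairs G' X X := by
  obtain ⟨d, hd, hds⟩ := hSD s hs
  refine ⟨con G (insert s D) s, minorOn_con (conn_insert hD hd hds) (mem_insert_self s D)
    fun x hx hxQ => ?_, ?_⟩
  · rcases mem_insert.1 hxQ with h | h
    · exact h
    · exact absurd hx (disjoint_left.1 hDX h)
  · have h1 := adjPairs_con G (X := X) (Q := insert s D) (hSX hs)
    have h2 := codeg_le_card_gain (G := G) (s := s) (Q := insert s D) hSX fun t ht => by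
      obtain ⟨d, hd, hdt⟩ := hSD t ht
      exact ⟨d, mem_insert_of_mem hd, hdt⟩
    omega

/-- Two disjoint outside sets are contracted onto different vertices; s₁ is removed from the second
count so that the pair {s₁, s₂} is gained once only. -/
theorem exists_minorOn_of_dominated₂ {G : SimpleGraph V} {X S₁ S₂ D₁ D₂ : Finset V} {s₁ s₂ : V}
    (hS₁X : S₁ ⊆ X) (hS₂X : S₂ ⊆ X) (hD₁ : Conn G D₁) (hD₂ : Conn G D₂) (hD₁X : Disjoint D₁ X)
    (hD₂X : Disjoint D₂ X) (hD : Disjoint D₁ D₂) (hSD₁ : ∀ t ∈ S₁, ∃ d ∈ D₁, G.Adj d t)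
    (hSD₂ : ∀ t ∈ S₂, ∃ d ∈ D₂, G.Adj d t) (hs₁ : s₁ ∈ S₁) (hs₂ : s₂ ∈ S₂) (hne : s₁ ≠ s₂) :
    ∃ G', MinorOn G X G' ∧ adjPairs G X X + 2 * codeg G S₁ s₁ + 2 * codeg G (S₂.erase s₁) s₂ ≤
      adjPairs G' X X := by
  obtain ⟨d₁, hd₁, hds₁⟩ := hSD₁ s₁ hs₁
  obtain ⟨d₂, hd₂, hds₂⟩ := hSD₂ s₂ hs₂
  have hs₁D : s₁ ∉ D₁ ∧ s₁ ∉ D₂ :=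
    ⟨disjoint_right.1 hD₁X (hS₁X hs₁), disjoint_right.1 hD₂X (hS₁X hs₁)⟩
  have hs₂D : s₂ ∉ D₁ ∧ s₂ ∉ D₂ :=
    ⟨disjoint_right.1 hD₁X (hS₂X hs₂), disjoint_right.1 hD₂X (hS₂X hs₂)⟩
  refine ⟨con (con G (insert s₁ D₁) s₁) (insert s₂ D₂) s₂,
    minorOn_con_con (conn_insert hD₁ hd₁ hds₁) (mem_insert_self _ _)
      (conn_insert hD₂ hd₂ hds₂) (mem_insert_self _ _) ?_ ?_ ?_, ?_⟩
  · rw [disjoint_insert_left, disjoint_insert_right, mem_insert]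
    exact ⟨fun h => h.elim hne hs₁D.2, hs₂D.1, hD⟩
  · intro x hx hxQ
    rcases mem_insert.1 hxQ with h | h
    · exact h
    · exact absurd hx (disjoint_left.1 hD₁X h)
  · intro x hx hxQ
    rcases mem_insert.1 hxQ with h | h
    · exact h
    · exact absurd hx (disjoint_left.1 hD₂X h)
  · have h1 := adjPairs_con_con (G := G) (Q := insert s₁ D₁) (R := insert s₂ D₂) (hS₁X hs₁)
      (hS₂X hs₂) hne
    have h2 := codeg_le_card_gain (G := G) (s := s₁) (Q := insert s₁ D₁) hS₁X fun t ht => by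
      obtain ⟨d, hd, hdt⟩ := hSD₁ t ht
      exact ⟨d, mem_insert_of_mem hd, hdt⟩
    have h3 := codeg_erase_le_card_gain_erase (G := G) (s := s₂) (r := s₁) (Q := insert s₂ D₂)
      hS₂X fun t ht => by
        obtain ⟨d, hd, hdt⟩ := hSD₂ t ht
        exact ⟨d, mem_insert_of_mem hd, hdt⟩
    omega

omit [Fintype V] in
theorem exists_pos_codeg {G : SimpleGraph V} {S : Finset V} (h : coPairs G S ≠ 0) :
    ∃ s ∈ S, 0 < codeg G S s := by
  obtain ⟨s, hs, hne⟩ := exists_ne_zero_of_sum_ne_zero h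
  exact ⟨s, hs, Nat.pos_of_ne_zero hne⟩

omit [Fintype V] in
/-- Non-adjacent pairs in `H` that are not inside `T` have an end in `H \ T`. -/
theorem coPairs_le_add {G : SimpleGraph V} {H T : Finset V} {d : ℕ} (hT : T ⊆ H)
    (hd : ∀ x ∈ H, codeg G H x ≤ d) : coPairs G H ≤ coPairs G T + 2 * ((#H - #T) * d) := by
  have hdis : Disjoint (H \ T) T := sdiff_disjoint
  have h1 := coPairs_union G hdis
  rw [sdiff_union_of_subset hT] at h1
  have h2 : coPairs G (H \ T) + ∑ a ∈ H \ T, codeg G T a ≤ #(H \ T) * d := by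
    have : ∑ a ∈ H \ T, (codeg G (H \ T) a + codeg G T a) ≤ #(H \ T) * d := by
      rw [← smul_eq_mul]
      refine sum_le_card_nsmul _ _ d fun x hx => ?_
      rw [← codeg_union G hdis, sdiff_union_of_subset hT]
      exact hd x (mem_sdiff.1 hx).1
    rwa [sum_add_distrib] at this
  rw [card_sdiff_of_subset hT] at h2
  omega

namespace IsCritical

variable {G : SimpleGraph V} (h : IsCritical G)
include h

/-- A component of `G - N[v] - F`, where `F` is separated from the rest by `N[v]`. -/
theorem exists_component_avoiding {v z : V} {F : Finset V} (hzF : z ∉ F) (hzv : z ≠ v)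
    (hzn : z ∉ nbr G v) (hF : ∀ x ∈ F, ∀ y, y ∉ F → G.Adj x y → y ∈ nbr G v) :
    ∃ C, Conn G C ∧ z ∈ C ∧ Disjoint C F ∧ Disjoint C (insert v (nbr G v)) ∧
      outer G C ⊆ nbr G v ∧ 5 ≤ #(outer G C) := by
  obtain ⟨C, hC, hzC, hdis, hnb⟩ := exists_component G (F := insert v (nbr G v) ∪ F) (z := z)
    (by simp [hzF, hzv, hzn])
  rw [disjoint_union_right] at hdis
  have hout : outer G C ⊆ nbr G v := by
    intro x hx
    obtain ⟨hxC, c, hc, hcx⟩ := mem_outer.1 hx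
    have hcn : c ∉ insert v (nbr G v) := disjoint_left.1 hdis.1 hc
    have hcF : c ∉ F := disjoint_left.1 hdis.2 hc
    rcases mem_union.1 (hnb c hc x hxC hcx) with h1 | h1
    · rcases mem_insert.1 h1 with rfl | h1
      · exact absurd (mem_insert_of_mem (mem_nbr.2 hcx.symm)) hcn
      · exact h1
    · exact absurd (mem_insert_of_mem (hF x h1 c hcF hcx.symm)) hcn
  refine ⟨C, hC, hzC, hdis.2, hdis.1, hout, h.five_le_card_outer hC fun heq => ?_⟩
  rcases mem_union.1 (heq ▸ mem_univ v) with h1 | h1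
  · exact disjoint_left.1 hdis.1 h1 (mem_insert_self _ _)
  · exact notMem_nbr_self G v (hout h1)

theorem exists_component_of_notMem {v z : V} (hzv : z ≠ v) (hzn : z ∉ nbr G v) :
    ∃ C, Conn G C ∧ z ∈ C ∧ Disjoint C (insert v (nbr G v)) ∧
      outer G C ⊆ nbr G v ∧ 5 ≤ #(outer G C) := by
  obtain ⟨C, h1, h2, -, h3⟩ := h.exists_component_avoiding (F := ∅) (by simp) hzv hzn (by simp)
  exact ⟨C, h1, h2, h3⟩

omit h in
theorem adjPairs_closed_nbr (G : SimpleGraph V) (v : V) :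
    adjPairs G (insert v (nbr G v)) (insert v (nbr G v)) =
      adjPairs G (nbr G v) (nbr G v) + 2 * #(nbr G v) := by
  rw [adjPairs_insert_self _ (notMem_nbr_self G v), deg_eq_card_nbr subset_rfl]

theorem exists_notMem_closed_nbr {v : V} (hv : #(nbr G v) ≤ 8) : ∃ z, z ≠ v ∧ z ∉ nbr G v := by
  by_contra hcon
  push Not at hcon
  have : (univ : Finset V) ⊆ insert v (nbr G v) := fun z _ => by
    by_cases hz : z = v
    · simp [hz]
    · exact mem_insert_of_mem (hcon z hz)
  have h1 := card_le_card this
  rw [card_insert_of_notMem (notMem_nbr_self G v), card_univ] at h1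
  have := h.ten_le
  omega

/-- N(v) misses at most a matching, that is three edges, so N[v] has at least 18 + 7 edges. A
component outside, contracted to a ninth vertex, adds five. -/
theorem card_nbr_ne_seven (v : V) : #(nbr G v) ≠ 7 := by
  intro hv
  obtain ⟨z, hz1, hz2⟩ := h.exists_notMem_closed_nbr (v := v) (by omega)
  obtain ⟨C, hC, -, hdis, hsub, h5⟩ := h.exists_component_of_notMem hz1 hz2
  have h1 := h.nine_of_dominated
    (by rw [card_insert_of_notMem (notMem_nbr_self G v), hv]) hC hdis
    (hsub.trans (subset_insert _ _)) fun t ht => (mem_outer.1 ht).2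
  rw [adjPairs_closed_nbr, hv] at h1
  have h2 := adjPairs_add_coPairs G (nbr G v)
  have h3 := coPairs_le_of_codeg_le (G := G) (S := nbr G v) (d := 1)
    fun s hs => by have := h.codeg_nbr hs; omega
  obtain ⟨r, hr⟩ := coPairs_even G (nbr G v)
  rw [hv] at h2 h3
  omega

/-- N(v) misses at least seven edges since N[v] has at most 29, and at most eight since each vertex
misses at most two. If it misses seven, D may gain nothing, so T is a clique and the vertices
outside T account for at most six. If it misses eight, D gains at most one edge, so T misses a
matching, and the count leaves only |T| = 5. -/
theorem coPairs_of_card_nbr_eq_eight {v : V} (hv : #(nbr G v) = 8) {D T : Finset V}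
    (hD : Conn G D) (hdis : Disjoint D (insert v (nbr G v))) (hT : T ⊆ nbr G v) (h5 : 5 ≤ #T)
    (hTD : ∀ t ∈ T, ∃ d ∈ D, G.Adj d t) :
    coPairs G (nbr G v) = 16 ∧ #T = 5 ∧ coPairs G T = 4 ∧ ∀ t ∈ T, codeg G T t ≤ 1 := by
  have hF : #(insert v (nbr G v)) = 9 := by
    rw [card_insert_of_notMem (notMem_nbr_self G v), hv]
  have h1 := h.nine _ _ (minorOn_self G (insert v (nbr G v))) hF
  rw [adjPairs_closed_nbr] at h1
  have h2 := adjPairs_add_coPairs G (nbr G v)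
  have hcod : ∀ s ∈ nbr G v, codeg G (nbr G v) s ≤ 2 :=
    fun s hs => by have := h.codeg_nbr hs; omega
  have h3 := coPairs_le_of_codeg_le hcod
  have h4 := coPairs_le_add hT hcod
  have h5' : ∀ t ∈ T, 2 * codeg G T t + 14 ≤ coPairs G (nbr G v) := by
    intro t ht
    obtain ⟨G', hG', hle⟩ := exists_minorOn_of_dominated (hT.trans (subset_insert v _)) hD hdis
      hTD ht
    have := h.nine _ _ hG' hF
    rw [adjPairs_closed_nbr] at hle
    rw [hv] at hle h2
    omega
  have hT8 := card_le_card hT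
  obtain ⟨r, hr⟩ := coPairs_even G (nbr G v)
  obtain ⟨q, hq⟩ := coPairs_even G T
  rw [hv] at h1 h2 h3 h4 hT8
  obtain h14 | h16 : coPairs G (nbr G v) = 14 ∨ coPairs G (nbr G v) = 16 := by omega
  · have h0 := coPairs_le_of_codeg_le (G := G) (S := T) (d := 0)
      fun s hs => by have := h5' s hs; omega
    omega
  · have h0 : ∀ t ∈ T, codeg G T t ≤ 1 := fun t ht => by have := h5' t ht; omega
    have := coPairs_le_of_codeg_le h0
    exact ⟨h16, by omega, by omega, h0⟩

/-- N[v] has 28 edges, and two disjoint outside sets can each be contracted to add another one. The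
two missing edges of T₂ form a matching, so s₁ cannot spoil both. -/
theorem false_of_card_nbr_eq_eight {v : V} (hv : #(nbr G v) = 8) {D₁ D₂ T₁ T₂ : Finset V}
    (hD₁ : Conn G D₁) (hdis₁ : Disjoint D₁ (insert v (nbr G v))) (hT₁ : T₁ ⊆ nbr G v)
    (h5₁ : 5 ≤ #T₁) (hTD₁ : ∀ t ∈ T₁, ∃ d ∈ D₁, G.Adj d t)
    (hD₂ : Conn G D₂) (hdis₂ : Disjoint D₂ (insert v (nbr G v))) (hT₂ : T₂ ⊆ nbr G v)
    (h5₂ : 5 ≤ #T₂) (hTD₂ : ∀ t ∈ T₂, ∃ d ∈ D₂, G.Adj d t) (hD : Disjoint D₁ D₂) : False := by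
  obtain ⟨h16, -, h4₁, -⟩ := h.coPairs_of_card_nbr_eq_eight hv hD₁ hdis₁ hT₁ h5₁ hTD₁
  obtain ⟨-, -, h4₂, h1₂⟩ := h.coPairs_of_card_nbr_eq_eight hv hD₂ hdis₂ hT₂ h5₂ hTD₂
  obtain ⟨s₁, hs₁, hpos₁⟩ := exists_pos_codeg (G := G) (S := T₁) (by omega)
  have hne : coPairs G (T₂.erase s₁) ≠ 0 := by
    by_cases hs : s₁ ∈ T₂
    · have := coPairs_erase G hs
      have := h1₂ s₁ hs
      omega
    · rw [erase_eq_of_notMem hs]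
      omega
  obtain ⟨s₂, hs₂, hpos₂⟩ := exists_pos_codeg hne
  rw [mem_erase] at hs₂
  obtain ⟨G', hG', hle⟩ := exists_minorOn_of_dominated₂ (hT₁.trans (subset_insert v _))
    (hT₂.trans (subset_insert v _)) hD₁ hD₂ hdis₁ hdis₂ hD hTD₁ hTD₂ hs₁ hs₂.2 hs₂.1.symm
  have h1 := h.nine _ _ hG' (by rw [card_insert_of_notMem (notMem_nbr_self G v), hv])
  have h2 := adjPairs_add_coPairs G (nbr G v)
  rw [adjPairs_closed_nbr] at hle
  rw [hv] at hle h2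
  omega

theorem card_nbr_ne_eight (v : V) : #(nbr G v) ≠ 8 := by
  intro hv
  obtain ⟨z, hz1, hz2⟩ := h.exists_notMem_closed_nbr (v := v) (by omega)
  obtain ⟨C, hC, -, hdis, hsub, h5⟩ := h.exists_component_of_notMem hz1 hz2
  have hTC : ∀ t ∈ outer G C, ∃ c ∈ C, G.Adj c t := fun t ht => (mem_outer.1 ht).2
  obtain ⟨h16, hT5, hT4, hT1⟩ := h.coPairs_of_card_nbr_eq_eight hv hC hdis hsub h5 hTC
  have hF : #(insert v (nbr G v)) = 9 := by
    rw [card_insert_of_notMem (notMem_nbr_self G v), hv]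
  by_cases hz : ∃ z, z ∉ C ∧ z ∉ insert v (nbr G v)
  · obtain ⟨z, hzC, hz⟩ := hz
    rw [mem_insert, not_or] at hz
    obtain ⟨D, hD, -, hDC, hDdis, hDsub, hD5⟩ := h.exists_component_avoiding hzC hz.1 hz.2
      fun x hx y hy hxy => hsub (mem_outer.2 ⟨hy, x, hx, hxy⟩)
    exact h.false_of_card_nbr_eq_eight hv hC hdis hsub h5 hTC hD hDdis hDsub hD5
      (fun t ht => (mem_outer.1 ht).2) hDC.symm
  · push Not at hz
    have hCF : Cᶜ = insert v (nbr G v) := by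
      ext x
      rw [mem_compl]
      exact ⟨hz x, fun hx hxC => disjoint_left.1 hdis hxC hx⟩
    have hcut := adjPairs_cut G C
    rw [hCF, adjPairs_closed_nbr] at hcut
    have hE := h.edges
    have hH := adjPairs_add_coPairs G (nbr G v)
    have hT := adjPairs_add_coPairs G (outer G C)
    have hX := adjPairs_add_coPairs G (C ∪ outer G C)
    have hcard : #(C ∪ outer G C) = #C + 5 := by
      rw [card_union_of_disjoint (disjoint_outer G C), hT5]
    have hn : #C + 9 = Fintype.card V := by rw [← hF, ← hCF, card_add_card_compl]
    obtain ⟨c, hc⟩ := hC.1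
    have hc6 := h.six_le_deg_union_outer (mem_union_left (outer G C) hc)
    have hc7 := deg_add_codeg G (mem_union_left (outer G C) hc)
    rw [hv] at hH hcut
    rw [hT5] at hT
    -- C is all that lies outside N[v]. The cut formula gives C ∪ T, with T the boundary, exactly
    -- 5|C| + 11 edges, one more than allowed once it has nine vertices.
    have hn3 : #C ≤ 3 := by
      by_contra hlt
      have := h.small _ _ (minorOn_self G (C ∪ outer G C)) (by omega) (by omega)
      omega
    have hmono := coPairs_mono G (subset_union_right (s₁ := C) (s₂ := outer G C))
    have hu := coPairs_union G (disjoint_outer G C)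
    rw [hcard] at hX
    obtain h2 | h3 : #C = 2 ∨ #C = 3 := by omega
    · rw [h2] at hX
      omega
    · rw [h3] at hX
      -- C ∪ T misses only two edges, and T already misses two. So C is complete to T, and two
      -- single vertices of C serve as the two outside sets.
      have h0 : ∑ a ∈ C, codeg G (outer G C) a = 0 := by omega
      rw [sum_eq_zero_iff] at h0
      have hadj : ∀ c ∈ C, ∀ t ∈ outer G C, G.Adj c t := fun c hc t ht =>
        codeg_eq_zero_iff.1 (h0 c hc) t ht
          fun hct => disjoint_left.1 (disjoint_outer G C) hc (hct ▸ ht)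
      obtain ⟨a, ha, b, hb, hab⟩ := one_lt_card.1 (show 1 < #C by omega)
      have hdis' : ∀ c ∈ C, Disjoint {c} (insert v (nbr G v)) := fun c hc => by
        rw [disjoint_singleton_left]
        exact disjoint_left.1 hdis hc
      exact h.false_of_card_nbr_eq_eight hv (conn_singleton G a) (hdis' a ha) hsub h5
        (fun t ht => ⟨a, mem_singleton_self a, hadj a ha t ht⟩) (conn_singleton G b) (hdis' b hb)
        hsub h5 (fun t ht => ⟨b, mem_singleton_self b, hadj b hb t ht⟩) (by simpa using hab)

end IsCritical

end
end DenseMinor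

/-! ### Minimum degree nine is impossible -/

namespace DenseMinor
section
open scoped Classical
open Finset

variable {V : Type*} [Fintype V]

namespace IsCritical

variable {G : SimpleGraph V} (h : IsCritical G)
include h

theorem codeg_nbr_le_three {v : V} (hv : #(nbr G v) = 9) {x : V} (hx : x ∈ nbr G v) :
    codeg G (nbr G v) x ≤ 3 := by
  have := h.codeg_nbr hx
  omega

omit h in
theorem adjPairs_insert_erase {v : V} (hv : #(nbr G v) = 9) {x : V} (hx : x ∈ nbr G v) :
    #(insert v ((nbr G v).erase x)) = 9 ∧
      adjPairs G (insert v ((nbr G v).erase x)) (insert v ((nbr G v).erase x)) +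
        coPairs G ((nbr G v).erase x) = 72 := by
  have h1 : v ∉ (nbr G v).erase x := fun h => notMem_nbr_self G v (mem_erase.1 h).2
  have h2 : #((nbr G v).erase x) = 8 := by rw [card_erase_of_mem hx, hv]
  have h3 := adjPairs_add_coPairs G ((nbr G v).erase x)
  have h4 : deg G ((nbr G v).erase x) v = 8 := by
    rw [deg_eq_card_inter, inter_eq_right.2 (erase_subset _ _), h2]
  rw [card_insert_of_notMem h1, adjPairs_insert_self _ h1, h4]
  rw [h2] at h3 ⊢
  omega

/-- N[v] without x has nine vertices, so N(v) without x must still miss seven edges. -/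
theorem codeg_nbr_le {v : V} (hv : #(nbr G v) = 9) {x : V} (hx : x ∈ nbr G v) :
    2 * codeg G (nbr G v) x + 14 ≤ coPairs G (nbr G v) := by
  obtain ⟨h1, h2⟩ := adjPairs_insert_erase hv hx
  have h3 := h.nine _ _ (minorOn_self G _) h1
  have h4 := coPairs_erase G hx
  omega

omit h [Fintype V] in
-- Every non-neighbour of u has u as a non-neighbour in turn, hence lies in T.
theorem codeg_eq_of_subset_of_pos {H T S : Finset V} {u : V} (hu : u ∈ H)
    (hT : ∀ x ∈ H, 0 < codeg G H x → x ∈ T) (hS : S ⊆ H) :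
    codeg G S u ≤ codeg G (T ∩ S) u := by
  refine card_le_card fun t ht => ?_
  obtain ⟨h1, h2, h3⟩ := mem_filter.1 ht
  refine mem_filter.2 ⟨mem_inter.2 ⟨hT t (hS h1) (card_pos.2 ⟨u, ?_⟩), h1⟩, h2, h3⟩
  exact mem_filter.2 ⟨hu, h2.symm, fun h => h3 h.symm⟩

/-- A connected set outside `N[v]` cannot be attached to all vertices of `N(v)` that have a
non-neighbour in `N(v)`. -/
theorem false_of_attached {v : V} (hv : #(nbr G v) = 9) {D T : Finset V} (hD : Conn G D)
    (hdis : Disjoint D (insert v (nbr G v)))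
    (hTD : ∀ t ∈ T, ∃ d ∈ D, G.Adj d t)
    (hall : ∀ x ∈ nbr G v, 0 < codeg G (nbr G v) x → x ∈ T) : False := by
  obtain ⟨u, hu, hsum, hmax⟩ := exists_coPairs_le G (S := nbr G v) (card_pos.1 (by omega))
  have hu3 := h.codeg_nbr_le_three hv hu
  have hu14 := h.codeg_nbr_le hv hu
  have huT : u ∈ T := hall u hu (by
    by_contra h0
    have : codeg G (nbr G v) u = 0 := by omega
    rw [this] at hsum
    omega)
  have hR8 : #((nbr G v).erase u) = 8 := by rw [card_erase_of_mem hu, hv]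
  have hcoR := coPairs_erase G hu
  obtain ⟨x, hx, hsum', hmax'⟩ := exists_coPairs_le G (S := (nbr G v).erase u)
    (card_pos.1 (by omega))
  obtain ⟨hxu, hxH⟩ := mem_erase.1 hx
  have hx3 : codeg G ((nbr G v).erase u) x ≤ 3 :=
    (codeg_mono (erase_subset _ _) x).trans (h.codeg_nbr_le_three hv hxH)
  rw [hR8] at hsum'
  rw [hv] at hsum
  -- contract `D` onto `u` and delete a vertex `y`
  have hdisX : ∀ y, Disjoint D (insert v ((nbr G v).erase y)) := fun y =>
    disjoint_of_subset_right (insert_subset_insert _ (erase_subset _ _)) hdis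
  -- Once D has joined u to everything, the edges missing from N[v] - y are those missing from N(v)
  -- - u - y. The last conjunct makes the truncated subtraction harmless.
  have hE : ∀ y ∈ nbr G v, y ≠ u →
      adjPairs G (insert v ((nbr G v).erase y)) (insert v ((nbr G v).erase y)) +
        coPairs G ((nbr G v).erase u) = 72 + 2 * codeg G ((nbr G v).erase u) y -
          2 * codeg G ((nbr G v).erase y) u ∧
      codeg G ((nbr G v).erase y) u ≤ codeg G (T ∩ (nbr G v).erase y) u ∧
      u ∈ T ∩ (nbr G v).erase y ∧ 2 * codeg G ((nbr G v).erase y) u ≤ 72 := by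
    intro y hy hyu
    obtain ⟨-, h2⟩ := adjPairs_insert_erase hv hy
    have h3 := coPairs_erase G (A := (nbr G v).erase y) (x := u) (mem_erase.2 ⟨hyu.symm, hu⟩)
    have h4 := coPairs_erase G (A := (nbr G v).erase u) (x := y) (mem_erase.2 ⟨hyu, hy⟩)
    rw [erase_right_comm] at h4
    exact ⟨by omega, codeg_eq_of_subset_of_pos hu hall (erase_subset _ _),
      mem_inter.2 ⟨huT, mem_erase.2 ⟨hyu.symm, hu⟩⟩, by omega⟩
  have hdel : 14 + 2 * codeg G ((nbr G v).erase u) x ≤ coPairs G ((nbr G v).erase u) := by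
    obtain ⟨h1, h2, h3, h4⟩ := hE x hxH hxu
    obtain ⟨G', hG', hle⟩ := exists_minorOn_of_dominated (G := G) (S := T ∩ (nbr G v).erase x)
      (X := insert v ((nbr G v).erase x)) (inter_subset_right.trans (subset_insert _ _)) hD
      (hdisX x) (fun t ht => hTD t (mem_inter.1 ht).1) h3
    have := h.nine _ _ hG' (adjPairs_insert_erase hv hxH).1
    omega
  obtain ⟨r, hr⟩ := coPairs_even G (nbr G v)
  -- With the upper bounds 9d and 8e, for d and e the largest numbers of non-neighbours in N(v) and
  -- N(v) - u, both lower bounds can hold only for d = e = 3; parity gives the value 20.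
  have h20 : coPairs G ((nbr G v).erase u) = 20 ∧ codeg G ((nbr G v).erase u) x = 3 := by omega
  set R := (nbr G v).erase u with hR
  set B := R.filter fun t => t ≠ x ∧ ¬ G.Adj x t with hB
  have hB3 : #B = 3 := h20.2
  have hRH : R ⊆ nbr G v := erase_subset _ _
  have hBR : B ⊆ R := filter_subset _ _
  have hT5 : #(R \ B) = 5 := by rw [card_sdiff_of_subset hBR, hR8, hB3]
  -- R misses ten edges and the three vertices of B meet at most nine of them.
  have hpos : coPairs G (R \ B) ≠ 0 := by
    have := coPairs_le_add (G := G) (H := R) (T := R \ B) (d := 3) sdiff_subset fun y hy =>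
      (codeg_mono hRH y).trans (h.codeg_nbr_le_three hv (hRH hy))
    omega
  obtain ⟨y, hy, hypos⟩ := exists_pos_codeg hpos
  obtain ⟨hyR, hyB⟩ := mem_sdiff.1 hy
  have hyx : y ≠ x := by
    rintro rfl
    have : codeg G (R \ B) y = 0 := codeg_eq_zero_iff.2 fun t ht hty => by
      rw [mem_sdiff] at ht
      by_contra hadj
      exact ht.2 (mem_filter.2 ⟨ht.1, hty, hadj⟩)
    omega
  have hxy : G.Adj y x := by
    by_contra hadj
    exact hyB (mem_filter.2 ⟨hyR, hyx, fun h => hadj h.symm⟩)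
  obtain ⟨hyu, hyH⟩ := mem_erase.1 hyR
  obtain ⟨h1, h2, h3, h4⟩ := hE y hyH hyu
  have hS2 : nbr G v ∩ nbr G y ⊆ insert v ((nbr G v).erase y) := fun t ht => by
    rw [mem_inter, mem_nbr (v := y)] at ht
    exact mem_insert_of_mem (mem_erase.2 ⟨ht.2.ne', ht.1⟩)
  have hyX : Disjoint {y} (insert v ((nbr G v).erase y)) := by
    rw [disjoint_singleton_left, mem_insert, not_or]
    exact ⟨fun h => notMem_nbr_self G v (h ▸ hyH), notMem_erase _ _⟩
  -- Instead of deleting y, contract it onto x while D goes onto u. Each vertex of B is a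
  -- non-neighbour of y, whose removal disposes of a missing edge, or a neighbour, and then x gains
  -- it. With the non-neighbour of y outside B this saves four edges, and 26 + 4 = 30.
  obtain ⟨G', hG', hle⟩ := exists_minorOn_of_dominated₂ (G := G)
    (S₁ := T ∩ (nbr G v).erase y) (S₂ := nbr G v ∩ nbr G y)
    (X := insert v ((nbr G v).erase y)) (inter_subset_right.trans (subset_insert _ _)) hS2 hD
    (conn_singleton G y) (hdisX y) hyX
    (by rw [disjoint_singleton_right]
        exact disjoint_right.1 hdis (mem_insert_of_mem hyH))
    (fun t ht => hTD t (mem_inter.1 ht).1)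
    (fun t ht => ⟨y, mem_singleton_self y, mem_nbr.1 (mem_inter.1 ht).2⟩) h3
    (mem_inter.2 ⟨hxH, mem_nbr.2 hxy⟩) hxu.symm
  have h5 := h.nine _ _ hG' (adjPairs_insert_erase hv hyH).1
  have h6 : codeg G R y = codeg G (R \ B) y + codeg G B y := by
    rw [← codeg_union G sdiff_disjoint, sdiff_union_of_subset hBR]
  have h7 := deg_add_codeg_of_notMem G hyB
  have h8 : deg G B y ≤ codeg G ((nbr G v ∩ nbr G y).erase u) x := by
    refine card_le_card fun t ht => ?_
    obtain ⟨htB, hyt⟩ := mem_filter.1 ht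
    obtain ⟨htR, htx⟩ := mem_filter.1 htB
    obtain ⟨htu, htH⟩ := mem_erase.1 htR
    exact mem_filter.2 ⟨mem_erase.2 ⟨htu, mem_inter.2 ⟨htH, mem_nbr.2 hyt⟩⟩, htx⟩
  omega

theorem sum_card_nbr : ∑ x, #(nbr G x) + 28 = 10 * Fintype.card V := h.edges

omit h in
theorem ten_le_card_union_outer (h9 : ∀ x, 9 ≤ #(nbr G x)) {C : Finset V} (hC : Conn G C) :
    10 ≤ #(C ∪ outer G C) := by
  obtain ⟨c, hc⟩ := hC.1
  have h1 := card_le_card (insert_subset (mem_union_left _ hc) (nbr_subset (G := G) hc))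
  rw [card_insert_of_notMem (notMem_nbr_self G c)] at h1
  have := h9 c
  omega

/-- A component outside `N[v]`, where `v` has degree nine, has a vertex of degree nine. -/
theorem exists_card_nbr_eq_nine (h9 : ∀ x, 9 ≤ #(nbr G x)) {v : V} (hv : #(nbr G v) = 9)
    {D : Finset V} (hD : Conn G D) (hdis : Disjoint D (insert v (nbr G v)))
    (hout : outer G D ⊆ nbr G v) : ∃ w ∈ D, #(nbr G w) = 9 := by
  by_contra hcon
  push Not at hcon
  have hSD : ∀ t ∈ outer G D, ∃ d ∈ D, G.Adj d t := fun t ht => (mem_outer.1 ht).2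
  have hvX : v ∉ D ∪ outer G D := fun hvX => by
    rcases mem_union.1 hvX with h1 | h1
    · exact disjoint_left.1 hdis h1 (mem_insert_self _ _)
    · exact notMem_nbr_self G v (hout h1)
  have hXn : #(D ∪ outer G D) < Fintype.card V := card_lt_univ_of_notMem hvX
  have hX10 := ten_le_card_union_outer h9 hD
  have h1 : 10 * #D ≤ adjPairs G D D + adjPairs G D (outer G D) := by
    rw [← adjPairs_union_right G (disjoint_outer G D), mul_comm]
    refine (smul_eq_mul (#D) 10) ▸ card_nsmul_le_sum D _ 10 fun x hx => ?_
    rw [deg_eq_card_nbr (nbr_subset hx)]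
    have h2 := h9 x
    have h3 := hcon x hx
    omega
  have h2 : 6 * #(outer G D) ≤
      adjPairs G D (outer G D) + adjPairs G (outer G D) (outer G D) := by
    rw [adjPairs_comm G D, ← adjPairs_union_right G (disjoint_outer G D), mul_comm]
    exact (smul_eq_mul (#(outer G D)) 6) ▸ card_nsmul_le_sum (outer G D) _ 6 fun x hx =>
      h.six_le_deg_union_outer (mem_union_right _ hx)
  have h3 := adjPairs_union_self G (disjoint_outer G D)
  have h4 := h.small _ _ (minorOn_self G (D ∪ outer G D)) (by omega) hXn
  have h5 := card_union_of_disjoint (disjoint_outer G D)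
  have h6 := card_le_card hout
  rw [hv] at h6
  -- Degrees at least 10 in D and at least 6 on the boundary S exceed the bound for D ∪ S unless
  -- 4|S| ≥ 30.
  obtain hk | hk : #(outer G D) = 8 ∨ #(outer G D) = 9 := by omega
  -- There is room for a single extra edge, so S misses at most a matching. Then N(v) misses at most
  -- 4 + 3 edges, while it must miss at least seven, and more as soon as any vertex has a
  -- non-neighbour.
  · have hcod : ∀ s ∈ outer G D, codeg G (outer G D) s ≤ 1 := fun s hs => by
      have := h.small_of_dominated (by omega) hXn subset_union_right (conn_singleton G v)
        (disjoint_singleton_left.2 hvX)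
        (fun t ht => ⟨v, mem_singleton_self v, mem_nbr.1 (hout ht)⟩) hs
      omega
    have h7 := coPairs_le_of_codeg_le hcod
    have h8 := coPairs_le_add (G := G) hout fun x hx => h.codeg_nbr_le_three hv hx
    have h0 := coPairs_le_of_codeg_le (G := G) (S := nbr G v) (d := 0) fun x hx => by
      have := h.codeg_nbr_le hv hx
      omega
    obtain ⟨x, hx⟩ : (nbr G v).Nonempty := card_pos.1 (by omega)
    have := h.codeg_nbr_le hv hx
    omega
  · have heq : outer G D = nbr G v := eq_of_subset_of_card_le hout (by omega)
    exact h.false_of_attached hv hD hdis hSD fun x hx _ => heq ▸ hx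

theorem false_of_nine_le (h9 : ∀ x, 9 ≤ #(nbr G x)) : False := by
  have hsum := h.sum_card_nbr
  have hn : 28 ≤ Fintype.card V := by
    have : Fintype.card V * 9 ≤ ∑ x, #(nbr G x) :=
      (smul_eq_mul (Fintype.card V) 9) ▸ card_nsmul_le_sum univ _ 9 fun x _ => h9 x
    omega
  obtain ⟨v₀, hv₀⟩ : ∃ v, #(nbr G v) = 9 := by
    by_contra hcon
    push Not at hcon
    have : Fintype.card V * 10 ≤ ∑ x, #(nbr G x) :=
      (smul_eq_mul (Fintype.card V) 10) ▸ card_nsmul_le_sum univ _ 10 fun x _ => by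
        have h1 := h9 x
        have h2 := hcon x
        omega
    omega
  obtain ⟨z₀, hz₀⟩ : ∃ z, z ∉ insert v₀ (nbr G v₀) := by
    by_contra hcon
    push Not at hcon
    have h1 := card_le_card (fun z _ => hcon z : (univ : Finset V) ⊆ _)
    rw [card_insert_of_notMem (notMem_nbr_self G v₀), card_univ] at h1
    omega
  obtain ⟨C, hC, hmax⟩ := exists_max_image
    ((univ : Finset (Finset V)).filter fun C => Conn G C ∧
      ∃ v, #(nbr G v) = 9 ∧ Disjoint C (insert v (nbr G v))) card
    ⟨{z₀}, by
      simp only [mem_filter, mem_univ, true_and]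
      exact ⟨conn_singleton G z₀, v₀, hv₀, disjoint_singleton_left.2 hz₀⟩⟩
  simp only [mem_filter, mem_univ, true_and] at hC hmax
  obtain ⟨hC, v, hv, hCv⟩ := hC
  -- Otherwise a boundary vertex outside N(w) could be added to C, against its maximality.
  have hout : ∀ w, #(nbr G w) = 9 → Disjoint C (insert w (nbr G w)) → outer G C ⊆ nbr G w := by
    intro w hw hCw s hs
    obtain ⟨hsC, c, hc, hcs⟩ := mem_outer.1 hs
    by_contra hsw
    have hsw' : s ∉ insert w (nbr G w) := by
      rw [mem_insert, not_or]
      refine ⟨?_, hsw⟩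
      rintro rfl
      exact disjoint_left.1 hCw hc (mem_insert_of_mem (mem_nbr.2 hcs.symm))
    have := hmax (insert s C) ⟨conn_insert hC hc hcs, w, hw, by
      rw [disjoint_insert_left]; exact ⟨hsw', hCw⟩⟩
    rw [card_insert_of_notMem hsC] at this
    omega
  have hSv := hout v hv hCv
  have hSC : ∀ t ∈ outer G C, ∃ c ∈ C, G.Adj c t := fun t ht => (mem_outer.1 ht).2
  obtain ⟨u, hu, hupos, huS⟩ : ∃ u ∈ nbr G v, 0 < codeg G (nbr G v) u ∧ u ∉ outer G C := by
    by_contra hcon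
    push Not at hcon
    exact h.false_of_attached hv hC hCv hSC hcon
  -- Having a non-neighbour in N(v), u has at most eight neighbours inside N[v] but degree at least
  -- nine.
  obtain ⟨z, huz, hz⟩ : ∃ z, G.Adj u z ∧ z ∉ insert v (nbr G v) := by
    by_contra hcon
    push Not at hcon
    have h1 : nbr G u ⊆ insert v (nbr G v) := fun z hz => hcon z (mem_nbr.1 hz)
    have h2 := deg_eq_card_nbr h1
    have h3 := deg_add_codeg G (mem_insert_of_mem hu : u ∈ insert v (nbr G v))
    have h4 := codeg_mono (G := G) (subset_insert v (nbr G v)) u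
    rw [card_insert_of_notMem (notMem_nbr_self G v)] at h3
    have := h9 u
    omega
  have hzC : z ∉ C := fun hzC => huS (mem_outer.2
    ⟨fun huC => disjoint_left.1 hCv huC (mem_insert_of_mem hu), z, hzC, huz.symm⟩)
  rw [mem_insert, not_or] at hz
  obtain ⟨D, hD, hzD, hDC, hDv, hDout, -⟩ := h.exists_component_avoiding hzC hz.1 hz.2
    fun x hx y hy hxy => hSv (mem_outer.2 ⟨hy, x, hx, hxy⟩)
  obtain ⟨w, hwD, hw⟩ := h.exists_card_nbr_eq_nine h9 hv hD hDv hDout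
  have hwC : w ∉ C := disjoint_left.1 hDC hwD
  have hCw : Disjoint C (insert w (nbr G w)) := by
    rw [disjoint_insert_right]
    refine ⟨hwC, disjoint_left.2 fun c hc hcw => ?_⟩
    exact disjoint_left.1 hCv hc (mem_insert_of_mem (hDout (mem_outer.2
      ⟨disjoint_right.1 hDC hc, w, hwD, mem_nbr.1 hcw⟩)))
  have hSw := hout w hw hCw
  have hvX : v ∉ C ∪ outer G C := fun hvX => by
    rcases mem_union.1 hvX with h1 | h1
    · exact disjoint_left.1 hCv h1 (mem_insert_self _ _)
    · exact notMem_nbr_self G v (hSv h1)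
  have hwX : w ∉ C ∪ outer G C := fun hwX => by
    rcases mem_union.1 hwX with h1 | h1
    · exact hwC h1
    · exact notMem_nbr_self G w (hSw h1)
  have hvw : v ≠ w := fun hvw =>
    disjoint_left.1 hDv hwD (mem_insert.2 (Or.inl hvw.symm))
  have hXn : #(C ∪ outer G C) < Fintype.card V := card_lt_univ_of_notMem hvX
  have hX10 := ten_le_card_union_outer h9 hC
  have h5 := h.five_le_card_outer hC fun heq => hvX (heq ▸ mem_univ v)
  obtain ⟨s₁, hs₁, hsum₁, hmax₁⟩ := exists_coPairs_le G (S := outer G C) (card_pos.1 (by omega))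
  have hk1 : #((outer G C).erase s₁) + 1 = #(outer G C) := card_erase_add_one hs₁
  obtain ⟨s₂, hs₂, hsum₂, -⟩ := exists_coPairs_le G (S := (outer G C).erase s₁)
    (card_pos.1 (by omega))
  rw [mem_erase] at hs₂
  obtain ⟨G', hG', hle⟩ := exists_minorOn_of_dominated₂ (G := G) (X := C ∪ outer G C)
    (S₁ := outer G C) (S₂ := outer G C) subset_union_right subset_union_right
    (conn_singleton G v) (conn_singleton G w) (disjoint_singleton_left.2 hvX)
    (disjoint_singleton_left.2 hwX) (by simpa using hvw)
    (fun t ht => ⟨v, mem_singleton_self v, mem_nbr.1 (hSv ht)⟩)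
    (fun t ht => ⟨w, mem_singleton_self w, mem_nbr.1 (hSw ht)⟩) hs₁ hs₂.2 hs₂.1.symm
  have hb1 := h.small _ _ hG' (by omega) hXn
  have hcompl := card_add_card_compl C
  have hCpos : 0 < #C := card_pos.2 hC.1
  have hCc : 10 ≤ #Cᶜ := by
    have h1 : insert v (nbr G v) ⊆ Cᶜ := fun x hx => mem_compl.2 (disjoint_right.1 hCv hx)
    have h2 := card_le_card h1
    rw [card_insert_of_notMem (notMem_nbr_self G v)] at h2
    omega
  have hb2 := h.small_of_dominated (X := Cᶜ) (by omega) (by omega)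
    (fun x hx => mem_compl.2 (disjoint_right.1 (disjoint_outer G C) hx)) hC disjoint_compl_right
    hSC hs₁
  have hk8 : #(outer G C) ≤ 8 := by
    have := card_le_card (fun x hx => mem_erase.2 ⟨fun h => huS (h ▸ hx), hSv hx⟩ :
      outer G C ⊆ (nbr G v).erase u)
    rw [card_erase_of_mem hu] at this
    omega
  have hs3 : codeg G (outer G C) s₁ ≤ 3 :=
    (codeg_mono hSv s₁).trans (h.codeg_nbr_le_three hv (hSv hs₁))
  -- With k = |S|, d and d' the gains at s₁ and s₂, and m twice the edges missing from S, the two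
  -- bounds and the cut formula give k(k - 1) - m + 4d + 2d' ≤ 10k - 32. This fails for 5 ≤ k ≤ 8
  -- and d ≤ 3, as m is even, m ≤ kd and m ≤ 2d + (k - 1)d'.
  have hcut := adjPairs_cut G C
  have hE := h.edges
  have hS := adjPairs_add_coPairs G (outer G C)
  have hco := coPairs_erase G hs₁
  have hcard := card_union_of_disjoint (disjoint_outer G C)
  obtain ⟨r, hr⟩ := coPairs_even G (outer G C)
  generalize #(outer G C) = k at *
  generalize codeg G (outer G C) s₁ = d at *
  generalize #((outer G C).erase s₁) = k' at *
  obtain rfl : k' = k - 1 := by omega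
  interval_cases k <;> interval_cases d <;> omega

end IsCritical

end
end DenseMinor

/-! ### Menger's theorem -/

namespace DenseMinor
section
open scoped Classical
open Finset

variable {V : Type*} [Fintype V]

/-- `(U, W)` is a separation of `G` with `A` on the first side and `B` on the second. -/
structure IsSeparation (G : SimpleGraph V) (A B U W : Finset V) : Prop where
  cover : ∀ x, x ∈ U ∨ x ∈ W
  left : A ⊆ U
  right : B ⊆ W
  noEdge : ∀ x, x ∈ U → x ∉ W → ∀ y, y ∈ W → y ∉ U → ¬ G.Adj x y

omit [Fintype V] in
theorem IsSeparation.symm {G : SimpleGraph V} {A B U W : Finset V} (h : IsSeparation G A B U W) :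
    IsSeparation G B A W U :=
  ⟨fun x => (h.cover x).symm, h.right, h.left,
    fun x hx hxU y hy hyW hxy => h.noEdge y hy hyW x hx hxU hxy.symm⟩

/-- The graph `G` with the edges that leave `U` removed. -/
def restrictTo (G : SimpleGraph V) (U : Finset V) : SimpleGraph V where
  Adj a b := G.Adj a b ∧ a ∈ U ∧ b ∈ U
  symm := ⟨fun _ _ h => ⟨h.1.symm, h.2.2, h.2.1⟩⟩
  loopless := ⟨fun _ h => h.1.ne rfl⟩

omit [Fintype V] in
theorem restrictTo_le (G : SimpleGraph V) (U : Finset V) : restrictTo G U ≤ G := fun _ _ h => h.1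

omit [Fintype V] in
theorem Conn.subset_of_restrictTo {G : SimpleGraph V} {U P : Finset V}
    (hP : Conn (restrictTo G U) P) (h : (P ∩ U).Nonempty) : P ⊆ U := by
  by_contra hcon
  obtain ⟨a, -, b, hb, hab⟩ := hP.2 (P ∩ U) inter_subset_left h fun heq =>
    hcon (inter_eq_left.1 heq)
  rw [mem_sdiff, mem_inter] at hb
  exact hb.2 ⟨hb.1, hab.2.2⟩

theorem adjPairs_lt_of_le {G G' : SimpleGraph V} (hle : G' ≤ G) {x y : V} (hxy : G.Adj x y)
    (hxy' : ¬ G'.Adj x y) : adjPairs G' univ univ < adjPairs G univ univ := by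
  rw [adjPairs_eq_card, adjPairs_eq_card]
  refine card_lt_card ((ssubset_iff_of_subset (monotone_filter_right _ fun p _ hp => hle hp)).2
    ⟨(x, y), by simpa using hxy, by simpa using hxy'⟩)

omit [Fintype V] in
-- A separation inside U extends to G as (U₁ ∩ U, W₁ ∪ W) without growing its middle, since U ∩ W ⊆
-- W₁. Edges from U \ W to W \ U do no harm, as they start at x, which lies in W₁.
theorem le_card_separation_restrictTo {G : SimpleGraph V} {A B U W : Finset V} {k : ℕ} {x : V}
    (hsep : ∀ U W, IsSeparation G A B U W → k ≤ #(U ∩ W)) (hcover : ∀ x, x ∈ U ∨ x ∈ W)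
    (hA : A ⊆ U) (hB : B ⊆ W)
    (hx : ∀ p, p ∈ U → p ∉ W → ∀ q, q ∈ W → q ∉ U → G.Adj p q → p = x) (U₁ W₁ : Finset V)
    (h₁ : IsSeparation (restrictTo G U) A (insert x (U ∩ W)) U₁ W₁) : k ≤ #(U₁ ∩ W₁) := by
  have hY : ∀ z, z ∈ U → z ∈ W → z ∈ W₁ := fun z h1 h2 =>
    h₁.right (mem_insert_of_mem (mem_inter.2 ⟨h1, h2⟩))
  refine (hsep (U₁ ∩ U) (W₁ ∪ W) ⟨?_, subset_inter h₁.left hA,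
    hB.trans subset_union_right, ?_⟩).trans (card_le_card ?_)
  · intro z
    rw [mem_inter, mem_union]
    have := hcover z
    have := h₁.cover z
    tauto
  · intro p hp hp' q hq hq' hpq
    rw [mem_inter] at hp hq'
    rw [mem_union, not_or] at hp'
    by_cases hqU : q ∈ U
    · have hqU₁ : q ∉ U₁ := fun h => hq' ⟨h, hqU⟩
      have hqW₁ : q ∈ W₁ := (h₁.cover q).resolve_left hqU₁
      exact h₁.noEdge p hp.1 hp'.1 q hqW₁ hqU₁ ⟨hpq, hp.2, hqU⟩
    · have hqW : q ∈ W := (hcover q).resolve_left hqU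
      have := hx p hp.2 hp'.2 q hqW hqU hpq
      exact hp'.1 (this ▸ h₁.right (mem_insert_self _ _))
  · intro z hz
    rw [mem_inter, mem_inter, mem_union] at hz
    rw [mem_inter]
    refine ⟨hz.1.1, hz.2.elim id (hY z hz.1.2)⟩

omit [Fintype V] in
-- With k disjoint sets against k target vertices, each set takes exactly one target and none is
-- left over.
theorem image_eq_of_disjoint {k : ℕ} {P : Fin k → Finset V} {B : Finset V} {f : Fin k → V}
    (hP : ∀ i j, i ≠ j → Disjoint (P i) (P j)) (hf : ∀ i, f i ∈ P i) (hfB : ∀ i, f i ∈ B)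
    (hB : #B = k) : Function.Injective f ∧ ∀ z ∈ B, ∃ i, f i = z := by
  have hinj : Function.Injective f := fun i j hij => by
    by_contra hne
    exact disjoint_left.1 (hP i j hne) (hf i) (hij ▸ hf j)
  refine ⟨hinj, fun z hz => ?_⟩
  have himg : univ.image f = B := eq_of_subset_of_card_le
    (fun y hy => by obtain ⟨i, -, rfl⟩ := mem_image.1 hy; exact hfB i)
    (by rw [card_image_of_injective _ hinj, card_univ, Fintype.card_fin, hB])
  rw [← himg] at hz
  obtain ⟨i, -, h⟩ := mem_image.1 hz
  exact ⟨i, h⟩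

/-- Menger's theorem, with connected sets in the place of paths. -/
theorem exists_disjoint_conn (G : SimpleGraph V) (A B : Finset V) (k : ℕ)
    (hsep : ∀ U W, IsSeparation G A B U W → k ≤ #(U ∩ W)) :
    ∃ P : Fin k → Finset V, (∀ i, Conn G (P i)) ∧ (∀ i j, i ≠ j → Disjoint (P i) (P j)) ∧
      ∀ i, (P i ∩ A).Nonempty ∧ (P i ∩ B).Nonempty := by
  induction hm : adjPairs G univ univ using Nat.strong_induction_on generalizing G A B with
  | _ m ih =>
  subst hm
  by_cases hedge : ∃ x y, G.Adj x y
  swap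
  · push Not at hedge
    have h1 := hsep A (Aᶜ ∪ B) ⟨fun x => by
      rw [mem_union, mem_compl]; tauto, subset_rfl, subset_union_right,
      fun x _ _ y _ _ hxy => hedge x y hxy⟩
    rw [inter_union_distrib_left, inter_compl, empty_union] at h1
    obtain ⟨C, hC, hCk⟩ := exists_subset_card_eq h1
    let e := C.equivFinOfCardEq hCk
    refine ⟨fun i => {(e.symm i).1}, fun i => conn_singleton G _, fun i j hij => ?_, fun i => ?_⟩
    · rw [disjoint_singleton_left, mem_singleton]
      exact fun h => hij (e.symm.injective (Subtype.ext h))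
    · have := mem_inter.1 (hC (e.symm i).2)
      exact ⟨⟨_, mem_inter.2 ⟨mem_singleton_self _, this.1⟩⟩,
        ⟨_, mem_inter.2 ⟨mem_singleton_self _, this.2⟩⟩⟩
  obtain ⟨x₀, y₀, hxy₀⟩ := hedge
  by_cases hdel : ∀ U W, IsSeparation (G.deleteEdges {s(x₀, y₀)}) A B U W → k ≤ #(U ∩ W)
  · obtain ⟨P, h1, h2, h3⟩ := ih _ (adjPairs_lt_of_le (G.deleteEdges_le _) hxy₀ (by simp)) _ A B
      hdel rfl
    exact ⟨P, fun i => (h1 i).mono (G.deleteEdges_le _), h2, h3⟩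
  push Not at hdel
  obtain ⟨U, W, hUW, hlt⟩ := hdel
  -- The separation is too small for G, so the deleted edge crosses it and is the only one to do so.
  -- Adding x to W repairs it, whence its middle has exactly k - 1 vertices.
  obtain ⟨x, y, hxy, hxU, hxW, hyW, hyU, huniq⟩ : ∃ x y, G.Adj x y ∧ x ∈ U ∧ x ∉ W ∧ y ∈ W ∧
      y ∉ U ∧ ∀ p, p ∈ U → p ∉ W → ∀ q, q ∈ W → q ∉ U → G.Adj p q → p = x ∧ q = y := by
    have hcross : ∀ p, p ∈ U → p ∉ W → ∀ q, q ∈ W → q ∉ U → G.Adj p q →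
        s(p, q) = s(x₀, y₀) := by
      intro p hp hp' q hq hq' hpq
      by_contra hne
      exact hUW.noEdge p hp hp' q hq hq' (by simpa [hpq] using hne)
    obtain ⟨x, hxU, hxW, y, hyW, hyU, hxy⟩ : ∃ x, x ∈ U ∧ x ∉ W ∧ ∃ y, y ∈ W ∧ y ∉ U ∧
        G.Adj x y := by
      by_contra hcon
      push Not at hcon
      exact absurd (hsep U W ⟨hUW.cover, hUW.left, hUW.right, hcon⟩) (by omega)
    refine ⟨x, y, hxy, hxU, hxW, hyW, hyU, fun p hp hp' q hq hq' hpq => ?_⟩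
    have := (hcross p hp hp' q hq hq' hpq).trans (hcross x hxU hxW y hyW hyU hxy).symm
    rcases Sym2.eq_iff.1 this with h | h
    · exact h
    · exact absurd (h.1 ▸ hp) hyU
  have hYk : #(U ∩ W) + 1 = k := by
    have h1 := hsep U (insert x W) ⟨fun z => (hUW.cover z).imp_right mem_insert_of_mem, hUW.left,
      hUW.right.trans (subset_insert _ _), fun p hp hp' q hq hq' hpq => by
        rw [mem_insert, not_or] at hp'
        rcases mem_insert.1 hq with rfl | hq
        · exact hq' hxU
        · exact hp'.1 (huniq p hp hp'.2 q hq hq' hpq).1⟩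
    have h2 : U ∩ insert x W ⊆ insert x (U ∩ W) := fun z hz => by
      rw [mem_inter, mem_insert] at hz
      rw [mem_insert, mem_inter]
      tauto
    have := card_le_card h2
    have := card_insert_le x (U ∩ W)
    omega
  have hB1 : #(insert x (U ∩ W)) = k := by
    rw [card_insert_of_notMem (by simp [hxW]), hYk]
  have hA2 : #(insert y (W ∩ U)) = k := by
    rw [card_insert_of_notMem (by simp [hyU]), inter_comm, hYk]
  obtain ⟨P, hPc, hPd, hPm⟩ := ih _ (adjPairs_lt_of_le (restrictTo_le G U) hxy
    fun h => hyU h.2.2) (restrictTo G U) A (insert x (U ∩ W))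
    (le_card_separation_restrictTo hsep hUW.cover hUW.left hUW.right
      fun p hp hp' q hq hq' hpq => (huniq p hp hp' q hq hq' hpq).1) rfl
  obtain ⟨Q, hQc, hQd, hQm⟩ := ih _ (adjPairs_lt_of_le (restrictTo_le G W) hxy
    fun h => hxW h.2.1) (restrictTo G W) B (insert y (W ∩ U))
    (le_card_separation_restrictTo
      (fun U W h => by rw [inter_comm]; exact hsep W U h.symm)
      (fun z => (hUW.cover z).symm) hUW.right hUW.left
      fun p hp hp' q hq hq' hpq => (huniq q hq hq' p hp hp' hpq.symm).2) rfl
  have hPU : ∀ i, P i ⊆ U := fun i => (hPc i).subset_of_restrictTo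
    ((hPm i).1.mono (inter_subset_inter_left hUW.left))
  have hQW : ∀ i, Q i ⊆ W := fun i => (hQc i).subset_of_restrictTo
    ((hQm i).1.mono (inter_subset_inter_left hUW.right))
  choose f hf using fun i => (hPm i).2
  choose g hg using fun i => (hQm i).2
  simp only [mem_inter (s₁ := P _), mem_inter (s₁ := Q _)] at hf hg
  obtain ⟨hfinj, hfsurj⟩ := image_eq_of_disjoint hPd (fun i => (hf i).1) (fun i => (hf i).2) hB1
  obtain ⟨hginj, hgsurj⟩ := image_eq_of_disjoint hQd (fun i => (hg i).1) (fun i => (hg i).2) hA2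
  -- The families in U and W are matched at common vertices of U ∩ W, except that the set ending at
  -- x is continued from y along the edge xy.
  have htarget : ∀ i, ∃ j, g j = if f i = x then y else f i := by
    intro i
    apply hgsurj
    split_ifs with hi
    · exact mem_insert_self _ _
    · have := (hf i).2
      rw [mem_insert, mem_inter] at this
      exact mem_insert_of_mem (mem_inter.2 (this.resolve_left hi).symm)
  choose σ hσ using htarget
  have hfU : ∀ i, f i ≠ y := fun i hi => hyU (hi ▸ hPU i (hf i).1)
  have hσinj : Function.Injective σ := by
    intro i j hij
    apply hfinj
    have h1 := (hσ i).symm.trans ((congrArg g hij).trans (hσ j))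
    split_ifs at h1 with hi hj hj
    · exact hi.trans hj.symm
    · exact absurd h1.symm (hfU j)
    · exact absurd h1 (hfU i)
    · exact h1
  have hPQ : ∀ i j, i ≠ j → Disjoint (P i) (Q (σ j)) := by
    intro i j hij
    rw [disjoint_left]
    intro z hzP hzQ
    have hzU := hPU i hzP
    have hzW := hQW _ hzQ
    obtain ⟨i', hi'⟩ := hfsurj z (mem_insert_of_mem (mem_inter.2 ⟨hzU, hzW⟩))
    obtain ⟨j', hj'⟩ := hgsurj z (mem_insert_of_mem (mem_inter.2 ⟨hzW, hzU⟩))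
    have hii : i' = i := by
      by_contra hne
      exact disjoint_left.1 (hPd i' i hne) (hf i').1 (hi' ▸ hzP)
    have hjj : j' = σ j := by
      by_contra hne
      exact disjoint_left.1 (hQd j' (σ j) hne) (hg j').1 (hj' ▸ hzQ)
    subst hii hjj
    rw [hσ j] at hj'
    split_ifs at hj' with hj
    · exact hyU (hj' ▸ hzU)
    · exact hij (hfinj (hi'.trans hj'.symm))
  refine ⟨fun i => P i ∪ Q (σ i), fun i => ?_, fun i j hij => ?_, fun i => ⟨?_, ?_⟩⟩
  · refine conn_union ((hPc i).mono (restrictTo_le G U)) ((hQc _).mono (restrictTo_le G W)) ?_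
    have h1 := hσ i
    split_ifs at h1 with hi
    · exact Or.inr ⟨x, hi ▸ (hf i).1, y, h1 ▸ (hg _).1, hxy⟩
    · exact Or.inl ⟨f i, (hf i).1, h1 ▸ (hg _).1⟩
  · rw [disjoint_union_left, disjoint_union_right, disjoint_union_right]
    exact ⟨⟨hPd i j hij, hPQ i j hij⟩, (hPQ j i hij.symm).symm, hQd _ _ (hσinj.ne hij)⟩
  · exact (hPm i).1.mono (inter_subset_inter_right subset_union_left)
  · exact (hQm _).1.mono (inter_subset_inter_right subset_union_right)

end
end DenseMinor

/-! ### Five connections at a vertex of degree six -/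

namespace DenseMinor
section
open scoped Classical
open Finset

variable {V : Type*} [Fintype V]

/-- Contracting disjoint connected sets `P i` onto vertices `a i`. -/
theorem exists_minorOn_of_family {ι : Type*} (G : SimpleGraph V) {P : ι → Finset V} {a : ι → V}
    (hP : ∀ i, Conn G (P i)) (hdis : ∀ i j, i ≠ j → Disjoint (P i) (P j)) (ha : ∀ i, a i ∈ P i) :
    ∃ G', G ≤ G' ∧ MinorOn G {x | ∀ i, x ∈ P i → x = a i} G' ∧
      ∀ i p y, p ∈ P i → G.Adj p y → y ≠ a i → G'.Adj (a i) y := by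
  let φ : V → Finset V := fun x => {y | y = x ∨ ∃ i, a i = x ∧ y ∈ P i}
  have hφa : ∀ i, φ (a i) = P i := by
    intro i
    ext y
    simp only [φ, mem_filter, mem_univ, true_and]
    constructor
    · rintro (rfl | ⟨j, hj, hy⟩)
      · exact ha i
      · have : j = i := by
          by_contra hne
          exact disjoint_left.1 (hdis j i hne) (ha j) (hj ▸ ha i)
        exact this ▸ hy
    · exact fun hy => Or.inr ⟨i, rfl, hy⟩
  have hφ : ∀ x, (∀ i, a i ≠ x) → φ x = {x} := by
    intro x hx
    ext y
    simp only [φ, mem_filter, mem_univ, true_and, mem_singleton]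
    exact ⟨fun h => h.elim id fun ⟨i, hi, _⟩ => absurd hi (hx i), Or.inl⟩
  have hself : ∀ x, x ∈ φ x := fun x => by simp [φ]
  refine ⟨⟨fun x y => x ≠ y ∧ ∃ p ∈ φ x, ∃ q ∈ φ y, G.Adj p q,
    ⟨fun x y ⟨h, p, hp, q, hq, hpq⟩ => ⟨h.symm, q, hq, p, hp, hpq.symm⟩⟩,
    ⟨fun x hx => hx.1 rfl⟩⟩, fun x y h => ⟨h.ne, x, hself x, y, hself y, h⟩, ⟨φ, ?_, ?_, ?_⟩, ?_⟩
  · intro x _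
    by_cases hx : ∃ i, a i = x
    · obtain ⟨i, rfl⟩ := hx
      rw [hφa]
      exact hP i
    · push Not at hx
      rw [hφ x hx]
      exact conn_singleton G x
  · intro x hx y hy hxy
    simp only [mem_filter, mem_univ, true_and] at hx hy
    rw [disjoint_left]
    intro z hzx hzy
    simp only [φ, mem_filter, mem_univ, true_and] at hzx hzy
    rcases hzx with rfl | ⟨i, rfl, hi⟩ <;> rcases hzy with rfl | ⟨j, rfl, hj⟩
    · exact hxy rfl
    · exact hxy (hx j hj)
    · exact hxy (hy i hi).symm
    · have : i ≠ j := fun h => hxy (h ▸ rfl)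
      exact disjoint_left.1 (hdis i j this) hi hj
  · exact fun x _ y _ h => h.2
  · exact fun i p y hp hpy hy => ⟨hy.symm, p, hφa i ▸ hp, y, hself y, hpy⟩

namespace IsCritical

variable {G : SimpleGraph V} (h : IsCritical G)
include h

/-- Five disjoint connections between the neighbourhoods of two non-adjacent vertices. -/
theorem exists_five_connections {v w : V} (hvw : v ≠ w) (hadj : ¬ G.Adj v w) :
    ∃ P : Fin 5 → Finset V, (∀ i, Conn G (P i)) ∧ (∀ i j, i ≠ j → Disjoint (P i) (P j)) ∧
      (∀ i, v ∉ P i ∧ w ∉ P i) ∧ (∀ i, ∃ a, P i ∩ nbr G v = {a}) ∧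
      ∀ i, ∃ b, P i ∩ nbr G w = {b} := by
  have hsub : ∀ x, x ∈ nbr G v ∨ x ∈ nbr G w → x ∈ ({v, w} : Finset V)ᶜ := by
    intro x hx
    rw [mem_nbr, mem_nbr] at hx
    simp only [mem_compl, mem_insert, mem_singleton, not_or]
    constructor <;> rintro rfl
    · exact hx.elim G.irrefl fun h => hadj h.symm
    · exact hx.elim hadj G.irrefl
  obtain ⟨P, hPc, hPd, hPm⟩ := exists_disjoint_conn (restrictTo G {v, w}ᶜ) (nbr G v) (nbr G w) 5 (by
    intro U W hUW
    -- Removing the middle of the separation confines the component of v to the side of U and keeps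
    -- it off w. Its boundary lies in U ∩ W and has at least five vertices.
    obtain ⟨C, hC, hvC, hCX, hnb⟩ := exists_component G (F := (U ∩ W) \ {v, w}) (z := v) (by simp)
    have hCM : C ⊆ insert v ((U \ W).erase w) := by
      by_contra hcon
      obtain ⟨a, ha, b, hb, hab⟩ := hC.2 (C ∩ insert v ((U \ W).erase w)) inter_subset_left
        ⟨v, by simp [hvC]⟩ fun heq => hcon (inter_eq_left.1 heq)
      rw [mem_inter, mem_insert, mem_erase, mem_sdiff] at ha
      rw [mem_sdiff, mem_inter, mem_insert, mem_erase, mem_sdiff] at hb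
      obtain ⟨hbC, hb⟩ := hb
      have hbX : ¬ (b ∈ U ∧ b ∈ W ∧ b ≠ v ∧ b ≠ w) := fun hb =>
        disjoint_left.1 hCX hbC (by simp [hb.1, hb.2.1, hb.2.2.1, hb.2.2.2])
      have hcov := hUW.cover b
      by_cases hav : a = v
      · subst hav
        have hbU : b ∈ U := hUW.left (mem_nbr.2 hab)
        have hbw : b ≠ w := fun hbw => hadj (hbw ▸ hab)
        have hbv := hab.ne'
        tauto
      · obtain ⟨haw, haU, haW⟩ := ha.2.resolve_left hav
        have hbw : b ≠ w := by
          rintro rfl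
          exact haW (hUW.right (mem_nbr.2 hab.symm))
        by_cases hbU : b ∈ U
        · tauto
        · have hbW : b ∈ W := hcov.resolve_left hbU
          have hbv : b ≠ v := fun hbv => hb ⟨hbC, Or.inl hbv⟩
          exact hUW.noEdge a haU haW b hbW hbU ⟨hab, by simp [hav, haw], by simp [hbv, hbw]⟩
    have hwC : w ∉ C := fun hwC => by
      have := hCM hwC
      simp [hvw.symm] at this
    have hout : outer G C ⊆ (U ∩ W) \ {v, w} := fun x hx => by
      obtain ⟨hxC, c, hc, hcx⟩ := mem_outer.1 hx
      exact hnb c hc x hxC hcx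
    refine (h.five_le_card_outer hC fun heq => ?_).trans
      (card_le_card (hout.trans sdiff_subset))
    rcases mem_union.1 (heq ▸ mem_univ w) with h1 | h1
    · exact hwC h1
    · simpa using hout h1)
  have hPU : ∀ i, P i ⊆ {v, w}ᶜ := fun i => (hPc i).subset_of_restrictTo
    ((hPm i).1.mono (inter_subset_inter_left fun x hx => hsub x (Or.inl hx)))
  have htrim := fun i => ((hPc i).mono (restrictTo_le G _)).exists_subset_inter_eq_singletons
    (hPm i).1 (hPm i).2
  choose Q hQP hQc hQa hQb using htrim
  refine ⟨Q, hQc, fun i j hij => disjoint_of_subset_left (hQP i)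
    (disjoint_of_subset_right (hQP j) (hPd i j hij)), fun i => ⟨fun hv => ?_, fun hw => ?_⟩,
    hQa, hQb⟩
  · simpa using hPU i (hQP i hv)
  · simpa using hPU i (hQP i hw)

/-- Five common neighbours with v leave a vertex of N(v) no non-neighbour there. -/
theorem adj_of_card_nbr_eq_six {v : V} (hv : #(nbr G v) = 6) {x y : V} (hx : x ∈ nbr G v)
    (hy : y ∈ nbr G v) (hxy : x ≠ y) : G.Adj x y := by
  have h1 := h.codeg_nbr hx
  exact (codeg_eq_zero_iff (S := nbr G v) (x := x)).1 (by omega) y hy hxy.symm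

/-- The bags `{v}`, `{s}`, `P i`, `{w}` and `Z` have at least `30` adjacencies. -/
theorem false_of_connections {v w s : V} (hv : #(nbr G v) = 6) (hvw : v ≠ w) (hadj : ¬ G.Adj v w)
    {P : Fin 5 → Finset V} {a b : Fin 5 → V} (hPc : ∀ i, Conn G (P i))
    (hPd : ∀ i j, i ≠ j → Disjoint (P i) (P j)) (hPvw : ∀ i, v ∉ P i ∧ w ∉ P i)
    (ha : ∀ i, a i ∈ P i ∧ a i ∈ nbr G v) (hb : ∀ i, b i ∈ P i ∧ b i ∈ nbr G w)
    (hs : s ∈ nbr G v) (hsP : ∀ i, s ∉ P i) {Z : Finset V} (hZ : Conn G Z)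
    (hZP : ∀ i, Disjoint Z (P i)) (hZv : v ∉ Z) (hZw : w ∉ Z) (hZs : s ∉ Z)
    (hZw' : ∃ z ∈ Z, G.Adj z w)
    (hcount : 3 ≤ #{i | ∃ z ∈ Z, ∃ p ∈ P i, G.Adj z p} + (if ∃ z ∈ Z, G.Adj z s then 1 else 0) +
      if G.Adj s w then 1 else 0) : False := by
  obtain ⟨G₁, hG, hminor, hadj₁⟩ := exists_minorOn_of_family G hPc hPd fun i => (ha i).1
  have hainj : Function.Injective a := fun i j hij => by
    by_contra hne
    exact disjoint_left.1 (hPd i j hne) (ha i).1 (hij ▸ (ha j).1)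
  have has : ∀ i, a i ≠ s := fun i h => hsP i (h ▸ (ha i).1)
  have hav : ∀ i, a i ≠ v := fun i h => (hPvw i).1 (h ▸ (ha i).1)
  have haw : ∀ i, a i ≠ w := fun i h => (hPvw i).2 (h ▸ (ha i).1)
  have hsv : s ≠ v := (mem_nbr.1 hs).ne'
  have hsw : s ≠ w := fun h => hadj (h ▸ mem_nbr.1 hs)
  obtain ⟨z₀, hz₀⟩ := hZ.1
  have hzP : ∀ z ∈ Z, ∀ i, z ∉ P i := fun z hz i => disjoint_left.1 (hZP i) hz
  set A : Finset V := univ.image a with hA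
  have hA5 : #A = 5 := by rw [hA, card_image_of_injective _ hainj, card_univ, Fintype.card_fin]
  have memA : ∀ x, x ∈ A ↔ ∃ i, a i = x := fun x => by simp [hA]
  have hsA : s ∉ A := by simp [memA, has]
  have hvA : v ∉ insert s A := by simp [memA, hav, hsv.symm]
  have hwA : w ∉ insert v (insert s A) := by simp [memA, haw, hsw.symm, hvw.symm]
  have hzA : ∀ z ∈ Z, z ∉ insert w (insert v (insert s A)) := by
    intro z hz
    simp only [mem_insert, memA, not_or, not_exists]
    exact ⟨fun h => hZw (h ▸ hz), fun h => hZv (h ▸ hz), fun h => hZs (h ▸ hz),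
      fun i h => hzP z hz i (h ▸ (ha i).1)⟩
  have hAA : adjPairs G₁ A A = 20 := by
    have h1 := adjPairs_add_coPairs G₁ A
    have h2 := coPairs_le_of_codeg_le (G := G₁) (S := A) (d := 0) fun x hx => by
      rw [Nat.le_zero, codeg_eq_zero_iff]
      intro t ht htx
      obtain ⟨i, rfl⟩ := (memA x).1 hx
      obtain ⟨j, rfl⟩ := (memA t).1 ht
      exact hG (h.adj_of_card_nbr_eq_six hv (ha i).2 (ha j).2 htx.symm)
    rw [hA5] at h1 h2
    omega
  have hdegs : 5 ≤ deg G₁ A s := by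
    rw [← hA5]
    refine card_le_card fun x hx => mem_filter.2 ⟨hx, ?_⟩
    obtain ⟨i, rfl⟩ := (memA x).1 hx
    exact hG (h.adj_of_card_nbr_eq_six hv hs (ha i).2 (has i).symm)
  have hdegv : 6 ≤ deg G₁ (insert s A) v := by
    have h1 : #(insert s A) = 6 := by rw [card_insert_of_notMem hsA, hA5]
    rw [← h1]
    refine card_le_card fun x hx => mem_filter.2 ⟨hx, hG ?_⟩
    rcases mem_insert.1 hx with rfl | hx
    · exact mem_nbr.1 hs
    · obtain ⟨i, rfl⟩ := (memA x).1 hx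
      exact mem_nbr.1 (ha i).2
  have hwa : ∀ i, G₁.Adj w (a i) := fun i =>
    (hadj₁ i (b i) w (hb i).1 (mem_nbr.1 (hb i).2).symm (haw i).symm).symm
  have hdegw : 5 + (if G.Adj s w then 1 else 0) ≤ deg G₁ (insert v (insert s A)) w := by
    split_ifs with hsw'
    · have h1 : #(insert s A) = 6 := by rw [card_insert_of_notMem hsA, hA5]
      rw [show 5 + 1 = #(insert s A) from h1.symm]
      refine card_le_card fun x hx => mem_filter.2 ⟨mem_insert_of_mem hx, ?_⟩
      rcases mem_insert.1 hx with rfl | hx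
      · exact hG hsw'.symm
      · obtain ⟨i, rfl⟩ := (memA x).1 hx
        exact hwa i
    · rw [add_zero, ← hA5]
      refine card_le_card fun x hx => mem_filter.2
        ⟨mem_insert_of_mem (mem_insert_of_mem hx), ?_⟩
      obtain ⟨i, rfl⟩ := (memA x).1 hx
      exact hwa i
  have hY1 := adjPairs_insert_self G₁ hsA
  have hY2 := adjPairs_insert_self G₁ hvA
  have hY3 := adjPairs_insert_self G₁ hwA
  have hY : #(insert w (insert v (insert s A))) = 8 := by
    rw [card_insert_of_notMem hwA, card_insert_of_notMem hvA, card_insert_of_notMem hsA, hA5]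
  set I : Finset (Fin 5) := {i | ∃ z ∈ Z, ∃ p ∈ P i, G.Adj z p} with hI
  obtain ⟨T, hTY, hTZ, hTcard⟩ : ∃ T ⊆ insert w (insert v (insert s A)),
      (∀ t ∈ T, ∃ z ∈ Z, G₁.Adj z t) ∧
        #I + (if ∃ z ∈ Z, G.Adj z s then 1 else 0) + 1 ≤ #T := by
    have hIadj : ∀ i ∈ I, ∃ z ∈ Z, G₁.Adj z (a i) := by
      intro i hi
      obtain ⟨z, hz, p, hp, hzp⟩ := (mem_filter.1 hi).2
      exact ⟨z, hz, (hadj₁ i p z hp hzp.symm fun h => hzP z hz i (h ▸ (ha i).1)).symm⟩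
    have hIA : I.image a ⊆ A := image_subset_image (subset_univ _)
    have hIc : #(I.image a) = #I := card_image_of_injective _ hainj
    have hwI : w ∉ insert s (I.image a) := fun hw => hwA (mem_insert_of_mem
      (insert_subset_insert s hIA hw))
    have hwI' : w ∉ I.image a := fun h => hwI (mem_insert_of_mem h)
    have hsI : s ∉ I.image a := fun h => hsA (hIA h)
    split_ifs with hs'
    · refine ⟨insert w (insert s (I.image a)), insert_subset_insert _
        ((insert_subset_insert s hIA).trans (subset_insert _ _)), ?_, ?_⟩
      · intro t ht
        rcases mem_insert.1 ht with rfl | ht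
        · obtain ⟨z, hz, hzw⟩ := hZw'
          exact ⟨z, hz, hG hzw⟩
        rcases mem_insert.1 ht with rfl | ht
        · obtain ⟨z, hz, hzw⟩ := hs'
          exact ⟨z, hz, hG hzw⟩
        · obtain ⟨i, hi, rfl⟩ := mem_image.1 ht
          exact hIadj i hi
      · rw [card_insert_of_notMem hwI, card_insert_of_notMem hsI, hIc]
    · refine ⟨insert w (I.image a), insert_subset_insert _
        (hIA.trans ((subset_insert _ _).trans (subset_insert _ _))), ?_, ?_⟩
      · intro t ht
        rcases mem_insert.1 ht with rfl | ht
        · obtain ⟨z, hz, hzw⟩ := hZw'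
          exact ⟨z, hz, hG hzw⟩
        · obtain ⟨i, hi, rfl⟩ := mem_image.1 ht
          exact hIadj i hi
      · rw [card_insert_of_notMem hwI', hIc]
  have hfinal := adjPairs_con_insert (G := G₁) (Q := Z) (hzA z₀ hz₀) hTY hTZ
  have hm : MinorOn G (insert z₀ (insert w (insert v (insert s A)))) (con G₁ Z z₀) := by
    refine hminor.con (hZ.mono hG) hz₀ (fun z hz => ?_) (fun x hx => ?_) fun x hx hxZ => ?_
    · simp only [mem_filter, mem_univ, true_and]
      exact fun i hi => absurd hi (hzP z hz i)
    · simp only [mem_insert, memA] at hx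
      simp only [mem_filter, mem_univ, true_and]
      intro i hi
      rcases hx with rfl | rfl | rfl | rfl | ⟨j, rfl⟩
      · exact absurd hi (hzP _ hz₀ i)
      · exact absurd hi (hPvw i).2
      · exact absurd hi (hPvw i).1
      · exact absurd hi (hsP i)
      · by_contra hne
        exact disjoint_left.1 (hPd i j fun h => hne (h ▸ rfl)) hi (ha j).1
    · exact (mem_insert.1 hx).resolve_right (hzA x hxZ)
  -- The vertices v, s and a i form a K₇ with 21 edges, w sees the five a i, and Z sees w. With the
  -- three of `hcount` this makes 30.
  have := h.nine _ _ hm (by rw [card_insert_of_notMem (hzA z₀ hz₀), hY])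
  omega

end IsCritical

end
end DenseMinor

/-! ### No vertex of degree six -/

namespace DenseMinor
section
open scoped Classical
open Finset

variable {V : Type*} [Fintype V]

namespace IsCritical

variable {G : SimpleGraph V} (h : IsCritical G)
include h

/-- N(w) is a clique too, so its spare vertex t is joined to all five connections and serves as Z.
-/
theorem false_of_six_of_connections {v w s t : V} (hv : #(nbr G v) = 6) (hw : #(nbr G w) = 6)
    (hvw : v ≠ w) (hadj : ¬ G.Adj v w) {P : Fin 5 → Finset V} {a b : Fin 5 → V}
    (hPc : ∀ i, Conn G (P i)) (hPd : ∀ i j, i ≠ j → Disjoint (P i) (P j))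
    (hPvw : ∀ i, v ∉ P i ∧ w ∉ P i) (ha : ∀ i, a i ∈ P i ∧ a i ∈ nbr G v)
    (hb : ∀ i, b i ∈ P i ∧ b i ∈ nbr G w) (hs : s ∈ nbr G v) (hsP : ∀ i, s ∉ P i)
    (ht : t ∈ nbr G w) (htP : ∀ i, t ∉ P i) (hst : s ≠ t) : False := by
  have hall : ({i | ∃ z ∈ ({t} : Finset V), ∃ p ∈ P i, G.Adj z p} : Finset (Fin 5)) = univ := by
    refine eq_univ_of_forall fun i => mem_filter.2 ⟨mem_univ i, t, mem_singleton_self t, b i,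
      (hb i).1, h.adj_of_card_nbr_eq_six hw ht (hb i).2 fun hti => htP i (hti ▸ (hb i).1)⟩
  refine h.false_of_connections hv hvw hadj hPc hPd hPvw ha hb hs hsP (conn_singleton G t)
    (fun i => disjoint_singleton_left.2 (htP i)) ?_ ?_ (by simpa using hst)
    ⟨t, mem_singleton_self t, (mem_nbr.1 ht).symm⟩ ?_
  · rw [mem_singleton]
    rintro rfl
    exact hadj (mem_nbr.1 ht).symm
  · rw [mem_singleton]
    exact (mem_nbr.1 ht).ne
  · rw [hall, card_univ, Fintype.card_fin]
    omega

/-- The clique N(v) with v and w has 15 + 6 + 6 edges on eight vertices, and an outside component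
contracts to a ninth vertex with at least five more. -/
theorem false_of_same_nbr {v w : V} (hv : #(nbr G v) = 6) (hvw : v ≠ w)
    (heq : nbr G v = nbr G w) : False := by
  have hvN := notMem_nbr_self G v
  have hwN : w ∉ nbr G v := heq ▸ notMem_nbr_self G w
  have hwY : w ∉ insert v (nbr G v) := by simp [hwN, hvw.symm]
  have h1 := adjPairs_closed_nbr G v
  have h2 := adjPairs_insert_self G hwY
  have h3 : deg G (insert v (nbr G v)) w = 6 := by
    rw [deg_eq_card_nbr (heq ▸ subset_insert v _), ← heq, hv]
  have h4 := adjPairs_add_coPairs G (nbr G v)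
  have h5 := coPairs_le_of_codeg_le (G := G) (S := nbr G v) (d := 0) fun x hx => by
    have := h.codeg_nbr hx
    omega
  have hY : #(insert w (insert v (nbr G v))) = 8 := by
    rw [card_insert_of_notMem hwY, card_insert_of_notMem hvN, hv]
  obtain ⟨z, hz⟩ : ∃ z, z ∉ insert w (insert v (nbr G v)) := by
    by_contra hcon
    push Not at hcon
    have h6 := card_le_card (fun z _ => hcon z : (univ : Finset V) ⊆ _)
    rw [hY, card_univ] at h6
    have := h.ten_le
    omega
  rw [mem_insert, mem_insert, not_or, not_or] at hz
  obtain ⟨C, hC, -, hCw, hCv, hout, hC5⟩ := h.exists_component_avoiding (F := {w})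
    (by simpa using hz.1) hz.2.1 hz.2.2 fun x hx y _ hxy => by
      rw [mem_singleton] at hx
      subst hx
      rw [heq]
      exact mem_nbr.2 hxy
  have h6 := h.nine_of_dominated hY hC (by
      rw [disjoint_insert_right]
      exact ⟨disjoint_singleton_right.1 hCw, hCv⟩)
    (hout.trans ((subset_insert _ _).trans (subset_insert _ _)))
    fun t ht => (mem_outer.1 ht).2
  rw [hv] at h1 h4 h5
  omega

omit h [Fintype V] in
theorem exists_notMem_image {N : Finset V} (hN : 5 < #N) (a : Fin 5 → V) :
    ∃ s ∈ N, ∀ i, s ≠ a i := by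
  by_contra hcon
  push Not at hcon
  have h1 : N ⊆ univ.image a := fun s hs => by
    obtain ⟨i, hi⟩ := hcon s hs
    exact mem_image.2 ⟨i, mem_univ i, hi.symm⟩
  have h2 := (card_le_card h1).trans card_image_le
  rw [card_univ, Fintype.card_fin] at h2
  omega

theorem false_of_six_of_six {v w : V} (hv : #(nbr G v) = 6) (hw : #(nbr G w) = 6) (hvw : v ≠ w)
    (hadj : ¬ G.Adj v w) : False := by
  obtain ⟨P, hPc, hPd, hPvw, hPa, hPb⟩ := h.exists_five_connections hvw hadj
  choose a ha using hPa
  choose b hb using hPb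
  have ha' : ∀ i, a i ∈ P i ∧ a i ∈ nbr G v := fun i => by
    rw [← mem_inter, ha]; exact mem_singleton_self _
  have hb' : ∀ i, b i ∈ P i ∧ b i ∈ nbr G w := fun i => by
    rw [← mem_inter, hb]; exact mem_singleton_self _
  obtain ⟨s, hs, hsa⟩ := exists_notMem_image (by omega : 5 < #(nbr G v)) a
  obtain ⟨t, ht, htb⟩ := exists_notMem_image (by omega : 5 < #(nbr G w)) b
  have hsP : ∀ i, s ∉ P i := fun i hi => hsa i (by
    rw [← mem_singleton, ← ha]; exact mem_inter.2 ⟨hi, hs⟩)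
  have htP : ∀ i, t ∉ P i := fun i hi => htb i (by
    rw [← mem_singleton, ← hb]; exact mem_inter.2 ⟨hi, ht⟩)
  by_cases hst : s = t
  swap
  · exact h.false_of_six_of_connections hv hw hvw hadj hPc hPd hPvw ha' hb' hs hsP ht htP hst
  subst hst
  -- When the spare vertices of N(v) and N(w) coincide in s, replace a connection with distinct ends
  -- by {s}: its ends become distinct spare vertices. If no connection has distinct ends, then N(v)
  -- = N(w).
  by_cases hab : ∃ i, a i ≠ b i
  · obtain ⟨i, hi⟩ := hab
    have hu : ∀ (Q : V → Finset V → Prop) (f : Fin 5 → V), Q s {s} → (∀ j, Q (f j) (P j)) →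
        ∀ j, Q (Function.update f i s j) (Function.update P i {s} j) := by
      intro Q f h1 h2 j
      by_cases hj : j = i
      · subst hj
        simpa using h1
      · simpa [hj] using h2 j
    have hu' : ∀ (Q : Finset V → Prop), Q {s} → (∀ j, j ≠ i → Q (P j)) →
        ∀ j, Q (Function.update P i {s} j) := by
      intro Q h1 h2 j
      by_cases hj : j = i
      · subst hj
        simpa using h1
      · simpa [hj] using h2 j hj
    have hnot : ∀ x, x ≠ s → x ∈ P i → ∀ j, x ∉ Function.update P i {s} j := fun x hx hxi =>
      hu' (fun S => x ∉ S) (by simpa using hx) fun j hj hxj =>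
        disjoint_left.1 (hPd i j hj.symm) hxi hxj
    have hsv : s ≠ v := (mem_nbr.1 hs).ne'
    have hsw : s ≠ w := (mem_nbr.1 ht).ne'
    refine h.false_of_six_of_connections (s := a i) (t := b i) hv hw hvw hadj
      (P := Function.update P i {s}) (a := Function.update a i s) (b := Function.update b i s)
      (hu' (Conn G) (conn_singleton G s) fun j _ => hPc j) ?_
      (hu' (fun S => v ∉ S ∧ w ∉ S) (by simp [hsv.symm, hsw.symm]) fun j _ => hPvw j)
      (hu (fun x S => x ∈ S ∧ x ∈ nbr G v) a (by simp [hs]) ha')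
      (hu (fun x S => x ∈ S ∧ x ∈ nbr G w) b (by simp [ht]) hb')
      (ha' i).2 (hnot _ (hsa i).symm (ha' i).1) (hb' i).2 (hnot _ (htb i).symm (hb' i).1) hi
    intro j k hjk
    by_cases hj : j = i
    · subst hj
      simp [hjk.symm, hsP]
    · by_cases hk : k = i
      · subst hk
        simp [hj, hsP]
      · simpa [hj, hk] using hPd j k hjk
  · push Not at hab
    refine h.false_of_same_nbr hv hvw (eq_of_subset_of_card_le (fun x hx => ?_) (by omega))
    by_contra hxw
    have hxs : x ≠ s := fun hxs => hxw (hxs ▸ ht)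
    have h1 : nbr G v ⊆ insert s (univ.image a) := by
      refine (eq_of_subset_of_card_le (insert_subset hs fun y hy => ?_) ?_).ge
      · obtain ⟨i, -, rfl⟩ := mem_image.1 hy
        exact (ha' i).2
      · rw [card_insert_of_notMem (by simpa [eq_comm] using hsa), card_image_of_injective,
          card_univ, Fintype.card_fin, hv]
        intro i j hij
        by_contra hne
        exact disjoint_left.1 (hPd i j hne) (ha' i).1 (hij ▸ (ha' j).1)
    obtain ⟨i, -, rfl⟩ := mem_image.1 ((mem_insert.1 (h1 hx)).resolve_left hxs)
    exact hxw (hab i ▸ (hb' i).2)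

/-- Otherwise N[v] - w is a K₆ inside N(w), so at most 3 · 3 edges are missing from N(w). But v has
three non-neighbours there, which requires ten missing edges by `codeg_nbr_le`. -/
theorem not_adj_of_six_of_nine {v w : V} (hv : #(nbr G v) = 6) (hw : #(nbr G w) = 9) :
    ¬ G.Adj v w := by
  intro hadj
  have hvH : v ∈ nbr G w := mem_nbr.2 hadj.symm
  have hwv : w ∈ nbr G v := mem_nbr.2 hadj
  have hTH : insert v ((nbr G v).erase w) ⊆ nbr G w := insert_subset hvH fun x hx => by
    rw [mem_erase] at hx
    exact mem_nbr.2 (h.adj_of_card_nbr_eq_six hv hwv hx.2 hx.1.symm)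
  have hvT : v ∉ (nbr G v).erase w := fun h => notMem_nbr_self G v (mem_erase.1 h).2
  have hT6 : #(insert v ((nbr G v).erase w)) = 6 := by
    rw [card_insert_of_notMem hvT, card_erase_of_mem hwv, hv]
  have h1 := coPairs_le_add hTH fun x hx => h.codeg_nbr_le_three hw hx
  have h2 := coPairs_le_of_codeg_le (G := G) (S := insert v ((nbr G v).erase w)) (d := 0)
    fun x hx => by
      rw [Nat.le_zero, codeg_eq_zero_iff]
      intro t ht htx
      rcases mem_insert.1 hx with rfl | hx <;> rcases mem_insert.1 ht with rfl | ht
      · exact absurd rfl htx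
      · exact mem_nbr.1 (mem_erase.1 ht).2
      · exact (mem_nbr.1 (mem_erase.1 hx).2).symm
      · exact h.adj_of_card_nbr_eq_six hv (mem_erase.1 hx).2 (mem_erase.1 ht).2 htx.symm
  have h3 := h.codeg_nbr_le hw hvH
  have h4 := deg_add_codeg G hvH
  have h5 : deg G (nbr G w) v ≤ 5 := by
    rw [deg_eq_card_inter]
    have : nbr G v ∩ nbr G w ⊆ (nbr G v).erase w := fun x hx => by
      rw [mem_inter] at hx
      exact mem_erase.2 ⟨fun h => notMem_nbr_self G w (h ▸ hx.2), hx.1⟩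
    have := card_le_card this
    rw [card_erase_of_mem hwv] at this
    omega
  omega

/-- Four vertices of N(w) are not used by the connections, and Z is found among them because each
vertex misses at most three others in N(w). -/
theorem false_of_six_of_nine {v w : V} (hv : #(nbr G v) = 6) (hw : #(nbr G w) = 9) (hvw : v ≠ w) :
    False := by
  have hadj := h.not_adj_of_six_of_nine hv hw
  obtain ⟨P, hPc, hPd, hPvw, hPa, hPb⟩ := h.exists_five_connections hvw hadj
  choose a ha using hPa
  choose b hb using hPb
  have ha' : ∀ i, a i ∈ P i ∧ a i ∈ nbr G v := fun i => by
    rw [← mem_inter, ha]; exact mem_singleton_self _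
  have hb' : ∀ i, b i ∈ P i ∧ b i ∈ nbr G w := fun i => by
    rw [← mem_inter, hb]; exact mem_singleton_self _
  obtain ⟨s, hs, hsa⟩ := exists_notMem_image (by omega : 5 < #(nbr G v)) a
  have hsP : ∀ i, s ∉ P i := fun i hi => hsa i (by
    rw [← mem_singleton, ← ha]; exact mem_inter.2 ⟨hi, hs⟩)
  have hbinj : Function.Injective b := fun i j hij => by
    by_contra hne
    exact disjoint_left.1 (hPd i j hne) (hb' i).1 (hij ▸ (hb' j).1)
  set B : Finset V := univ.image b with hB
  have hB5 : #B = 5 := by rw [hB, card_image_of_injective _ hbinj, card_univ, Fintype.card_fin]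
  have hBH : B ⊆ nbr G w := fun x hx => by
    obtain ⟨i, -, rfl⟩ := mem_image.1 hx
    exact (hb' i).2
  have hZ4 : #(nbr G w \ B) = 4 := by rw [card_sdiff_of_subset hBH, hw, hB5]
  have hZP : ∀ z ∈ nbr G w \ B, ∀ i, z ∉ P i := fun z hz i hi => by
    rw [mem_sdiff] at hz
    have h1 : z ∈ P i ∩ nbr G w := mem_inter.2 ⟨hi, hz.1⟩
    rw [hb, mem_singleton] at h1
    exact hz.2 (mem_image.2 ⟨i, mem_univ i, h1.symm⟩)
  have hcod : ∀ x ∈ nbr G w, codeg G (nbr G w \ B) x + codeg G B x ≤ 3 := fun x hx => by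
    rw [← codeg_union G sdiff_disjoint, sdiff_union_of_subset hBH]
    exact h.codeg_nbr_le_three hw hx
  have hcard : ∀ Z : Finset V, #{y ∈ B | ∃ z ∈ Z, G.Adj z y} ≤
      #({i | ∃ z ∈ Z, ∃ p ∈ P i, G.Adj z p} : Finset (Fin 5)) := by
    intro Z
    have h1 : B.filter (fun y => ∃ z ∈ Z, G.Adj z y) ⊆
        ({i | ∃ z ∈ Z, ∃ p ∈ P i, G.Adj z p} : Finset (Fin 5)).image b := by
      intro y hy
      obtain ⟨hyB, z, hz, hzy⟩ := mem_filter.1 hy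
      obtain ⟨i, -, rfl⟩ := mem_image.1 hyB
      exact mem_image.2 ⟨i, mem_filter.2 ⟨mem_univ i, z, hz, b i, (hb' i).1, hzy⟩, rfl⟩
    exact (card_le_card h1).trans card_image_le
  have key : ∀ Z ⊆ nbr G w \ B, Conn G Z → s ∉ Z →
      3 ≤ #{y ∈ B | ∃ z ∈ Z, G.Adj z y} + (if ∃ z ∈ Z, G.Adj z s then 1 else 0) +
        (if G.Adj s w then 1 else 0) → False := by
    intro Z hZ hZc hsZ hcount
    obtain ⟨z, hz⟩ := hZc.1
    refine h.false_of_connections hv hvw hadj hPc hPd hPvw ha' hb' hs hsP hZc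
      (fun i => disjoint_left.2 fun z hz => hZP z (hZ hz) i) (fun hvZ => ?_) (fun hwZ => ?_) hsZ
      ⟨z, hz, (mem_nbr.1 (mem_sdiff.1 (hZ hz)).1).symm⟩ ?_
    · exact hadj (mem_nbr.1 (mem_sdiff.1 (hZ hvZ)).1).symm
    · exact notMem_nbr_self G w (mem_sdiff.1 (hZ hwZ)).1
    · have := hcard Z
      omega
  have hsingle : ∀ z, #{y ∈ B | ∃ z' ∈ ({z} : Finset V), G.Adj z' y} = deg G B z := by
    intro z
    simp [deg]
  by_cases hsw : G.Adj s w
  · obtain ⟨z, hz, hzs⟩ : ∃ z ∈ nbr G w \ B, z ≠ s := by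
      obtain ⟨z, hz⟩ := exists_mem_ne (by omega : 1 < #(nbr G w \ B)) s
      exact ⟨z, hz⟩
    have hzB : z ∉ B := (mem_sdiff.1 hz).2
    refine key {z} (singleton_subset_iff.2 hz) (conn_singleton G z) (by simpa using hzs.symm) ?_
    rw [hsingle, if_pos hsw]
    have h1 := hcod z (mem_sdiff.1 hz).1
    have h2 := deg_add_codeg_of_notMem G hzB
    by_cases hzs' : G.Adj z s
    · rw [if_pos ⟨z, mem_singleton_self z, hzs'⟩]
      omega
    · have hsH : s ∈ nbr G w \ B := mem_sdiff.2 ⟨mem_nbr.2 hsw.symm, fun hsB => by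
        obtain ⟨i, -, hi⟩ := mem_image.1 hsB
        exact hsP i (hi ▸ (hb' i).1)⟩
      have h3 : 0 < codeg G (nbr G w \ B) z :=
        card_pos.2 ⟨s, mem_filter.2 ⟨hsH, hzs.symm, hzs'⟩⟩
      omega
  · have hsH : s ∉ nbr G w := fun hsH => hsw (mem_nbr.1 hsH).symm
    by_cases hz3 : ∃ z ∈ nbr G w \ B, codeg G B z ≤ 2
    · obtain ⟨z, hz, hz2⟩ := hz3
      have hzB : z ∉ B := (mem_sdiff.1 hz).2
      refine key {z} (singleton_subset_iff.2 hz) (conn_singleton G z) ?_ ?_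
      · rw [mem_singleton]
        rintro rfl
        exact hsH (mem_sdiff.1 hz).1
      · rw [hsingle]
        have h2 := deg_add_codeg_of_notMem G hzB
        omega
    · push Not at hz3
      -- Each of the four spends all three of its non-neighbours in B, so they form a clique. Taken
      -- together as Z they reach every vertex of B, since none can miss four.
      obtain ⟨z₀, hz₀⟩ : (nbr G w \ B).Nonempty := card_pos.1 (by omega)
      refine key _ subset_rfl (conn_of_dominating hz₀ fun y hy hne => ?_)
        (fun hsZ => hsH (mem_sdiff.1 hsZ).1) ?_
      · have h1 := hz3 z₀ hz₀
        have h2 := hcod z₀ (mem_sdiff.1 hz₀).1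
        exact codeg_eq_zero_iff.1 (by omega) y hy hne
      · have hall : B.filter (fun y => ∃ z ∈ nbr G w \ B, G.Adj z y) = B := by
          rw [filter_eq_self]
          intro y hy
          by_contra hcon
          push Not at hcon
          have h1 : #(nbr G w \ B) ≤ codeg G (nbr G w \ B) y := card_le_card fun z hz =>
            mem_filter.2 ⟨hz, fun hzy => (mem_sdiff.1 hz).2 (hzy ▸ hy),
              fun hyz => hcon z hz hyz.symm⟩
          have h2 := hcod y (hBH hy)
          omega
        rw [hall, hB5]
        omega

/-- If d(v) = 6, all vertices outside N[v] have degree at least 10, so the degree sum is at least 7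
· 6 + 10(n - 7) = 10n - 28. Equality makes N[v] a K₇ with no edges leaving it, contrary to
5-connectedness. -/
theorem nine_le_card_nbr (v : V) : 9 ≤ #(nbr G v) := by
  have h69 : ∀ x, #(nbr G x) = 6 ∨ 9 ≤ #(nbr G x) := fun x => by
    have h1 := h.six_le_card_nbr x
    have h2 := h.card_nbr_ne_seven x
    have h3 := h.card_nbr_ne_eight x
    omega
  refine (h69 v).resolve_left fun hv => ?_
  have hvF := notMem_nbr_self G v
  have hF7 : #(insert v (nbr G v)) = 7 := by rw [card_insert_of_notMem hvF, hv]
  have h10 : ∀ x, #(nbr G x) ≠ 9 := fun x hx => h.false_of_six_of_nine hv hx (by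
    rintro rfl
    omega)
  have hout : ∀ x ∈ (insert v (nbr G v))ᶜ, 10 ≤ #(nbr G x) := fun x hx => by
    rw [mem_compl, mem_insert, not_or] at hx
    have h1 := h10 x
    rcases h69 x with h2 | h2
    · exact (h.false_of_six_of_six hv h2 (Ne.symm hx.1) fun hadj => hx.2 (mem_nbr.2 hadj)).elim
    · omega
  have hsum := h.sum_card_nbr
  rw [← sum_add_sum_compl (insert v (nbr G v))] at hsum
  have h1 := card_nsmul_le_sum _ _ _ hout
  rw [smul_eq_mul] at h1
  have h2 := card_add_card_compl (insert v (nbr G v))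
  have hall : ∀ x ∈ insert v (nbr G v), #(nbr G x) = 6 := by
    by_contra hcon
    push Not at hcon
    obtain ⟨x, hx, hne⟩ := hcon
    have h3 : ∑ x ∈ insert v (nbr G v), 6 < ∑ x ∈ insert v (nbr G v), #(nbr G x) :=
      sum_lt_sum (fun x _ => h.six_le_card_nbr x)
        ⟨x, hx, lt_of_le_of_ne (h.six_le_card_nbr x) (Ne.symm hne)⟩
    rw [sum_const, smul_eq_mul] at h3
    omega
  have hnone : outer G (insert v (nbr G v)) = ∅ := by
    rw [eq_empty_iff_forall_notMem]
    intro y hy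
    obtain ⟨hyF, x, hx, hxy⟩ := mem_outer.1 hy
    have h3 : insert y ((insert v (nbr G v)).erase x) ⊆ nbr G x := by
      refine insert_subset (mem_nbr.2 hxy) fun z hz => ?_
      obtain ⟨hzx, hz⟩ := mem_erase.1 hz
      rw [mem_nbr]
      rcases mem_insert.1 hx with rfl | hx <;> rcases mem_insert.1 hz with rfl | hz
      · exact absurd rfl hzx
      · exact mem_nbr.1 hz
      · exact (mem_nbr.1 hx).symm
      · exact h.adj_of_card_nbr_eq_six hv hx hz hzx.symm
    have h4 := card_le_card h3
    rw [card_insert_of_notMem fun hy => hyF (mem_erase.1 hy).2, card_erase_of_mem hx,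
      hall x hx] at h4
    omega
  have h5 := h.five_le_card_outer (C := insert v (nbr G v))
    (conn_of_dominating (mem_insert_self _ _) fun y hy hne =>
      mem_nbr.1 ((mem_insert.1 hy).resolve_left hne)) (by
      rw [hnone, union_empty]
      intro heq
      have h6 := congrArg card heq
      rw [hF7, card_univ] at h6
      have := h.ten_le
      omega)
  rw [hnone, card_empty] at h5
  omega

end IsCritical

/-- There is no critical graph. -/
theorem not_isCritical (G : SimpleGraph V) : ¬ IsCritical G := fun h =>
  h.false_of_nine_le h.nine_le_card_nbr

end
end DenseMinor

/-! ### Models, minors and the extremal bound -/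

namespace DenseMinor
section
open scoped Classical
open Finset

/-- `G` has `t` disjoint connected bags all but at most `s` pairs of which are joined by an
edge. -/
def HasModel {V : Type*} (G : SimpleGraph V) (t s : ℕ) : Prop :=
  ∃ (K : SimpleGraph (Fin t)) (B : Fin t → Finset V), coPairs K univ ≤ 2 * s ∧
    (∀ i, Conn G (B i)) ∧ (∀ i j, i ≠ j → Disjoint (B i) (B j)) ∧
      ∀ i j, K.Adj i j → ∃ a ∈ B i, ∃ b ∈ B j, G.Adj a b

theorem HasModel.mono {V : Type*} {G G' : SimpleGraph V} (hle : G ≤ G') {t s : ℕ}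
    (h : HasModel G t s) : HasModel G' t s := by
  obtain ⟨K, B, h1, h2, h3, h4⟩ := h
  refine ⟨K, B, h1, fun i => (h2 i).mono hle, h3, fun i j hij => ?_⟩
  obtain ⟨a, ha, b, hb, hab⟩ := h4 i j hij
  exact ⟨a, ha, b, hb, hle hab⟩

theorem adjPairs_univ_eq {V : Type*} [Fintype V] (G : SimpleGraph V) [Fintype G.edgeSet] :
    adjPairs G univ univ = 2 * #G.edgeFinset := by
  have := SimpleGraph.sum_degrees_eq_twice_card_edges G
  rw [show G.edgeFinset = @SimpleGraph.edgeFinset V G (SimpleGraph.fintypeEdgeSet G) by congr!,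
    ← this]
  refine sum_congr rfl fun x _ => ?_
  rw [← SimpleGraph.card_neighborFinset_eq_degree]
  unfold deg
  congr 1
  ext y
  simp

theorem coPairs_univ_eq {V : Type*} [Fintype V] (G : SimpleGraph V) [Fintype Gᶜ.edgeSet] :
    coPairs G univ = 2 * #Gᶜ.edgeFinset := by
  rw [← adjPairs_univ_eq]
  refine sum_congr rfl fun x _ => ?_
  unfold codeg deg
  congr 1
  ext y
  simp [ne_comm]

theorem HasModel.hasCompleteMinusMinor {V : Type*} {G : SimpleGraph V} {t s : ℕ}
    (h : HasModel G t s) (hs : s ≤ t.choose 2) : G.HasCompleteMinusMinor t s := by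
  obtain ⟨K, B, hK, hB, hdis, hadj⟩ := h
  rw [coPairs_univ_eq] at hK
  -- At most s pairs are missing; others are added to reach exactly s deleted edges.
  obtain ⟨D, hKD, hD, hDs⟩ := exists_subsuperset_card_eq
    (s := Kᶜ.edgeFinset) (t := (⊤ : SimpleGraph (Fin t)).edgeFinset) (n := s)
    (SimpleGraph.edgeFinset_mono le_top) (by omega)
    (by rw [SimpleGraph.card_edgeFinset_top_eq_card_choose_two, Fintype.card_fin]; exact hs)
  have hHK : ∀ i j, ((⊤ : SimpleGraph (Fin t)).deleteEdges D).Adj i j → K.Adj i j := by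
    intro i j hij
    rw [SimpleGraph.deleteEdges_adj, SimpleGraph.top_adj] at hij
    by_contra hne
    exact hij.2 (hKD (by simpa [hij.1] using hne))
  refine ⟨(⊤ : SimpleGraph (Fin t)).deleteEdges D,
    ⟨D, fun e he => by simpa using hD he, hDs, rfl⟩, ?_⟩
  set H := (⊤ : SimpleGraph (Fin t)).deleteEdges (D : Set (Sym2 (Fin t))) with hH
  have huniq : ∀ x i j, x ∈ B i → x ∈ B j → i = j := fun x i j hi hj => by
    by_contra hne
    exact disjoint_left.1 (hdis i j hne) hi hj
  -- Edges between bags that H does not join are left out, so that contracting the bags gives H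
  -- itself.
  let S : G.Subgraph :=
    { verts := {x | ∃ i, x ∈ B i}
      Adj := fun x y => G.Adj x y ∧ ∃ i j, x ∈ B i ∧ y ∈ B j ∧ (i = j ∨ H.Adj i j)
      adj_sub := fun h => h.1
      edge_vert := fun h => by
        obtain ⟨-, i, -, hi, -⟩ := h
        exact ⟨i, hi⟩
      symm := ⟨fun x y ⟨h, i, j, hi, hj, hij⟩ =>
        ⟨h.symm, j, i, hj, hi, hij.imp Eq.symm SimpleGraph.Adj.symm⟩⟩ }
  have hf : ∀ x : S.verts, ∃ i, x.1 ∈ B i := fun x => x.2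
  choose f hf using hf
  refine ⟨S, f, fun w => ?_, fun i j => ⟨fun hij => ⟨hij.ne, ?_⟩, ?_⟩⟩
  · refine (conn_iff_induce_connected.1 (hB w)).map
      (f := (⟨fun x => ⟨⟨x.1, w, x.2⟩, huniq x.1 _ _ (hf _) x.2⟩, fun {x y} hxy => ?_⟩ :
        G.induce (B w : Set V) →g S.coe.induce (f ⁻¹' {w}))) ?_
    · exact ⟨hxy, w, w, x.2, y.2, Or.inl rfl⟩
    · rintro ⟨⟨x, hx⟩, hxw⟩
      have hxw' : f ⟨x, hx⟩ = w := hxw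
      exact ⟨⟨x, hxw' ▸ hf ⟨x, hx⟩⟩, rfl⟩
  · obtain ⟨a, ha, b, hb, hab⟩ := hadj i j (hHK i j hij)
    exact ⟨⟨a, i, ha⟩, ⟨b, j, hb⟩, huniq a _ _ (hf _) ha, huniq b _ _ (hf _) hb,
      hab, i, j, ha, hb, Or.inr hij⟩
  · rintro ⟨hne, x, y, rfl, rfl, hxy⟩
    obtain ⟨-, i, j, hi, hj, hij⟩ := hxy
    rw [huniq _ _ _ (hf x) hi, huniq _ _ _ (hf y) hj] at hne ⊢
    exact hij.resolve_left hne

theorem hasModel_of_hasCompleteMinusMinor {V : Type*} [Fintype V] {G : SimpleGraph V} {t s : ℕ}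
    (h : G.HasCompleteMinusMinor t s) : HasModel G t s := by
  obtain ⟨H, ⟨D, hD, hDs, rfl⟩, S, f, hf, hadj⟩ := h
  refine ⟨(⊤ : SimpleGraph (Fin t)).deleteEdges D,
    fun i => ({x | ∃ hx : x ∈ S.verts, f ⟨x, hx⟩ = i} : Finset V), ?_, fun i => ?_,
    fun i j hij => ?_, fun i j hij => ?_⟩
  · have : ((⊤ : SimpleGraph (Fin t)).deleteEdges (D : Set (Sym2 (Fin t))))ᶜ.edgeFinset ⊆ D := by
      intro e he
      induction e with
      | _ x y =>
        rw [SimpleGraph.mem_edgeFinset, SimpleGraph.mem_edgeSet, SimpleGraph.compl_adj,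
          SimpleGraph.deleteEdges_adj, SimpleGraph.top_adj] at he
        by_contra hne
        exact he.2 ⟨he.1, hne⟩
    rw [coPairs_univ_eq, ← hDs]
    exact Nat.mul_le_mul_left 2 (card_le_card this)
  · rw [conn_iff_induce_connected]
    refine (hf i).map (f := (⟨fun x => ⟨x.1.1, mem_coe.2 (mem_filter.2 ⟨mem_univ _, x.1.2, x.2⟩)⟩, fun {x y} hxy => ?_⟩ :
      S.coe.induce (f ⁻¹' {i}) →g G.induce _)) ?_
    · exact S.adj_sub hxy
    · rintro ⟨x, hx⟩
      have hx' : ∃ hx : x ∈ S.verts, f ⟨x, hx⟩ = i := by simpa using hx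
      obtain ⟨hxS, hxi⟩ := hx'
      exact ⟨⟨⟨x, hxS⟩, hxi⟩, rfl⟩
  · rw [disjoint_left]
    intro x hx hy
    simp only [mem_filter, mem_univ, true_and] at hx hy
    obtain ⟨h1, h2⟩ := hx
    obtain ⟨h3, h4⟩ := hy
    exact hij (h2.symm.trans h4)
  · obtain ⟨-, x, y, hx, hy, hxy⟩ := (hadj i j).1 hij
    exact ⟨x.1, mem_filter.2 ⟨mem_univ _, x.2, hx⟩, y.1, mem_filter.2 ⟨mem_univ _, y.2, hy⟩,
      S.adj_sub hxy⟩

theorem MinorOn.hasModel {V : Type*} {G G' : SimpleGraph V} {X : Finset V} {t s : ℕ}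
    (h : MinorOn G X G') (hm : HasModel (G'.comap (Subtype.val : X → V)) t s) :
    HasModel G t s := by
  obtain ⟨φ, h1, h2, h3⟩ := h
  obtain ⟨K, B, hK, hB, hdis, hadj⟩ := hm
  refine ⟨K, fun i => (B i).biUnion fun x => φ x.1, hK, fun i => ?_, fun i j hij => ?_,
    fun i j hij => ?_⟩
  · exact conn_biUnion (hB i) (fun q _ => h1 q.1 q.2) fun x _ y _ hxy => h3 x.1 x.2 y.1 y.2 hxy
  · rw [disjoint_biUnion_left]
    intro x hx
    rw [disjoint_biUnion_right]
    intro y hy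
    refine h2 x.1 x.2 y.1 y.2 fun hxy => ?_
    exact disjoint_left.1 (hdis i j hij) hx (Subtype.ext hxy ▸ hy)
  · obtain ⟨x, hx, y, hy, hxy⟩ := hadj i j hij
    obtain ⟨a, ha, b, hb, hab⟩ := h3 x.1 x.2 y.1 y.2 hxy
    exact ⟨a, mem_biUnion.2 ⟨x, hx, ha⟩, b, mem_biUnion.2 ⟨y, hy, hb⟩, hab⟩

theorem adjPairs_comap_subtype {V : Type*} (G : SimpleGraph V) (X : Finset V) :
    adjPairs (G.comap (Subtype.val : X → V)) univ univ = adjPairs G X X := by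
  unfold adjPairs deg
  rw [← sum_coe_sort X]
  refine sum_congr rfl fun x _ => ?_
  rw [← card_map (Function.Embedding.subtype _)]
  congr 1
  ext y
  simp only [mem_map, mem_filter, mem_univ, true_and, SimpleGraph.comap_adj,
    Function.Embedding.subtype_apply, Subtype.exists, exists_and_left]
  exact ⟨by rintro ⟨_, h, hx, rfl⟩; exact ⟨hx, h⟩, fun h => ⟨y, h.2, h.1, rfl⟩⟩

theorem hasModel_of_card_eq_nine {V : Type*} [Fintype V] {G : SimpleGraph V}
    (hV : Fintype.card V = 9) (hE : 60 ≤ adjPairs G univ univ) : HasModel G 9 6 := by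
  let e : Fin 9 ≃ V := (Fintype.equivFinOfCardEq hV).symm
  refine ⟨G.comap e, fun i => {e i}, ?_, fun i => conn_singleton G _, fun i j hij => ?_,
    fun i j hij => ⟨e i, mem_singleton_self _, e j, mem_singleton_self _, hij⟩⟩
  · have h1 := adjPairs_add_coPairs (G.comap e) univ
    have h2 : adjPairs (G.comap e) univ univ = adjPairs G univ univ := by
      unfold adjPairs deg
      rw [← Equiv.sum_comp e]
      refine sum_congr rfl fun x _ => ?_
      rw [← card_map e.toEmbedding]
      congr 1
      ext y
      simp
    rw [card_univ, Fintype.card_fin] at h1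
    omega
  · simpa using hij

theorem exists_le_adjPairs_eq {V : Type*} [Fintype V] {G : SimpleGraph V} {m : ℕ}
    (hm : 2 * m ≤ adjPairs G univ univ) : ∃ G' ≤ G, adjPairs G' univ univ = 2 * m := by
  rw [adjPairs_univ_eq] at hm
  obtain ⟨D, hD, hDm⟩ := exists_subset_card_eq (show m ≤ #G.edgeFinset by omega)
  refine ⟨SimpleGraph.fromEdgeSet D, fun x y hxy => ?_, ?_⟩
  · rw [SimpleGraph.fromEdgeSet_adj] at hxy
    simpa using hD hxy.1
  · rw [adjPairs_univ_eq]
    congr 1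
    rw [← hDm]
    congr 1
    ext z
    rw [SimpleGraph.mem_edgeFinset, SimpleGraph.edgeSet_fromEdgeSet]
    exact ⟨fun h => h.1, fun h => ⟨h, G.not_isDiag_of_mem_edgeFinset (hD h)⟩⟩

/-- The extremal theorem, for bags. -/
theorem hasModel_of_le_adjPairs (n : ℕ) : ∀ {V : Type u} [Fintype V] (G : SimpleGraph V),
    Fintype.card V = n → 9 ≤ n → 10 * n ≤ adjPairs G univ univ + 28 → HasModel G 9 6 := by
  induction n using Nat.strong_induction_on with
  | _ n ih =>
  intro V _ G hV hn hE
  by_cases hn9 : n = 9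
  · exact hasModel_of_card_eq_nine (hV.trans hn9) (by omega)
  -- Criticality asks for exactly 5n - 14 edges. Its bounds on minors come from the induction and
  -- from the case of nine vertices, parity closing the gap of one in each.
  obtain ⟨G₀, hle, hG₀⟩ := exists_le_adjPairs_eq (G := G) (m := 5 * n - 14) (by omega)
  refine HasModel.mono hle ?_
  by_contra hno
  refine not_isCritical G₀ ⟨by omega, by omega, fun X G' hX hX9 hXn => ?_, fun X G' hX hX9 => ?_⟩
  · by_contra hlt
    obtain ⟨r, hr⟩ := adjPairs_even G' X
    refine hno (hX.hasModel (ih #X (by omega) _ (Fintype.card_coe X) hX9 ?_))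
    rw [adjPairs_comap_subtype]
    omega
  · by_contra hlt
    obtain ⟨r, hr⟩ := adjPairs_even G' X
    refine hno (hX.hasModel (hasModel_of_card_eq_nine ((Fintype.card_coe X).trans hX9) ?_))
    rw [adjPairs_comap_subtype]
    omega

theorem ncard_edgeSet {V : Type*} [Fintype V] (G : SimpleGraph V) :
    2 * G.edgeSet.ncard = adjPairs G univ univ := by
  rw [adjPairs_univ_eq, Set.ncard_eq_toFinset_card']
  rfl

theorem hasCompleteMinusMinor_nine_six {V : Type u} [Finite V] (G : SimpleGraph V)
    (hV : 9 ≤ Nat.card V) (hE : 5 * Nat.card V ≤ G.edgeSet.ncard + 14) :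
    G.HasCompleteMinusMinor 9 6 := by
  have := Fintype.ofFinite V
  rw [Nat.card_eq_fintype_card] at hV hE
  refine (hasModel_of_le_adjPairs _ G rfl hV ?_).hasCompleteMinusMinor (by decide)
  have := ncard_edgeSet G
  omega

end
end DenseMinor

/-! ### Sums over 4-cliques, and cockades -/

namespace DenseMinor
section
open scoped Classical
open Finset

section Maps
variable {V W : Type*} (G : SimpleGraph V) (f : W ↪ V)

theorem deg_map (S : Finset W) (x : W) : deg G (S.map f) (f x) = deg (G.comap f) S x := by
  unfold deg
  rw [filter_map, card_map]
  rfl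

theorem codeg_map (S : Finset W) (x : W) : codeg G (S.map f) (f x) = codeg (G.comap f) S x := by
  unfold codeg
  rw [filter_map, card_map]
  simp

theorem adjPairs_map (S T : Finset W) :
    adjPairs G (S.map f) (T.map f) = adjPairs (G.comap f) S T := by
  simp [adjPairs, sum_map, deg_map]

theorem coPairs_map (S : Finset W) : coPairs G (S.map f) = coPairs (G.comap f) S := by
  simp [coPairs, sum_map, codeg_map]

theorem conn_comap {S : Finset W} (h : Conn G (S.map f)) : Conn (G.comap f) S := by
  refine ⟨map_nonempty.1 h.1, fun A hA hne hAS => ?_⟩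
  obtain ⟨a, ha, b, hb, hab⟩ := h.2 (A.map f) (map_subset_map.2 hA) (hne.map)
    fun heq => hAS (map_injective f heq)
  obtain ⟨a, ha', rfl⟩ := mem_map.1 ha
  rw [← Finset.map_sdiff] at hb
  obtain ⟨b, hb', rfl⟩ := mem_map.1 hb
  exact ⟨a, ha', b, hb', hab⟩

end Maps

section CliqueSum

variable {V : Type*} {G : SimpleGraph V} {A B : Finset V}

/-- Let P ∩ A be split in two. If both parts meet the clique A ∩ B, the clique joins them. Otherwise
one part avoids B, and the edge of P leaving it stays in A. -/
theorem IsSeparation.conn_inter (h : IsSeparation G ∅ ∅ A B)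
    (hS : ∀ x ∈ A ∩ B, ∀ y ∈ A ∩ B, x ≠ y → G.Adj x y) {P : Finset V} (hP : Conn G P)
    (hPA : (P ∩ A).Nonempty) : Conn G (P ∩ A) := by
  refine ⟨hPA, fun D hD hne hDA => ?_⟩
  have key : ∀ D ⊆ P ∩ A, D.Nonempty → D ≠ P ∩ A → (∀ x ∈ D, x ∉ B) →
      ∃ a ∈ D, ∃ b ∈ (P ∩ A) \ D, G.Adj a b := by
    intro D hD hne hDA hDB
    obtain ⟨a, ha, b, hb, hab⟩ := hP.2 D (hD.trans inter_subset_left) hne fun heq => by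
      subst heq
      exact hDA (subset_antisymm (by simpa using hD) inter_subset_left)
    rw [mem_sdiff] at hb
    refine ⟨a, ha, b, mem_sdiff.2 ⟨mem_inter.2 ⟨hb.1, ?_⟩, hb.2⟩, hab⟩
    by_contra hbA
    exact h.noEdge a (mem_inter.1 (hD ha)).2 (hDB a ha) b ((h.cover b).resolve_left hbA) hbA hab
  by_cases h1 : ∃ x ∈ D, x ∈ B
  · by_cases h2 : ∃ y ∈ (P ∩ A) \ D, y ∈ B
    · obtain ⟨x, hxD, hxB⟩ := h1
      obtain ⟨y, hyD, hyB⟩ := h2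
      have hxA := (mem_inter.1 (hD hxD)).2
      have hyA := (mem_inter.1 (mem_sdiff.1 hyD).1).2
      exact ⟨x, hxD, y, hyD, hS x (mem_inter.2 ⟨hxA, hxB⟩) y (mem_inter.2 ⟨hyA, hyB⟩)
        fun hxy => (mem_sdiff.1 hyD).2 (hxy ▸ hxD)⟩
    · push Not at h2
      obtain ⟨a, ha, b, hb, hab⟩ := key ((P ∩ A) \ D) sdiff_subset
        (sdiff_nonempty.2 fun h => hDA (subset_antisymm hD h))
        (fun heq => by
          obtain ⟨x, hx⟩ := hne
          exact (mem_sdiff.1 (heq ▸ hD hx)).2 hx) h2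
      rw [Finset.sdiff_sdiff_eq_self hD] at hb
      exact ⟨b, hb, a, ha, hab.symm⟩
  · push Not at h1
    exact key D hD hne hDA h1

theorem IsSeparation.inter_nonempty (h : IsSeparation G ∅ ∅ A B) {P : Finset V} (hP : Conn G P)
    (hPA : (P ∩ A).Nonempty) {x : V} (hx : x ∈ P) (hxA : x ∉ A) : ∃ s ∈ P, s ∈ A ∩ B := by
  obtain ⟨a, ha, b, hb, hab⟩ := hP.2 (P ∩ A) inter_subset_left hPA
    fun heq => hxA (inter_eq_left.1 heq hx)
  rw [mem_sdiff, mem_inter] at hb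
  rw [mem_inter] at ha
  have hbA : b ∉ A := fun h => hb.2 ⟨hb.1, h⟩
  refine ⟨a, ha.1, mem_inter.2 ⟨ha.2, ?_⟩⟩
  by_contra haB
  exact h.noEdge a ha.2 haB b ((h.cover b).resolve_left hbA) hbA hab

/-- Cut all bags down to A. If two bags were joined by an edge that is not inside A, both meet the
clique A ∩ B, which joins them again. -/
theorem IsSeparation.hasModel_comap {W : Type*} [Fintype W] (h : IsSeparation G ∅ ∅ A B)
    (hS : ∀ x ∈ A ∩ B, ∀ y ∈ A ∩ B, x ≠ y → G.Adj x y) {f : W ↪ V} (hf : univ.map f = A)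
    {t s : ℕ} {K : SimpleGraph (Fin t)} {P : Fin t → Finset V} (hK : coPairs K univ ≤ 2 * s)
    (hP : ∀ i, Conn G (P i)) (hdis : ∀ i j, i ≠ j → Disjoint (P i) (P j))
    (hadj : ∀ i j, K.Adj i j → ∃ a ∈ P i, ∃ b ∈ P j, G.Adj a b)
    (hPA : ∀ i, (P i ∩ A).Nonempty) : HasModel (G.comap f) t s := by
  have hA : ∀ a ∈ A, ∃ x, f x = a := fun a ha => by
    rw [← hf] at ha
    obtain ⟨x, -, hx⟩ := mem_map.1 ha
    exact ⟨x, hx⟩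
  refine ⟨K, fun i => {x | f x ∈ P i}, hK, fun i => ?_, fun i j hij => ?_, fun i j hij => ?_⟩
  · apply conn_comap
    have : map f {x | f x ∈ P i} = P i ∩ A := by
      ext y
      simp only [mem_map, mem_filter, mem_univ, true_and, mem_inter, ← hf]
      constructor
      · rintro ⟨x, hx, rfl⟩
        exact ⟨hx, x, rfl⟩
      · rintro ⟨hy, x, rfl⟩
        exact ⟨x, hy, rfl⟩
    rw [this]
    exact h.conn_inter hS (hP i) (hPA i)
  · rw [disjoint_left]
    intro x hx hy
    exact disjoint_left.1 (hdis i j hij) (mem_filter.1 hx).2 (mem_filter.1 hy).2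
  · suffices ∃ a ∈ P i, ∃ b ∈ P j, a ∈ A ∧ b ∈ A ∧ G.Adj a b by
      obtain ⟨a, ha, b, hb, haA, hbA, hab⟩ := this
      obtain ⟨x, rfl⟩ := hA a haA
      obtain ⟨y, rfl⟩ := hA b hbA
      exact ⟨x, by simpa using ha, y, by simpa using hb, hab⟩
    have hmeet : ∀ i j a b, a ∈ P i → b ∈ P j → G.Adj a b → a ∉ A →
        (∃ s ∈ P i, s ∈ A ∩ B) ∧ ∃ s ∈ P j, s ∈ A ∩ B := by
      intro i j a b ha hb hab haA
      refine ⟨h.inter_nonempty (hP i) (hPA i) ha haA, ?_⟩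
      by_cases hbA : b ∈ A
      · refine ⟨b, hb, mem_inter.2 ⟨hbA, ?_⟩⟩
        by_contra hbB
        exact h.noEdge b hbA hbB a ((h.cover a).resolve_left haA) haA hab.symm
      · exact h.inter_nonempty (hP j) (hPA j) hb hbA
    have hfin : (∃ s ∈ P i, s ∈ A ∩ B) → (∃ s ∈ P j, s ∈ A ∩ B) →
        ∃ a ∈ P i, ∃ b ∈ P j, a ∈ A ∧ b ∈ A ∧ G.Adj a b := by
      rintro ⟨s, hs, hsS⟩ ⟨r, hr, hrS⟩
      exact ⟨s, hs, r, hr, (mem_inter.1 hsS).1, (mem_inter.1 hrS).1,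
        hS s hsS r hrS fun hsr => disjoint_left.1 (hdis i j hij.ne) hs (hsr ▸ hr)⟩
    obtain ⟨a, ha, b, hb, hab⟩ := hadj i j hij
    by_cases haA : a ∈ A
    · by_cases hbA : b ∈ A
      · exact ⟨a, ha, b, hb, haA, hbA, hab⟩
      · obtain ⟨h1, h2⟩ := hmeet j i b a hb ha hab.symm hbA
        exact hfin h2 h1
    · obtain ⟨h1, h2⟩ := hmeet i j a b ha hb hab haA
      exact hfin h1 h2

/-- Among the bags of a model in a clique sum over a 4-clique, at most four meet the clique, and
bags on different sides are not joined. -/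
theorem IsSeparation.card_bags (h : IsSeparation G ∅ ∅ A B) (hS4 : #(A ∩ B) = 4) {t : ℕ}
    {K : SimpleGraph (Fin t)} {P : Fin t → Finset V} (hP : ∀ i, Conn G (P i))
    (hdis : ∀ i j, i ≠ j → Disjoint (P i) (P j))
    (hadj : ∀ i j, K.Adj i j → ∃ a ∈ P i, ∃ b ∈ P j, G.Adj a b) :
    t ≤ #{i | ¬ (P i ∩ A).Nonempty} + #{i | ¬ (P i ∩ B).Nonempty} + 4 ∧
      (∀ i, ¬ (P i ∩ A).Nonempty → ∀ j, ¬ (P j ∩ B).Nonempty → i ≠ j ∧ ¬ K.Adj i j) := by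
  constructor
  · have h1 : (univ : Finset (Fin t)) ⊆ ({i | ¬ (P i ∩ A).Nonempty} : Finset (Fin t)) ∪
        ({i | ¬ (P i ∩ B).Nonempty} : Finset (Fin t)) ∪
        ({i | (P i ∩ (A ∩ B)).Nonempty} : Finset (Fin t)) := by
      intro i _
      simp only [mem_union, mem_filter, mem_univ, true_and]
      by_contra hcon
      push Not at hcon
      obtain ⟨⟨hA, hB⟩, hS⟩ := hcon
      obtain ⟨b, hb⟩ := hB
      rw [mem_inter] at hb
      have hnot : ∀ s ∈ P i, s ∉ A ∩ B := fun s hs hsS =>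
        notMem_empty s (by rw [← hS]; exact mem_inter.2 ⟨hs, hsS⟩)
      by_cases hbA : b ∈ A
      · exact hnot b hb.1 (mem_inter.2 ⟨hbA, hb.2⟩)
      · obtain ⟨s, hs, hsS⟩ := h.inter_nonempty (hP i) hA hb.1 hbA
        exact hnot s hs hsS
    have h2 : #({i | (P i ∩ (A ∩ B)).Nonempty} : Finset (Fin t)) ≤ 4 := by
      rw [← hS4]
      have hch : ∀ i : Fin t, (P i ∩ (A ∩ B)).Nonempty → ∃ s, s ∈ P i ∧ s ∈ A ∩ B :=
        fun i ⟨s, hs⟩ => ⟨s, mem_inter.1 hs⟩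
      have : Nonempty V := (card_pos.1 (by omega : 0 < #(A ∩ B))).to_subtype.map Subtype.val
      choose! g hg using hch
      refine card_le_card_of_injOn g (fun i hi => (hg i (by simpa using hi)).2) ?_
      intro i hi j hj hij
      by_contra hne
      exact disjoint_left.1 (hdis i j hne) (hg i (by simpa using hi)).1
        (hij ▸ (hg j (by simpa using hj)).1)
    have h3 := card_le_card h1
    rw [card_univ, Fintype.card_fin] at h3
    have h4 := card_union_le (({i | ¬ (P i ∩ A).Nonempty} : Finset (Fin t)) ∪
        ({i | ¬ (P i ∩ B).Nonempty} : Finset (Fin t)))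
        ({i | (P i ∩ (A ∩ B)).Nonempty} : Finset (Fin t))
    have h5 := card_union_le ({i | ¬ (P i ∩ A).Nonempty} : Finset (Fin t))
        ({i | ¬ (P i ∩ B).Nonempty} : Finset (Fin t))
    omega
  · intro i hi j hj
    have hiA : ∀ x ∈ P i, x ∉ A := fun x hx hxA => hi ⟨x, mem_inter.2 ⟨hx, hxA⟩⟩
    have hjB : ∀ x ∈ P j, x ∉ B := fun x hx hxB => hj ⟨x, mem_inter.2 ⟨hx, hxB⟩⟩
    constructor
    · rintro rfl
      obtain ⟨x, hx⟩ := (hP i).1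
      exact (h.cover x).elim (hiA x hx) (hjB x hx)
    · intro hij
      obtain ⟨a, ha, b, hb, hab⟩ := hadj i j hij
      exact h.noEdge b ((h.cover b).resolve_right (hjB b hb)) (hjB b hb) a
        ((h.cover a).resolve_left (hiA a ha)) (hiA a ha) hab.symm

theorem two_mul_card_mul_card_le {ι : Type*} [Fintype ι] {K : SimpleGraph ι} {I J : Finset ι}
    (h : ∀ i ∈ I, ∀ j ∈ J, i ≠ j ∧ ¬ K.Adj i j) : 2 * (#I * #J) ≤ coPairs K univ := by
  have hIJ : Disjoint I J := disjoint_left.2 fun i hi hj => (h i hi i hj).1 rfl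
  have h1 := coPairs_union K hIJ
  have h2 : ∑ i ∈ I, codeg K J i = #I * #J := by
    rw [sum_congr rfl fun i hi => show codeg K J i = #J by
      unfold codeg
      rw [filter_true_of_mem fun j hj => ⟨(h i hi j hj).1.symm, (h i hi j hj).2⟩]]
    simp
  have h3 := coPairs_mono K (subset_univ (I ∪ J))
  omega

theorem card_le_codeg {ι : Type*} [Fintype ι] {K : SimpleGraph ι} {J : Finset ι} {j : ι}
    (h : ∀ i ∈ J, i ≠ j ∧ ¬ K.Adj j i) : #J ≤ codeg K univ j :=
  card_le_card fun i hi => mem_filter.2 ⟨mem_univ i, h i hi⟩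

theorem coPairs_univ_succAbove {n : ℕ} (K : SimpleGraph (Fin (n + 1))) (j : Fin (n + 1)) :
    coPairs K univ = coPairs (K.comap j.succAboveEmb) univ + 2 * codeg K univ j := by
  rw [coPairs_erase K (mem_univ j), ← coPairs_map]
  congr 2
  ext i
  simp [Fin.exists_succAbove_eq_iff]

/-- Let p bags miss A and q miss B. If p or q is 0, the model restricts to that side. Otherwise p +
q ≥ t - 4 and pq ≤ s. This is impossible for t = 8, s = 1. For t = 9, s = 5 it forces one of p, q to
be 1 and the other at least 4; the single bag then lacks at least four adjacencies, and dropping it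
leaves eight bags on one side lacking at most one. Hence the two exclusions are carried together. -/
theorem IsSeparation.hasModel_of_sum {W W' : Type*} [Fintype W] [Fintype W']
    (h : IsSeparation G ∅ ∅ A B)
    (hS : ∀ x ∈ A ∩ B, ∀ y ∈ A ∩ B, x ≠ y → G.Adj x y) (hS4 : #(A ∩ B) = 4) {f : W ↪ V}
    {g : W' ↪ V} (hf : univ.map f = A) (hg : univ.map g = B) :
    (HasModel G 8 1 → HasModel (G.comap f) 8 1 ∨ HasModel (G.comap g) 8 1) ∧
    (HasModel G 9 5 → HasModel (G.comap f) 8 1 ∨ HasModel (G.comap f) 9 5 ∨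
      HasModel (G.comap g) 8 1 ∨ HasModel (G.comap g) 9 5) := by
  have hS' : ∀ x ∈ B ∩ A, ∀ y ∈ B ∩ A, x ≠ y → G.Adj x y := by rwa [inter_comm]
  have key : ∀ {t s : ℕ} {K : SimpleGraph (Fin t)} {P : Fin t → Finset V},
      coPairs K univ ≤ 2 * s → (∀ i, Conn G (P i)) →
      (∀ i j, i ≠ j → Disjoint (P i) (P j)) →
      (∀ i j, K.Adj i j → ∃ a ∈ P i, ∃ b ∈ P j, G.Adj a b) →
      (#{i | ¬ (P i ∩ A).Nonempty} = 0 → HasModel (G.comap f) t s) ∧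
      (#{i | ¬ (P i ∩ B).Nonempty} = 0 → HasModel (G.comap g) t s) ∧
      #{i | ¬ (P i ∩ A).Nonempty} * #{i | ¬ (P i ∩ B).Nonempty} ≤ s := by
    intro t s K P hK hP hdis hadj
    refine ⟨fun h0 => ?_, fun h0 => ?_, ?_⟩
    · rw [card_eq_zero, filter_eq_empty_iff] at h0
      exact h.hasModel_comap hS hf hK hP hdis hadj fun i => not_not.1 (h0 (mem_univ i))
    · rw [card_eq_zero, filter_eq_empty_iff] at h0
      exact h.symm.hasModel_comap hS' hg hK hP hdis hadj fun i => not_not.1 (h0 (mem_univ i))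
    · have := two_mul_card_mul_card_le (K := K) (I := {i | ¬ (P i ∩ A).Nonempty})
        (J := {i | ¬ (P i ∩ B).Nonempty}) fun i hi j hj =>
          (h.card_bags hS4 hP hdis hadj).2 i (mem_filter.1 hi).2 j (mem_filter.1 hj).2
      omega
  have drop : ∀ {K : SimpleGraph (Fin 9)} {P : Fin 9 → Finset V} (j : Fin 9),
      coPairs K univ ≤ 10 → 4 ≤ codeg K univ j → (∀ i, Conn G (P i)) →
      (∀ i j, i ≠ j → Disjoint (P i) (P j)) →
      (∀ i j, K.Adj i j → ∃ a ∈ P i, ∃ b ∈ P j, G.Adj a b) →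
      (∀ i ≠ j, (P i ∩ A).Nonempty) ∨ (∀ i ≠ j, (P i ∩ B).Nonempty) →
      HasModel (G.comap f) 8 1 ∨ HasModel (G.comap g) 8 1 := by
    intro K P j hK hj hP hdis hadj hmeet
    have h3 : coPairs (K.comap (Fin.succAboveEmb j)) univ ≤ 2 * 1 := by
      have := coPairs_univ_succAbove K j
      omega
    have hdis' : ∀ i i' : Fin 8, i ≠ i' → Disjoint (P (j.succAbove i)) (P (j.succAbove i')) :=
      fun i i' hne => hdis _ _ fun h => hne (Fin.succAbove_right_injective h)
    rcases hmeet with hm | hm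
    · exact Or.inl (h.hasModel_comap hS hf (P := fun i => P (j.succAbove i)) h3 (fun i => hP _)
        hdis' (fun i i' hii => hadj _ _ hii) fun i => hm _ (Fin.succAbove_ne j i))
    · exact Or.inr (h.symm.hasModel_comap hS' hg (P := fun i => P (j.succAbove i)) h3
        (fun i => hP _) hdis' (fun i i' hii => hadj _ _ hii) fun i => hm _ (Fin.succAbove_ne j i))
  constructor
  · rintro ⟨K, P, hK, hP, hdis, hadj⟩
    obtain ⟨h1, h2, h3⟩ := key hK hP hdis hadj
    have h4 := (h.card_bags hS4 hP hdis hadj).1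
    by_contra hcon
    rw [not_or] at hcon
    have hp1 := fun h0 => hcon.1 (h1 h0)
    have hp2 := fun h0 => hcon.2 (h2 h0)
    clear h1 h2
    generalize #{i | ¬ (P i ∩ A).Nonempty} = p at *
    generalize #{i | ¬ (P i ∩ B).Nonempty} = q at *
    have : 1 ≤ p := Nat.pos_of_ne_zero hp1
    have : 1 ≤ q := Nat.pos_of_ne_zero hp2
    nlinarith
  · rintro ⟨K, P, hK, hP, hdis, hadj⟩
    obtain ⟨h1, h2, h3⟩ := key hK hP hdis hadj
    obtain ⟨h4, hnon⟩ := h.card_bags hS4 hP hdis hadj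
    by_contra hcon
    push Not at hcon
    obtain ⟨hc1, hc2, hc3, hc4⟩ := hcon
    have hp1 : #{i | ¬ (P i ∩ A).Nonempty} ≠ 0 := fun h0 => hc2 (h1 h0)
    have hp2 : #{i | ¬ (P i ∩ B).Nonempty} ≠ 0 := fun h0 => hc4 (h2 h0)
    have h5 : #{i | ¬ (P i ∩ A).Nonempty} = 1 ∨ #{i | ¬ (P i ∩ B).Nonempty} = 1 := by
      clear h1 h2
      generalize #{i | ¬ (P i ∩ A).Nonempty} = p at *
      generalize #{i | ¬ (P i ∩ B).Nonempty} = q at *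
      by_contra hne
      rw [not_or] at hne
      have : 2 ≤ p := by omega
      have : 2 ≤ q := by omega
      nlinarith
    rcases h5 with h5 | h5
    · obtain ⟨j, hj⟩ := card_eq_one.1 h5
      have hjA : ¬ (P j ∩ A).Nonempty := by
        have : j ∈ ({i | ¬ (P i ∩ A).Nonempty} : Finset (Fin 9)) := hj ▸ mem_singleton_self j
        exact (mem_filter.1 this).2
      have hcod : 4 ≤ codeg K univ j := by
        refine le_trans (b := #{i | ¬ (P i ∩ B).Nonempty}) (by omega) (card_le_codeg fun i hi => ?_)
        have := hnon j hjA i (mem_filter.1 hi).2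
        exact ⟨this.1.symm, this.2⟩
      refine (drop j hK hcod hP hdis hadj (Or.inl fun i hij => ?_)).elim hc1 hc3
      by_contra hiA
      have : i ∈ ({i | ¬ (P i ∩ A).Nonempty} : Finset (Fin 9)) := mem_filter.2 ⟨mem_univ i, hiA⟩
      rw [hj, mem_singleton] at this
      exact hij this
    · obtain ⟨j, hj⟩ := card_eq_one.1 h5
      have hjB : ¬ (P j ∩ B).Nonempty := by
        have : j ∈ ({i | ¬ (P i ∩ B).Nonempty} : Finset (Fin 9)) := hj ▸ mem_singleton_self j
        exact (mem_filter.1 this).2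
      have hcod : 4 ≤ codeg K univ j := by
        refine le_trans (b := #{i | ¬ (P i ∩ A).Nonempty}) (by omega) (card_le_codeg fun i hi => ?_)
        have := hnon i (mem_filter.1 hi).2 j hjB
        exact ⟨this.1, fun hji => this.2 hji.symm⟩
      refine (drop j hK hcod hP hdis hadj (Or.inr fun i hij => ?_)).elim hc1 hc3
      by_contra hiB
      have : i ∈ ({i | ¬ (P i ∩ B).Nonempty} : Finset (Fin 9)) := mem_filter.2 ⟨mem_univ i, hiB⟩
      rw [hj, mem_singleton] at this
      exact hij this

theorem IsSeparation.adjPairs_add [Fintype V] (h : IsSeparation G ∅ ∅ A B) :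
    adjPairs G univ univ + adjPairs G (A ∩ B) (A ∩ B) = adjPairs G A A + adjPairs G B B := by
  have h1 : (univ : Finset V) = A ∪ (B \ A) := by
    ext x
    have := h.cover x
    simp only [mem_univ, mem_union, mem_sdiff, true_iff]
    tauto
  have h2 : B = (A ∩ B) ∪ (B \ A) := by
    ext x
    simp only [mem_inter, mem_union, mem_sdiff]
    tauto
  have h3 : A = (A ∩ B) ∪ (A \ B) := by
    ext x
    simp only [mem_inter, mem_union, mem_sdiff]
    tauto
  have hd1 : Disjoint A (B \ A) := disjoint_sdiff
  have hd2 : Disjoint (A ∩ B) (B \ A) := disjoint_of_subset_left inter_subset_left hd1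
  have hd3 : Disjoint (A ∩ B) (A \ B) :=
    disjoint_of_subset_left inter_subset_right disjoint_sdiff
  have h4 : adjPairs G (A \ B) (B \ A) = 0 := by
    rw [adjPairs_eq_card, card_eq_zero, filter_eq_empty_iff]
    rintro ⟨x, y⟩ hxy
    simp only [mem_product, mem_sdiff] at hxy
    exact h.noEdge x hxy.1.1 hxy.1.2 y hxy.2.1 hxy.2.2
  have h5 : adjPairs G A (B \ A) = adjPairs G (A ∩ B) (B \ A) := by
    have := adjPairs_union_left G hd3 (B \ A)
    rwa [← h3, h4, add_zero] at this
  have h6 := adjPairs_union_self G hd1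
  have h7 := adjPairs_union_self G hd2
  rw [← h1] at h6
  rw [← h2] at h7
  omega

end CliqueSum

theorem adjPairs_completeEightMinusTwoIndependent :
    adjPairs completeEightMinusTwoIndependent univ univ = 52 := by
  rw [adjPairs_eq_card]
  have h1 : ∀ p : Fin 8 × Fin 8, completeEightMinusTwoIndependent.Adj p.1 p.2 ↔
      p.1 ≠ p.2 ∧ ¬ (s(p.1, p.2) = s(0, 1) ∨ s(p.1, p.2) = s(2, 3)) := by
    intro p
    simp [completeEightMinusTwoIndependent, SimpleGraph.deleteEdges_adj]
  have h2 : #{p : Fin 8 × Fin 8 | p.1 ≠ p.2 ∧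
      ¬ (s(p.1, p.2) = s(0, 1) ∨ s(p.1, p.2) = s(2, 3))} = 52 := by
    decide
  rw [← h2, univ_product_univ]
  congr 1
  ext p
  simp only [mem_filter, mem_univ, true_and, h1]

theorem not_hasModel_of_card_lt {V : Type*} [Fintype V] {G : SimpleGraph V} {t s : ℕ}
    (h : Fintype.card V < t) : ¬ HasModel G t s := by
  rintro ⟨K, B, -, hB, hdis, -⟩
  choose r hr using fun i => (hB i).1
  have hinj : Function.Injective r := fun i j hij => by
    by_contra hne
    exact disjoint_left.1 (hdis i j hne) (hr i) (hij ▸ hr j)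
  have := Fintype.card_le_of_injective r hinj
  rw [Fintype.card_fin] at this
  omega

/-- With as many bags as vertices every bag is a single vertex, so G itself misses at most s edges.
-/
theorem HasModel.le_adjPairs {V : Type*} [Fintype V] {G : SimpleGraph V} {t s : ℕ}
    (h : HasModel G t s) (ht : Fintype.card V = t) :
    t * t ≤ adjPairs G univ univ + 2 * s + t := by
  obtain ⟨K, B, hK, hB, hdis, hadj⟩ := h
  choose r hr using fun i => (hB i).1
  have hinj : Function.Injective r := fun i j hij => by
    by_contra hne
    exact disjoint_left.1 (hdis i j hne) (hr i) (hij ▸ hr j)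
  have hbij : Function.Bijective r :=
    (Fintype.bijective_iff_injective_and_card r).2 ⟨hinj, by rw [Fintype.card_fin, ht]⟩
  have hsing : ∀ i, ∀ x ∈ B i, x = r i := by
    intro i x hx
    obtain ⟨j, rfl⟩ := hbij.2 x
    by_contra hne
    exact disjoint_left.1 (hdis i j fun h => hne (h ▸ rfl)) hx (hr j)
  have h1 : K ≤ G.comap r := by
    intro i j hij
    obtain ⟨a, ha, b, hb, hab⟩ := hadj i j hij
    rw [hsing i a ha, hsing j b hb] at hab
    exact hab
  have h2 := adjPairs_mono h1 univ univ
  have h3 := adjPairs_add_coPairs K univ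
  have h4 := adjPairs_map G ⟨r, hinj⟩ univ univ
  have h5 : (univ : Finset (Fin t)).map ⟨r, hinj⟩ = univ := by
    ext x
    simpa using hbij.2 x
  rw [h5] at h4
  rw [card_univ, Fintype.card_fin] at h3
  have h6 : adjPairs (G.comap r) univ univ = adjPairs G univ univ := h4.symm
  omega

theorem isCockade_properties {V : Type u} {G : SimpleGraph V}
    (h : SimpleGraph.IsCockade completeEightMinusTwoIndependent 4 G) : ∀ [Fintype V],
    adjPairs G univ univ + 28 = 10 * Fintype.card V ∧ ¬ HasModel G 8 1 ∧ ¬ HasModel G 9 5 := by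
  induction h with
  | base G e =>
    intro _
    obtain ⟨e⟩ := e
    have hV := Fintype.card_congr e.toEquiv
    rw [Fintype.card_fin] at hV
    have hE : adjPairs G univ univ = 52 := by
      rw [← adjPairs_completeEightMinusTwoIndependent]
      have h1 := adjPairs_map completeEightMinusTwoIndependent e.toEquiv.toEmbedding univ univ
      rw [map_univ_equiv] at h1
      rw [h1]
      congr 1
      ext x y
      exact (e.map_adj_iff).symm
    refine ⟨by omega, fun hm => ?_, not_hasModel_of_card_lt (by omega)⟩
    have := hm.le_adjPairs hV
    omega
  | glue G₁ G₂ G h₁ h₂ K₁ K₂ hK₁ hK₂ f₁ f₂ cover overlap₁ overlap₂ hG ih₁ ih₂ =>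
    rename_i V₁ V₂ V
    intro _
    have : Fintype V₁ := Fintype.ofInjective f₁ f₁.injective
    have : Fintype V₂ := Fintype.ofInjective f₂ f₂.injective
    obtain ⟨hE₁, h8₁, h9₁⟩ := ih₁
    obtain ⟨hE₂, h8₂, h9₂⟩ := ih₂
    have hS1 : ∀ x, (∃ y, f₁ y = x) → (∃ y, f₂ y = x) → ∃ y ∈ K₁, f₁ y = x := fun x h1 h2 => by
      have : x ∈ Set.range f₁ ∩ Set.range f₂ := ⟨h1, h2⟩
      rw [overlap₁] at this
      exact this
    have hS2 : ∀ x, (∃ y, f₁ y = x) → (∃ y, f₂ y = x) → ∃ y ∈ K₂, f₂ y = x := fun x h1 h2 => by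
      have : x ∈ Set.range f₁ ∩ Set.range f₂ := ⟨h1, h2⟩
      rw [overlap₂] at this
      exact this
    have hadj : ∀ x y, G.Adj x y ↔ (∃ a b, G₁.Adj a b ∧ f₁ a = x ∧ f₁ b = y) ∨
        ∃ a b, G₂.Adj a b ∧ f₂ a = x ∧ f₂ b = y := by
      intro x y
      rw [hG, SimpleGraph.sup_adj, SimpleGraph.map_adj, SimpleGraph.map_adj]
    -- An edge of the second graph between vertices of the first has both ends in the identified
    -- clique, so it is already an edge of the first; likewise with the roles exchanged.
    have hc₁ : G.comap f₁ = G₁ := by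
      ext x y
      rw [SimpleGraph.comap_adj, hadj]
      constructor
      · rintro (⟨a, b, hab, ha, hb⟩ | ⟨a, b, hab, ha, hb⟩)
        · rwa [← f₁.injective ha, ← f₁.injective hb]
        · obtain ⟨x', hx', hxx⟩ := hS1 (f₁ x) ⟨x, rfl⟩ ⟨a, ha⟩
          obtain ⟨y', hy', hyy⟩ := hS1 (f₁ y) ⟨y, rfl⟩ ⟨b, hb⟩
          obtain rfl := f₁.injective hxx
          obtain rfl := f₁.injective hyy
          refine hK₁.1 hx' hy' ?_
          rintro rfl
          exact hab.ne (f₂.injective (ha.trans hb.symm))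
      · exact fun h => Or.inl ⟨x, y, h, rfl, rfl⟩
    have hc₂ : G.comap f₂ = G₂ := by
      ext x y
      rw [SimpleGraph.comap_adj, hadj]
      constructor
      · rintro (⟨a, b, hab, ha, hb⟩ | ⟨a, b, hab, ha, hb⟩)
        · obtain ⟨x', hx', hxx⟩ := hS2 (f₂ x) ⟨a, ha⟩ ⟨x, rfl⟩
          obtain ⟨y', hy', hyy⟩ := hS2 (f₂ y) ⟨b, hb⟩ ⟨y, rfl⟩
          obtain rfl := f₂.injective hxx
          obtain rfl := f₂.injective hyy
          refine hK₂.1 hx' hy' ?_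
          rintro rfl
          exact hab.ne (f₁.injective (ha.trans hb.symm))
        · rwa [← f₂.injective ha, ← f₂.injective hb]
      · exact fun h => Or.inr ⟨x, y, h, rfl, rfl⟩
    have hA : ∀ x, x ∈ univ.map f₁ ↔ ∃ y, f₁ y = x := fun x => by simp
    have hB : ∀ x, x ∈ univ.map f₂ ↔ ∃ y, f₂ y = x := fun x => by simp
    have hsep : IsSeparation G ∅ ∅ (univ.map f₁) (univ.map f₂) := by
      refine ⟨fun x => ?_, by simp, by simp, fun x hx hx' y hy hy' hxy => ?_⟩
      · rw [hA, hB]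
        have : x ∈ Set.range f₁ ∪ Set.range f₂ := cover ▸ Set.mem_univ x
        exact this
      · rw [hadj] at hxy
        rw [hB] at hx'
        rw [hA] at hy'
        rcases hxy with ⟨a, b, -, -, hb⟩ | ⟨a, b, -, ha, -⟩
        · exact hy' ⟨b, hb⟩
        · exact hx' ⟨a, ha⟩
    have hinter : univ.map f₁ ∩ univ.map f₂ = K₁.map f₁ := by
      ext x
      rw [mem_inter, hA, hB, mem_map]
      constructor
      · rintro ⟨h1, h2⟩
        exact hS1 x h1 h2
      · rintro ⟨y, hy, rfl⟩
        have : f₁ y ∈ Set.range f₁ ∩ Set.range f₂ := by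
          rw [overlap₁]
          exact ⟨y, hy, rfl⟩
        exact this
    have hS4 : #(univ.map f₁ ∩ univ.map f₂) = 4 := by rw [hinter, card_map, hK₁.2]
    have hS : ∀ x ∈ univ.map f₁ ∩ univ.map f₂, ∀ y ∈ univ.map f₁ ∩ univ.map f₂, x ≠ y →
        G.Adj x y := by
      intro x hx y hy hxy
      rw [hinter, mem_map] at hx hy
      obtain ⟨a, ha, rfl⟩ := hx
      obtain ⟨b, hb, rfl⟩ := hy
      exact (hadj _ _).2 (Or.inl ⟨a, b, hK₁.1 ha hb fun h => hxy (h ▸ rfl), rfl, rfl⟩)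
    refine ⟨?_, ?_⟩
    -- The four vertices and six edges of the clique are shared: 5(n + 4) - 28 - 6 = 5n - 14.
    · have h1 := hsep.adjPairs_add
      have h2 := card_union_add_card_inter (univ.map f₁) (univ.map f₂)
      have h3 : univ.map f₁ ∪ univ.map f₂ = (univ : Finset V) := eq_univ_of_forall fun x =>
        mem_union.2 (hsep.cover x)
      have h4 := adjPairs_add_coPairs G (univ.map f₁ ∩ univ.map f₂)
      have h5 := coPairs_le_of_codeg_le (G := G) (S := univ.map f₁ ∩ univ.map f₂) (d := 0)
        fun x hx => by
          rw [Nat.le_zero, codeg_eq_zero_iff]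
          exact fun y hy hyx => hS x hx y hy hyx.symm
      rw [adjPairs_map, adjPairs_map, hc₁, hc₂] at h1
      rw [h3, hS4, card_map, card_map, card_univ, card_univ, card_univ] at h2
      rw [hS4] at h4
      omega
    · obtain ⟨h1, h2⟩ := hsep.hasModel_of_sum hS hS4 rfl rfl
      rw [hc₁, hc₂] at h1 h2
      refine ⟨fun hm => ?_, fun hm => ?_⟩
      · rcases h1 hm with h | h
        exacts [h8₁ h, h8₂ h]
      · rcases h2 hm with h | h | h | h
        exacts [h8₁ h, h9₁ h, h8₂ h, h9₂ h]

end
end DenseMinor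

theorem theoremt :
    (∀ (V : Type u) [Finite V] (G : SimpleGraph V), 9 ≤ Nat.card V →
      5 * Nat.card V ≤ G.edgeSet.ncard + 14 → G.HasCompleteMinusMinor 9 6) ∧
    (∀ (V : Type u) [Finite V] (G : SimpleGraph V),
      SimpleGraph.IsCockade completeEightMinusTwoIndependent 4 G →
        G.edgeSet.ncard + 14 = 5 * Nat.card V ∧ ¬ G.HasCompleteMinusMinor 9 5) := by
  refine ⟨fun V _ G hV hE => DenseMinor.hasCompleteMinusMinor_nine_six G hV hE,
    fun V _ G hG => ?_⟩
  have := Fintype.ofFinite V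
  obtain ⟨hE, -, h9⟩ := DenseMinor.isCockade_properties hG
  refine ⟨?_, fun h => h9 (DenseMinor.hasModel_of_hasCompleteMinusMinor h)⟩
  rw [Nat.card_eq_fintype_card]
  have := DenseMinor.ncard_edgeSet G
  omega
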